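/- For a real number $k$ and $x>0$ put $u_0(x)=1$, $u_1(x)=x^k$, $u_6(x)=x^{3k-2}$, $u_5(x)=x^{2k-2}$, $u_3(x)=x^{k-2}$, $u_{10}(x)=(1+x^{2k-2})(x+kx^{2k-1})$, $u_{12}(x)=(1+x^{2k-2})(x+kx^{2k-1})\arctan(x^{k-1})$, and let $\mathcal G_9^k=[u_0,u_1,u_6,u_5,u_3,u_{10},u_{12}]$. Let $\mathcal Z(\mathcal G_9^k)$ be the maximum number of isolated zeros in $(0,\infty)$, counted with multiplicity, of a function in the real linear span of $\mathcal G_9^k$. Let \[ \begin{aligned} q_1(x)={}&2x^6-153x^5+894x^4-1625x^3+1234x^2-444x+48,\\ q_2(x)={}&177586560x^{17}-1447424208x^{16}+5969663136x^{15}-29387373904x^{14}+129626832188x^{13}\\ &-293774330511x^{12}+102470736381x^{11}+1027573184492x^{10}-2645532232771x^9\\ &+3259827826136x^8-2344796073539x^7+997977148820x^6-227233713561x^5\\ &+15757275163x^4+3311923726x^3-563207524x^2+11249208x+19744,\\ q_3(x)={}&862x^5-4831x^4+8308x^3-5186x^2+974x+1. \end{aligned} \] Then $q_1$ has exactly one root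 $k_1$ in $(0,\frac15)$; $q_2$ has exactly one root in each of $(0,\frac15)$, $(\frac15,\frac13)$, $(\frac32,2)$ and $(3,4)$, denoted $k_0,k_2,k_3,k_5$ respectively; $q_3$ has exactly one root $k_4$ in $(3,4)$; and $k_1,\dots,k_5$ are irrational. Moreover: For every $k\in(0,5]\setminus\{k_0,k_1,k_2,k_3,k_4,k_5,2,1,\frac32,\frac23\}$ one has $6\le\mathcal Z(\mathcal G_9^k)\le 11$. More precisely: (1) $\mathcal Z(\mathcal G_9^k)=6$ for $k\in(\frac15,k_2)\cup(\frac23,\frac34)\cup[\frac45,1)\cup(1,\frac43]\cup(\frac32,k_3)$; (2) $\mathcal Z(\mathcal G_9^k)=7$ for $k\in(k_1,\frac15)\cup(\frac13,\frac12)\cup(\frac12,\frac23)\cup(\frac34,\frac45)\cup(\frac43,\frac32)\cup(k_5,5]$; (3) $7\le\mathcal Z(\mathcal G_9^k)\le 8$ for $k\in(k_2,\frac13)\cup(k_3,2)\cup(2,3)$; (4) $7\le\mathcal Z(\mathcal G_9^k)\le 9$ for $k\in(k_4,k_5)$. -/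

import Mathlib

open scoped Topology

namespace ChebyshevFamily

noncomputable section

/-- `x` is an isolated zero of `f`. -/
def IsIsolatedZero (f : ℝ → ℝ) (x : ℝ) : Prop :=
  f x = 0 ∧ ∀ᶠ y in 𝓝[≠] x, f y ≠ 0

/-- The order of vanishing of `f` at `x`, for `f` smooth near `x`: the supremum of all `m` such that
`f` and its derivatives of order less than `m` vanish at `x`. -/
def zeroMult (f : ℝ → ℝ) (x : ℝ) : ℕ∞ :=
  ⨆ (m : ℕ) (_ : ∀ i < m, iteratedDeriv i f x = 0), (m : ℕ∞)

/-- The number of isolated zeros of `f` in `(0, ∞)`, counted with multiplicity. -/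
def numPosZeros (f : ℝ → ℝ) : ℕ∞ :=
  ⨆ (S : Finset ℝ) (_ : ∀ x ∈ S, 0 < x ∧ IsIsolatedZero f x), ∑ x ∈ S, zeroMult f x

/-- `𝒵(F)`: the maximum of the number of isolated zeros in `(0, ∞)`, counted with multiplicity,
over the functions in the real span of the family `F`. A supremum in `ℕ∞` of a nonempty family
that is finite is attained, so it is a maximum as soon as it is finite. -/
def maxPosZeros {n : ℕ} (F : Fin n → ℝ → ℝ) : ℕ∞ :=
  ⨆ f ∈ Submodule.span ℝ (Set.range F), numPosZeros f

/-- The constant function `1`. -/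
def u0 (_k : ℝ) : ℝ → ℝ := fun _ => 1

/-- `x ^ k`. -/
def u1 (k : ℝ) : ℝ → ℝ := fun x => x ^ k

/-- `x ^ (k - 2)`. -/
def u3 (k : ℝ) : ℝ → ℝ := fun x => x ^ (k - 2)

/-- `x ^ (2 k - 2)`. -/
def u5 (k : ℝ) : ℝ → ℝ := fun x => x ^ (2 * k - 2)

/-- `x ^ (3 k - 2)`. -/
def u6 (k : ℝ) : ℝ → ℝ := fun x => x ^ (3 * k - 2)

/-- `(1 + x ^ (2 k - 2)) (x + k x ^ (2 k - 1))`. -/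
def u10 (k : ℝ) : ℝ → ℝ := fun x => (1 + x ^ (2 * k - 2)) * (x + k * x ^ (2 * k - 1))

/-- `(1 + x ^ (2 k - 2)) (x + k x ^ (2 k - 1)) arctan (x ^ (k - 1))`. -/
def u12 (k : ℝ) : ℝ → ℝ := fun x =>
  (1 + x ^ (2 * k - 2)) * (x + k * x ^ (2 * k - 1)) * Real.arctan (x ^ (k - 1))

/-- The ordered family `[u₀, u₁, u₆, u₅, u₃, u₁₀, u₁₂]` with parameter `k`. -/
def G9 (k : ℝ) : Fin 7 → ℝ → ℝ :=
  ![u0 k, u1 k, u6 k, u5 k, u3 k, u10 k, u12 k]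

/-- The polynomial `q₁`. -/
def q1 (x : ℝ) : ℝ :=
  2 * x ^ 6 - 153 * x ^ 5 + 894 * x ^ 4 - 1625 * x ^ 3 + 1234 * x ^ 2 - 444 * x + 48

/-- The polynomial `q₂`. -/
def q2 (x : ℝ) : ℝ :=
  177586560 * x ^ 17 - 1447424208 * x ^ 16 + 5969663136 * x ^ 15 - 29387373904 * x ^ 14
    + 129626832188 * x ^ 13 - 293774330511 * x ^ 12 + 102470736381 * x ^ 11
    + 1027573184492 * x ^ 10 - 2645532232771 * x ^ 9 + 3259827826136 * x ^ 8
    - 2344796073539 * x ^ 7 + 997977148820 * x ^ 6 - 227233713561 * x ^ 5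
    + 15757275163 * x ^ 4 + 3311923726 * x ^ 3 - 563207524 * x ^ 2 + 11249208 * x + 19744

/-- The polynomial `q₃`. -/
def q3 (x : ℝ) : ℝ :=
  862 * x ^ 5 - 4831 * x ^ 4 + 8308 * x ^ 3 - 5186 * x ^ 2 + 974 * x + 1

/-- `r` is the only root of `q` in the open interval `(a, b)`. -/
def IsTheRootIn (q : ℝ → ℝ) (a b r : ℝ) : Prop :=
  {x : ℝ | x ∈ Set.Ioo a b ∧ q x = 0} = {r}

end

end ChebyshevFamily

open ChebyshevFamily

namespace ChebyshevFamily

open Set Filter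

/-! Put t = x^(k-1) and divide by x. Five members of the family become powers of t, and the other
two become (1+t²)(1+kt²) and (1+t²)(1+kt²) arctan t. Up to nonvanishing factors, an Euler operator a
t d/dt + b is the derivative of t^(b/a) f, so by Rolle a function has at most one more zero, with
multiplicity, than its image (`ZerosLE.of_eulerOp`). Five such operators kill the five powers and
send the other two functions to U = Q(t²) and V = Q(t²) arctan t + t R(t²)/(1+t²)⁴. If every
nontrivial αU + βV has at most N positive zeros, the family has at most N + 5 (`maxPosZeros_le`).

Conversely, the integration constants can be chosen so that a zero of order n of αU + βV lifts to a
zero of order n + 5 (`le_maxPosZeros`). The order n = 1 can be forced at any point, which gives the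
lower bound 6. The order n = 2 can be forced at a zero of the Wronskian UV' - U'V = 32 t⁴
E(t²)/(1+t²)⁵, where E is a quartic in s = t², so a positive root of E gives the lower bound 7.

It remains to bound the number of solutions of V/U = c. The derivative of V/U has the sign of E, so
on an interval without zeros of U there is at most one more solution than E has zeros. The zeros of
U cut (0, ∞) into such intervals. They are not zeros of V - cU, because dividing R by Q leaves a
remainder s²(A + Bs) that does not vanish there. The sharp counts also use V/U = 0 at t = 0 and V/U
→ π/2 at infinity: the branches of V/U then have constrained ranges, and a level met by one branch
is often missed by another. On a middle branch between two zeros of Q these constraints come from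
splitting V/U into a fixed increasing function `primPhi` and a rational term with the sign of (A +
Bs)/Q.

What is left is the signs of polynomials in k and s. The discriminant of E is q₂ times factors with
known rational roots and a factor positive on (0, 5], so E acquires a double root only at roots of
q₂ or at those rational values. The discriminant of Q is -(2k-1)q₃. Between critical parameters,
signs are certified by a Bernstein-type subdivision checker evaluated in the kernel. Near the roots
of q₂, where direct certificates fail, a sign is transported in k by the absence of double zeros
(`neg_of_no_double_zero`). For (k₁, 1/5) the argument covers all of [17/100, 1/5). -/

/-- The zeros of `f` in `I`, counted with multiplicity, number at most `n`. -/
def ZerosLE (f : ℝ → ℝ) (I : Set ℝ) (n : ℕ) : Prop :=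
  ∀ S : Finset ℝ, (∀ x ∈ S, x ∈ I) → ∑ x ∈ S, analyticOrderAt f x ≤ n

/-! ### Zero counts with multiplicity, and Rolle's theorem -/

namespace ZerosLE

variable {f g : ℝ → ℝ} {I J : Set ℝ} {m n : ℕ}

theorem mono_nat (h : ZerosLE f I m) (hmn : m ≤ n) : ZerosLE f I n := fun S hS =>
  (h S hS).trans (by exact_mod_cast hmn)

theorem mono_set (h : ZerosLE f I n) (hJ : J ⊆ I) : ZerosLE f J n := fun S hS =>
  h S fun x hx => hJ (hS x hx)

theorem of_order_eq (h : ZerosLE f I n) (hfg : ∀ x ∈ I, analyticOrderAt g x = analyticOrderAt f x) :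
    ZerosLE g I n := fun S hS => by
  rw [Finset.sum_congr rfl fun x hx => hfg x (hS x hx)]
  exact h S hS

theorem congr (h : ZerosLE f I n) (hI : IsOpen I) (hfg : ∀ x ∈ I, g x = f x) : ZerosLE g I n :=
  h.of_order_eq fun x hx => analyticOrderAt_congr <| by
    filter_upwards [hI.mem_nhds hx] with y hy using hfg y hy

theorem of_ne_zero (h : ∀ x ∈ I, f x ≠ 0) : ZerosLE f I n := fun S hS => by
  rw [Finset.sum_eq_zero fun x hx => analyticOrderAt_eq_zero.2 (Or.inr (h x (hS x hx)))]
  exact zero_le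

theorem order_mul {x : ℝ} (hf : AnalyticAt ℝ f x) (hg : AnalyticAt ℝ g x) (hx : g x ≠ 0) :
    analyticOrderAt (fun y => g y * f y) x = analyticOrderAt f x := by
  have := analyticOrderAt_mul hg hf
  rw [hg.analyticOrderAt_eq_zero.2 hx, zero_add] at this
  exact this

theorem mul_left (h : ZerosLE f I n) (hf : AnalyticOnNhd ℝ f I) (hg : AnalyticOnNhd ℝ g I)
    (hg0 : ∀ x ∈ I, g x ≠ 0) : ZerosLE (fun y => g y * f y) I n :=
  h.of_order_eq fun x hx => order_mul (hf x hx) (hg x hx) (hg0 x hx)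

theorem of_mul_left (h : ZerosLE (fun y => g y * f y) I n) (hf : AnalyticOnNhd ℝ f I)
    (hg : AnalyticOnNhd ℝ g I) (hg0 : ∀ x ∈ I, g x ≠ 0) : ZerosLE f I n :=
  h.of_order_eq fun x hx => (order_mul (hf x hx) (hg x hx) (hg0 x hx)).symm

theorem neg (h : ZerosLE f I n) : ZerosLE (fun x => -f x) I n :=
  h.of_order_eq fun _ _ => analyticOrderAt_neg

theorem union (hf : ZerosLE f I m) (hg : ZerosLE f J n) {K : Set ℝ} (hK : K ⊆ I ∪ J) :
    ZerosLE f K (m + n) := fun S hS => by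
  classical
  rw [← Finset.sum_filter_add_sum_filter_not S (· ∈ I)]
  push_cast
  refine add_le_add (hf _ fun x hx => (Finset.mem_filter.1 hx).2) (hg _ fun x hx => ?_)
  have hx' := Finset.mem_filter.1 hx
  exact (hK (hS x hx'.1)).resolve_left hx'.2

/-- A nonvanishing derivative of `u` preserves orders of vanishing, and injectivity keeps distinct
zeros distinct. -/
theorem comp (h : ZerosLE f J n) {u : ℝ → ℝ} (hu : ∀ x ∈ I, u x ∈ J) (hinj : InjOn u I)
    (hua : ∀ x ∈ I, AnalyticAt ℝ u x) (hu' : ∀ x ∈ I, deriv u x ≠ 0) :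
    ZerosLE (f ∘ u) I n := fun S hS => by
  classical
  rw [Finset.sum_congr rfl fun x hx =>
    analyticOrderAt_comp_of_deriv_ne_zero (hua x (hS x hx)) (hu' x (hS x hx))]
  rw [← Finset.sum_image (f := fun y => analyticOrderAt f y) (s := S) (g := u)]
  · refine h _ fun y hy => ?_
    obtain ⟨x, hx, rfl⟩ := Finset.mem_image.1 hy
    exact hu x (hS x hx)
  · exact fun x hx y hy hxy => hinj (hS x hx) (hS y hy) hxy

theorem diff_singleton (h : ZerosLE f I (n + 1)) {x : ℝ} (hx : x ∈ I) (hf : AnalyticAt ℝ f x)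
    (hfx : f x = 0) : ZerosLE f (I \ {x}) n := fun S hS => by
  classical
  have hxS : x ∉ S := fun hxS => (hS x hxS).2 rfl
  have h1 := h (insert x S) fun y hy => by
    rcases Finset.mem_insert.1 hy with rfl | hy
    · exact hx
    · exact (hS y hy).1
  rw [Finset.sum_insert hxS] at h1
  have h2 : 1 ≤ analyticOrderAt f x :=
    Order.one_le_iff_ne_zero.2 (hf.analyticOrderAt_ne_zero.2 hfx)
  have h3 : 1 + ∑ y ∈ S, analyticOrderAt f y ≤ 1 + (n : ℕ∞) := by
    refine (add_le_add_left h2 _).trans (h1.trans (le_of_eq ?_))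
    push_cast
    rw [add_comm]
  exact (ENat.add_le_add_iff_left (by simp)).1 h3

/-- A finite count rules out functions vanishing identically near a point; this is how zeros are
later seen to be isolated. -/
theorem ne_top (h : ZerosLE f I n) {x : ℝ} (hx : x ∈ I) : analyticOrderAt f x ≠ ⊤ := by
  have := h {x} (by simpa using hx)
  simp only [Finset.sum_singleton] at this
  exact ne_top_of_le_ne_top (by simp) this

/-- At each zero the derivative has order one less, so r distinct zeros lose r in total. The r - 1
zeros of the derivative lying strictly between consecutive zeros of `f` win back all but one. -/
theorem rolle (h : ZerosLE (deriv f) I n) (hI : I.OrdConnected) (hf : AnalyticOnNhd ℝ f I) :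
    ZerosLE f I (n + 1) := by
  classical
  have order_succ : ∀ x ∈ I, f x = 0 →
      analyticOrderAt f x = analyticOrderAt (deriv f) x + 1 := fun x hx hfx => by
    simpa [hfx] using (hf x hx).analyticOrderAt_deriv_add_one.symm
  -- Induction adds zeros from left to right. Recording that `T` does not extend beyond `S`
  -- guarantees that the next Rolle point, to the right of `S`, is new.
  have key : ∀ S : Finset ℝ, (∀ x ∈ S, x ∈ I ∧ f x = 0) → S = ∅ ∨
      ∃ T : Finset ℝ, (∀ t ∈ T, t ∈ I ∧ ∃ x ∈ S, t ≤ x) ∧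
        ∑ x ∈ S, analyticOrderAt f x ≤ ∑ x ∈ T, analyticOrderAt (deriv f) x + 1 := by
    intro S
    induction S using Finset.induction_on_max with
    | empty => exact fun _ => Or.inl rfl
    | insert a S hmax ih =>
      intro hS
      right
      have haS : a ∉ S := fun h => lt_irrefl _ (hmax a h)
      obtain ⟨haI, hfa⟩ := hS a (Finset.mem_insert_self _ _)
      rcases ih fun x hx => hS x (Finset.mem_insert_of_mem hx) with rfl | ⟨T, hT, hle⟩
      · refine ⟨{a}, fun t ht => ?_, ?_⟩
        · rw [Finset.mem_singleton] at ht
          subst ht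
          exact ⟨haI, t, by simp, le_rfl⟩
        · simp [order_succ a haI hfa]
      rcases S.eq_empty_or_nonempty with rfl | hne
      · refine ⟨{a}, fun t ht => ?_, ?_⟩
        · rw [Finset.mem_singleton] at ht
          subst ht
          exact ⟨haI, t, by simp, le_rfl⟩
        · simp [order_succ a haI hfa]
      set b := S.max' hne with hb
      have hbS : b ∈ S := S.max'_mem hne
      obtain ⟨hbI, hfb⟩ := hS b (Finset.mem_insert_of_mem hbS)
      have hba : b < a := hmax b hbS
      have hsub : Icc b a ⊆ I := hI.out hbI haI
      obtain ⟨ξ, hξ, hξ0⟩ := exists_deriv_eq_zero hba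
        (fun x hx => (hf x (hsub hx)).continuousAt.continuousWithinAt) (hfb.trans hfa.symm)
      have hξI : ξ ∈ I := hsub ⟨hξ.1.le, hξ.2.le⟩
      have hTb : ∀ t ∈ T, t ≤ b := fun t ht => by
        obtain ⟨-, x, hx, htx⟩ := hT t ht
        exact htx.trans (S.le_max' x hx)
      have hξT : ξ ∉ T := fun h => absurd (hTb ξ h) (not_le.2 hξ.1)
      have haT : a ∉ insert ξ T := fun h => by
        rcases Finset.mem_insert.1 h with h | h
        · exact hξ.2.ne h.symm
        · exact absurd (hTb a h) (not_le.2 hba)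
      refine ⟨insert a (insert ξ T), fun t ht => ?_, ?_⟩
      · rcases Finset.mem_insert.1 ht with rfl | ht
        · exact ⟨haI, t, by simp, le_rfl⟩
        rcases Finset.mem_insert.1 ht with rfl | ht
        · exact ⟨hξI, a, by simp, hξ.2.le⟩
        · exact ⟨(hT t ht).1, b, Finset.mem_insert_of_mem hbS, hTb t ht⟩
      · rw [Finset.sum_insert haS, Finset.sum_insert haT, Finset.sum_insert hξT,
          order_succ a haI hfa]
        have h1 : 1 ≤ analyticOrderAt (deriv f) ξ :=
          Order.one_le_iff_ne_zero.2 ((hf ξ hξI).deriv.analyticOrderAt_ne_zero.2 hξ0)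
        calc analyticOrderAt (deriv f) a + 1 + ∑ x ∈ S, analyticOrderAt f x
            ≤ analyticOrderAt (deriv f) a + analyticOrderAt (deriv f) ξ
              + (∑ x ∈ T, analyticOrderAt (deriv f) x + 1) := by gcongr
          _ = _ := by ring
  intro S hS
  -- Points where `f` does not vanish have order 0 and may be dropped.
  have h1 : ∑ x ∈ S, analyticOrderAt f x = ∑ x ∈ S with f x = 0, analyticOrderAt f x := by
    rw [Finset.sum_filter_of_ne]
    exact fun x hx hne => apply_eq_zero_of_analyticOrderAt_ne_zero hne
  rw [h1]
  rcases key (S.filter (f · = 0)) fun x hx =>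
    ⟨hS x (Finset.mem_filter.1 hx).1, (Finset.mem_filter.1 hx).2⟩ with h0 | ⟨T, hT, hle⟩
  · simp [h0]
  · refine hle.trans ?_
    push_cast
    gcongr
    exact h T fun t ht => (hT t ht).1

end ZerosLE

/-- Each side is at least m exactly when the first m derivatives vanish; comparison with naturals
also covers the value `⊤`. -/
theorem zeroMult_eq_analyticOrderAt {f : ℝ → ℝ} {x : ℝ} (hf : AnalyticAt ℝ f x) :
    zeroMult f x = analyticOrderAt f x := by
  refine le_antisymm (iSup₂_le fun m hm =>
    (natCast_le_analyticOrderAt_iff_iteratedDeriv_eq_zero hf).2 hm) ?_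
  refine ENat.forall_natCast_le_iff_le.1 fun m hm => ?_
  exact le_iSup₂_of_le m ((natCast_le_analyticOrderAt_iff_iteratedDeriv_eq_zero hf).1 hm) le_rfl

/-! ### Euler operators and their effect on zeros -/

/-- The first order Euler operator `a t d/dt + b`. -/
noncomputable def eulerOp (a b : ℝ) (f : ℝ → ℝ) : ℝ → ℝ := fun t => a * (t * deriv f t) + b * f t

theorem eulerOp_analytic (a b : ℝ) {f : ℝ → ℝ} {I : Set ℝ} (hf : AnalyticOnNhd ℝ f I) :
    AnalyticOnNhd ℝ (eulerOp a b f) I := fun t ht => by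
  have h1 := hf t ht
  have h2 := h1.deriv
  unfold eulerOp
  fun_prop

theorem eulerOp_congr (a b : ℝ) {f g : ℝ → ℝ} {I : Set ℝ} (hI : IsOpen I) (h : EqOn f g I) :
    EqOn (eulerOp a b f) (eulerOp a b g) I := fun t ht => by
  have : f =ᶠ[𝓝 t] g := by filter_upwards [hI.mem_nhds ht] with y hy using h hy
  simp only [eulerOp, this.deriv_eq, h ht]

theorem eulerOp_of_hasDerivAt (a b : ℝ) {f : ℝ → ℝ} {f' t : ℝ} (hf : HasDerivAt f f' t) :
    eulerOp a b f t = a * (t * f') + b * f t := by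
  rw [eulerOp, hf.deriv]

theorem analyticAt_rpow (p : ℝ) {t : ℝ} (ht : 0 < t) : AnalyticAt ℝ (fun y : ℝ => y ^ p) t :=
  (Real.contDiffAt_rpow_const_of_ne ht.ne').analyticAt

/-- t^(b/a) is the integrating factor of a t f' + b f; this makes Rolle's theorem applicable to
Euler operators. -/
theorem deriv_rpow_mul {a b : ℝ} (ha : a ≠ 0) {f : ℝ → ℝ} {t : ℝ} (ht : 0 < t)
    (hf : AnalyticAt ℝ f t) :
    deriv (fun y => y ^ (b / a) * f y) t = t ^ (b / a - 1) / a * eulerOp a b f t := by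
  have h1 : HasDerivAt (fun y : ℝ => y ^ (b / a)) (b / a * t ^ (b / a - 1)) t :=
    Real.hasDerivAt_rpow_const (Or.inl ht.ne')
  have h2 := h1.mul hf.differentiableAt.hasDerivAt
  have h3 : t ^ (b / a) = t ^ (b / a - 1) * t := by
    rw [← Real.rpow_add_one ht.ne']
    congr 1
    ring
  have h4 : (fun y : ℝ => y ^ (b / a) * f y) = (fun y : ℝ => y ^ (b / a)) * f := rfl
  rw [h4, h2.deriv, h3, eulerOp]
  field_simp
  ring

theorem ZerosLE.of_eulerOp {a b : ℝ} (ha : a ≠ 0) {f : ℝ → ℝ} {I : Set ℝ} {n : ℕ}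
    (hI : I.OrdConnected) (hpos : ∀ t ∈ I, 0 < t) (hopen : IsOpen I) (hf : AnalyticOnNhd ℝ f I)
    (h : ZerosLE (eulerOp a b f) I n) : ZerosLE f I (n + 1) := by
  have hr : ∀ p : ℝ, AnalyticOnNhd ℝ (fun y : ℝ => y ^ p) I := fun p t ht =>
    analyticAt_rpow p (hpos t ht)
  have h1 : ZerosLE (fun y => y ^ (b / a - 1) / a * eulerOp a b f y) I n :=
    h.mul_left (eulerOp_analytic a b hf)
      (fun t ht => ((hr _ t ht).div analyticAt_const ha))
      (fun t ht => div_ne_zero (Real.rpow_pos_of_pos (hpos t ht) _).ne' ha)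
  have h2 : ZerosLE (deriv fun y => y ^ (b / a) * f y) I n :=
    h1.congr hopen fun t ht => deriv_rpow_mul ha (hpos t ht) (hf t ht)
  exact (h2.rolle hI ((hr _).mul hf)).of_mul_left hf (hr _)
    fun t ht => (Real.rpow_pos_of_pos (hpos t ht) _).ne'

/-- The integrating factor turns this into the drop of the order by exactly one under
differentiation. It is the counterpart of `ZerosLE.of_eulerOp` used for lower bounds. -/
theorem order_of_eulerOp {a b : ℝ} (ha : a ≠ 0) {f : ℝ → ℝ} {t : ℝ} (ht : 0 < t)
    (hf : AnalyticAt ℝ f t) (hft : f t = 0) :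
    analyticOrderAt (eulerOp a b f) t + 1 = analyticOrderAt f t := by
  have hr : ∀ p : ℝ, AnalyticAt ℝ (fun y : ℝ => y ^ p) t := fun p => analyticAt_rpow p ht
  have hp : ∀ p : ℝ, t ^ p ≠ 0 := fun p => (Real.rpow_pos_of_pos ht _).ne'
  have hE : AnalyticAt ℝ (eulerOp a b f) t :=
    eulerOp_analytic a b (I := {t}) (fun y hy => by rwa [mem_singleton_iff.1 hy]) t rfl
  have h1 : analyticOrderAt (deriv fun y => y ^ (b / a) * f y) t
      = analyticOrderAt (eulerOp a b f) t := by
    rw [← ZerosLE.order_mul hE ((hr (b / a - 1)).div analyticAt_const ha) (div_ne_zero (hp _) ha)]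
    refine analyticOrderAt_congr ?_
    filter_upwards [hf.eventually_analyticAt, lt_mem_nhds ht] with y hy hy0
    exact deriv_rpow_mul ha hy0 hy
  rw [← ZerosLE.order_mul hf (hr (b / a)) (hp _), ← h1]
  have := AnalyticAt.analyticOrderAt_deriv_add_one (f := fun y => y ^ (b / a) * f y)
    ((hr (b / a)).mul hf)
  simpa only [hft, mul_zero, sub_zero] using this

/-- Composition of the Euler operators in a list, the last one being applied first. -/
noncomputable def eulerOps (l : List (ℝ × ℝ)) (f : ℝ → ℝ) : ℝ → ℝ :=
  l.foldr (fun ab g => eulerOp ab.1 ab.2 g) f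

/-- The factor by which `eulerOps l` multiplies `t ^ p`. -/
noncomputable def eulerSymbol (l : List (ℝ × ℝ)) (p : ℝ) : ℝ :=
  (l.map fun ab => ab.1 * p + ab.2).prod

theorem eulerOps_analytic (l : List (ℝ × ℝ)) {f : ℝ → ℝ} {I : Set ℝ} (hf : AnalyticOnNhd ℝ f I) :
    AnalyticOnNhd ℝ (eulerOps l f) I := by
  induction l with
  | nil => exact hf
  | cons ab l ih => exact eulerOp_analytic _ _ ih

theorem eulerOp_sum {ι : Type*} (a b : ℝ) (s : Finset ι) (c : ι → ℝ) (f : ι → ℝ → ℝ) {t : ℝ}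
    (hf : ∀ i ∈ s, AnalyticAt ℝ (f i) t) :
    eulerOp a b (fun y => ∑ i ∈ s, c i * f i y) t = ∑ i ∈ s, c i * eulerOp a b (f i) t := by
  have h : HasDerivAt (fun y => ∑ i ∈ s, c i * f i y) (∑ i ∈ s, c i * deriv (f i) t) t :=
    HasDerivAt.fun_sum fun i hi => (hf i hi).differentiableAt.hasDerivAt.const_mul (c i)
  rw [eulerOp_of_hasDerivAt a b h]
  simp only [eulerOp, Finset.mul_sum, ← Finset.sum_add_distrib]
  exact Finset.sum_congr rfl fun i _ => by ring

theorem eulerOps_sum {ι : Type*} (l : List (ℝ × ℝ)) (s : Finset ι) (c : ι → ℝ) (f : ι → ℝ → ℝ)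
    {I : Set ℝ} (hI : IsOpen I) (hf : ∀ i ∈ s, AnalyticOnNhd ℝ (f i) I) :
    EqOn (eulerOps l fun y => ∑ i ∈ s, c i * f i y) (fun y => ∑ i ∈ s, c i * eulerOps l (f i) y)
      I := by
  induction l with
  | nil => exact fun _ _ => rfl
  | cons ab l ih =>
    intro t ht
    have h := eulerOp_congr ab.1 ab.2 hI ih ht
    refine h.trans ?_
    rw [eulerOp_sum _ _ _ _ _ fun i hi => eulerOps_analytic l (hf i hi) t ht]
    rfl

theorem eulerOp_rpow (a b p : ℝ) {t : ℝ} (ht : 0 < t) :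
    eulerOp a b (fun y => y ^ p) t = (a * p + b) * t ^ p := by
  rw [eulerOp_of_hasDerivAt a b (Real.hasDerivAt_rpow_const (Or.inl ht.ne'))]
  have : t ^ p = t ^ (p - 1) * t := by
    rw [← Real.rpow_add_one ht.ne']
    congr 1
    ring
  rw [this]
  ring

theorem eulerOps_rpow (l : List (ℝ × ℝ)) (p : ℝ) :
    EqOn (eulerOps l fun y => y ^ p) (fun y => eulerSymbol l p * y ^ p) (Ioi 0) := by
  induction l with
  | nil => intro t _; simp [eulerOps, eulerSymbol]
  | cons ab l ih =>
    intro t ht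
    refine (eulerOp_congr ab.1 ab.2 isOpen_Ioi ih ht).trans ?_
    have h := eulerOp_sum ab.1 ab.2 {()} (fun _ => eulerSymbol l p) (fun _ y => y ^ p)
      (t := t) fun _ _ => analyticAt_rpow p ht
    simp only [Finset.sum_singleton] at h
    rw [h, eulerOp_rpow _ _ _ ht]
    simp only [eulerSymbol, List.map_cons, List.prod_cons]
    ring

theorem eulerOps_sum_rpow {ι : Type*} (l : List (ℝ × ℝ)) (s : Finset ι) (c p : ι → ℝ) :
    EqOn (eulerOps l fun y => ∑ i ∈ s, c i * y ^ p i)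
      (fun y => ∑ i ∈ s, c i * eulerSymbol l (p i) * y ^ p i) (Ioi 0) := fun t ht => by
  rw [eulerOps_sum l s c (fun i y => y ^ p i) isOpen_Ioi
    (fun i _ t ht => analyticAt_rpow (p i) ht) ht]
  refine Finset.sum_congr rfl fun i _ => ?_
  rw [eulerOps_rpow l (p i) ht]
  ring

theorem ZerosLE.of_eulerOps {l : List (ℝ × ℝ)} (hl : ∀ ab ∈ l, ab.1 ≠ 0) {f : ℝ → ℝ} {n : ℕ}
    (hf : AnalyticOnNhd ℝ f (Ioi 0)) (h : ZerosLE (eulerOps l f) (Ioi 0) n) :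
    ZerosLE f (Ioi 0) (n + l.length) := by
  induction l generalizing n with
  | nil => exact h
  | cons ab l ih =>
    have h1 := ih (fun x hx => hl x (List.mem_cons_of_mem _ hx)) <|
      ZerosLE.of_eulerOp (hl ab List.mem_cons_self) ordConnected_Ioi (fun _ ht => ht) isOpen_Ioi
        (eulerOps_analytic l hf) h
    rw [List.length_cons]
    convert h1 using 1
    ring

/-! ### Zeros of sums of real powers -/

theorem analytic_sum_rpow {ι : Type*} (s : Finset ι) (c p : ι → ℝ) :
    AnalyticOnNhd ℝ (fun y => ∑ i ∈ s, c i * y ^ p i) (Ioi 0) := fun _ ht =>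
  Finset.analyticAt_fun_sum s fun i _ => analyticAt_const.mul (analyticAt_rpow (p i) ht)

/-- A form of Descartes' rule of signs: `q` lists the exponents at which the sign may change. -/
theorem zerosLE_sum_rpow {ι : Type*} (s : Finset ι) (c p : ι → ℝ) (q : List ℝ)
    (h0 : ∀ i ∈ s, 0 ≤ c i * (q.map (p i - ·)).prod)
    (h1 : ∃ i ∈ s, c i * (q.map (p i - ·)).prod ≠ 0) :
    ZerosLE (fun y => ∑ i ∈ s, c i * y ^ p i) (Ioi 0) q.length := by
  have hs : ∀ x, eulerSymbol (q.map fun b => ((1 : ℝ), -b)) x = (q.map (x - ·)).prod := fun x => by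
    simp [eulerSymbol, Function.comp_def, sub_eq_add_neg]
  -- The operators t d/dt - b, for b in `q`, multiply the coefficient of t^p by ∏ (p - b). All
  -- coefficients become nonnegative and one positive, so the image has no zero, and each operator
  -- accounts for one.
  have h := ZerosLE.of_eulerOps (l := q.map fun b => ((1 : ℝ), -b)) (n := 0) (by simp)
    (analytic_sum_rpow s c p) <| ZerosLE.of_ne_zero fun t ht => by
      rw [eulerOps_sum_rpow _ s c p ht]
      simp only [hs]
      refine ne_of_gt (Finset.sum_pos' (fun i hi => ?_) ?_)
      · exact mul_nonneg (h0 i hi) (Real.rpow_pos_of_pos ht _).le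
      · obtain ⟨i, hi, hne⟩ := h1
        exact ⟨i, hi, mul_pos ((h0 i hi).lt_of_ne hne.symm) (Real.rpow_pos_of_pos ht _)⟩
  simpa using h

/-- Powers with distinct exponents form a Chebyshev system. -/
theorem zerosLE_sum_rpow_of_injOn {ι : Type*} (s : Finset ι) (c p : ι → ℝ)
    (hp : InjOn p s) (hc : ∃ i ∈ s, c i ≠ 0) :
    ZerosLE (fun y => ∑ i ∈ s, c i * y ^ p i) (Ioi 0) (s.card - 1) := by
  classical
  obtain ⟨j, hj, hcj⟩ := hc
  -- With all exponents except `p j` in the list, every other term is killed and a single monomial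
  -- survives.
  set q := ((s.erase j).toList.map p) with hq
  have hlen : q.length = s.card - 1 := by simp [hq, Finset.card_erase_of_mem hj]
  have hz : ∀ i ∈ s, i ≠ j → (q.map (p i - ·)).prod = 0 := fun i hi hij => by
    refine List.prod_eq_zero (List.mem_map.2 ⟨p i, List.mem_map.2 ⟨i, ?_, rfl⟩, sub_self _⟩)
    simp [hij, hi]
  have hnz : (q.map (p j - ·)).prod ≠ 0 := by
    refine List.prod_ne_zero fun h => ?_
    obtain ⟨b, hb, hb0⟩ := List.mem_map.1 h
    obtain ⟨i, hi, rfl⟩ := List.mem_map.1 hb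
    have hi' := Finset.mem_erase.1 (Finset.mem_toList.1 hi)
    exact hi'.1 (hp hi'.2 hj (sub_eq_zero.1 hb0).symm)
  rw [← hlen]
  rcases le_total 0 (c j * (q.map (p j - ·)).prod) with h | h
  · refine zerosLE_sum_rpow s c p q (fun i hi => ?_) ⟨j, hj, mul_ne_zero hcj hnz⟩
    rcases eq_or_ne i j with rfl | hij
    · exact h
    · rw [hz i hi hij, mul_zero]
  · have := (zerosLE_sum_rpow s (fun i => -c i) p q (fun i hi => ?_)
      ⟨j, hj, mul_ne_zero (neg_ne_zero.2 hcj) hnz⟩).neg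
    · simpa using this
    · rcases eq_or_ne i j with rfl | hij
      · rw [neg_mul]
        exact neg_nonneg.2 h
      · rw [hz i hi hij, mul_zero]

/-! ### Lifting a zero through the Euler operators -/

/-- The powers annihilated by one of the operators in the list. -/
def kernelPowers (l : List (ℝ × ℝ)) : Set (ℝ → ℝ) :=
  {f | ∃ ab ∈ l, f = fun t => t ^ (-ab.2 / ab.1)}

/-- Adding suitable powers annihilated by the operators raises the order of vanishing at `t` to that
of `eulerOps l F` plus the number of operators. -/
theorem exists_order_eq_add_length (l : List (ℝ × ℝ)) (hl : ∀ ab ∈ l, ab.1 ≠ 0)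
    (hd : l.Pairwise fun x y => -x.2 / x.1 ≠ -y.2 / y.1) {F : ℝ → ℝ} {t : ℝ} (ht : 0 < t)
    (hF : AnalyticOnNhd ℝ F (Ioi 0)) :
    ∃ g ∈ Submodule.span ℝ (kernelPowers l),
      analyticOrderAt (fun y => F y + g y) t = analyticOrderAt (eulerOps l F) t + l.length := by
  induction l generalizing F with
  | nil => exact ⟨0, zero_mem _, by simp [eulerOps]⟩
  | cons ab l ih =>
    have ha := hl ab List.mem_cons_self
    have hl' : ∀ x ∈ l, x.1 ≠ 0 := fun x hx => hl x (List.mem_cons_of_mem _ hx)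
    obtain ⟨hd1, hd2⟩ := List.pairwise_cons.1 hd
    set p := -ab.2 / ab.1 with hp
    have hsym : eulerSymbol l p ≠ 0 := by
      refine List.prod_ne_zero fun h0 => ?_
      obtain ⟨x, hx, hx0⟩ := List.mem_map.1 h0
      refine hd1 x hx ?_
      have := hl' x hx
      rw [eq_div_iff this]
      linarith
    set G := eulerOps l F with hG
    have hGa : AnalyticOnNhd ℝ G (Ioi 0) := eulerOps_analytic l hF
    -- The head operator kills t^p, and by `hd` the inner operators do not. So a multiple of t^p can
    -- be added to make the input of the head operator vanish at `t` without changing its output;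
    -- undoing the head operator then raises the order by one.
    set b := -G t / t ^ p / eulerSymbol l p with hb
    have htp : t ^ p ≠ 0 := (Real.rpow_pos_of_pos ht _).ne'
    have hpa : AnalyticOnNhd ℝ (fun y : ℝ => y ^ p) (Ioi 0) := fun y hy => analyticAt_rpow p hy
    have hF1a : AnalyticOnNhd ℝ (fun y => F y + b * y ^ p) (Ioi 0) :=
      hF.add (analyticOnNhd_const.mul hpa)
    have hlin : ∀ l' : List (ℝ × ℝ), EqOn (eulerOps l' fun y => F y + b * y ^ p)
        (fun y => eulerOps l' F y + b * eulerSymbol l' p * y ^ p) (Ioi 0) := fun l' y hy => by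
      have := eulerOps_sum l' (Finset.univ : Finset Bool) (fun i => cond i 1 b)
        (fun i => cond i F fun y => y ^ p) isOpen_Ioi (fun i _ => by cases i <;> assumption) hy
      simp only [Fintype.sum_bool, cond_true, cond_false, one_mul] at this
      rw [this, eulerOps_rpow l' p hy]
      ring
    have hG1 : eulerOps l (fun y => F y + b * y ^ p) t = 0 := by
      rw [hlin l ht, hb, ← hG]
      field_simp
      ring
    have hkill : eulerSymbol (ab :: l) p = 0 := by
      simp only [eulerSymbol, List.map_cons, List.prod_cons, hp]
      rw [show ab.1 * (-ab.2 / ab.1) + ab.2 = 0 by field_simp; ring, zero_mul]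
    have hord : analyticOrderAt (eulerOp ab.1 ab.2 (eulerOps l fun y => F y + b * y ^ p)) t
        = analyticOrderAt (eulerOps (ab :: l) F) t := by
      refine analyticOrderAt_congr ?_
      filter_upwards [lt_mem_nhds ht] with y hy
      have := hlin (ab :: l) hy
      rw [hkill, mul_zero] at this
      simpa [eulerOps] using this
    obtain ⟨g, hg, hgo⟩ := ih hl' hd2 hF1a
    rw [← order_of_eulerOp ha ht (eulerOps_analytic l hF1a t ht) hG1, hord] at hgo
    refine ⟨b • (fun y : ℝ => y ^ p) + g, add_mem (Submodule.smul_mem _ _ (Submodule.subset_span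
      ⟨ab, List.mem_cons_self, rfl⟩)) (Submodule.span_mono ?_ hg), ?_⟩
    · rintro f ⟨x, hx, rfl⟩
      exact ⟨x, List.mem_cons_of_mem _ hx, rfl⟩
    · rw [List.length_cons, Nat.cast_add, Nat.cast_one, add_comm (l.length : ℕ∞), ← add_assoc, ← hgo]
      congr 1
      ext y
      simp [add_assoc]

/-! ### The polynomials Q, R, E and the two image functions -/

noncomputable section

def coefQ0 (k : ℝ) : ℝ := 27 - 27 * k + 6 * k ^ 2
def coefQ1 (k : ℝ) : ℝ := 1 - 3 * k ^ 2 - 2 * k ^ 3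
def coefQ2 (k : ℝ) : ℝ := -9 * k + 57 * k ^ 2 - 114 * k ^ 3 + 72 * k ^ 4

/-- The polynomial such that the annihilator of the five powers of the family maps
`(1 + t²) (1 + k t²)` to `polyQ k (t²)`. -/
def polyQ (k s : ℝ) : ℝ := coefQ0 k + coefQ1 k * s + coefQ2 k * s ^ 2

/-- The derivative of `polyQ k`. -/
def polyQ' (k s : ℝ) : ℝ := coefQ1 k + 2 * coefQ2 k * s

def coefR1 (k : ℝ) : ℝ := -100 + 99 * k - 19 * k ^ 2 + 2 * k ^ 3
def coefR2 (k : ℝ) : ℝ := -118 - 26 * k + 456 * k ^ 2 - 572 * k ^ 3 + 248 * k ^ 4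
def coefR3 (k : ℝ) : ℝ := -140 + 262 * k + 42 * k ^ 2 - 496 * k ^ 3 + 344 * k ^ 4
def coefR4 (k : ℝ) : ℝ := 1 - 33 * k + 206 * k ^ 2 - 420 * k ^ 3 + 264 * k ^ 4

/-- The numerator of the rational part of the image of `(1 + t²) (1 + k t²) arctan t`. -/
def polyR (k s : ℝ) : ℝ := -coefQ0 k + coefR1 k * s + coefR2 k * s ^ 2 + coefR3 k * s ^ 3
  + coefR4 k * s ^ 4 + coefQ2 k * s ^ 5

/-- The derivative of `polyR k`. -/
def polyR' (k s : ℝ) : ℝ := coefR1 k + 2 * coefR2 k * s + 3 * coefR3 k * s ^ 2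
  + 4 * coefR4 k * s ^ 3 + 5 * coefQ2 k * s ^ 4

def coefE0 (k : ℝ) : ℝ :=
  (2 * k - 1) * (5 * k - 1) * (3 * k - 2) * (k - 3) * (2 * k - 3) * (5 * k - 4)
def coefE1 (k : ℝ) : ℝ := (3 * k - 2) * (5 * k - 4)
  * (-52 + 76 * k + 150 * k ^ 2 - 176 * k ^ 3 + 38 * k ^ 4 - 4 * k ^ 5)
def coefE2 (k : ℝ) : ℝ := (3 * k - 4) * (-38 + 201 * k - 930 * k ^ 2 + 2034 * k ^ 3
  - 1830 * k ^ 4 + 885 * k ^ 5 - 610 * k ^ 6 + 240 * k ^ 7)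
def coefE3 (k : ℝ) : ℝ := (2 * k - 1) * (3 * k - 4)
  * (4 - 70 * k + 236 * k ^ 2 + 178 * k ^ 3 - 940 * k ^ 4 + 716 * k ^ 5 - 156 * k ^ 6)
def coefE4 (k : ℝ) : ℝ :=
  k * (2 * k - 1) * (3 * k - 1) * (k - 2) ^ 2 * (4 * k - 3) * (3 * k - 4) * (k - 5)

/-- The polynomial factor of the Wronskian of the two images. -/
def polyE (k s : ℝ) : ℝ :=
  coefE0 k + coefE1 k * s + coefE2 k * s ^ 2 + coefE3 k * s ^ 3 + coefE4 k * s ^ 4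

/-- The image of `(1 + t²) (1 + k t²)`. -/
def imageU (k t : ℝ) : ℝ := polyQ k (t ^ 2)

/-- The image of `(1 + t²) (1 + k t²) arctan t`. -/
def imageV (k t : ℝ) : ℝ :=
  polyQ k (t ^ 2) * Real.arctan t + t * polyR k (t ^ 2) / (1 + t ^ 2) ^ 4

/-- The quotient of the two images. -/
def quotVU (k t : ℝ) : ℝ :=
  Real.arctan t + t * polyR k (t ^ 2) / (polyQ k (t ^ 2) * (1 + t ^ 2) ^ 4)

/-- A primitive of `t ↦ (128 / 3) t ^ 4 / (1 + t ^ 2) ^ 5`. -/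
def primPhi (t : ℝ) : ℝ := Real.arctan t
  + t * (-1 - 11 / 3 * t ^ 2 + 11 / 3 * (t ^ 2) ^ 2 + (t ^ 2) ^ 3) / (1 + t ^ 2) ^ 4

def coefA (k : ℝ) : ℝ :=
  32 / 3 * (-20 + 6 * k + 45 * k ^ 2 - 65 * k ^ 3 + 30 * k ^ 4)
def coefB (k : ℝ) : ℝ :=
  32 / 3 * (-16 + 24 * k + 24 * k ^ 2 - 85 * k ^ 3 + 57 * k ^ 4)

end

/-- Division of R by Q with a quotient independent of k, namely the cubic in `primPhi`. The
remainder governs V at zeros of Q and the rational part of V/U. -/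
theorem polyR_eq (k s : ℝ) : polyR k s =
    polyQ k s * (-1 - 11 / 3 * s + 11 / 3 * s ^ 2 + s ^ 3) + s ^ 2 * (coefA k + coefB k * s) := by
  simp only [polyR, polyQ, coefA, coefB, coefQ0, coefQ1, coefQ2, coefR1, coefR2, coefR3, coefR4]
  ring

/-- This is the numerator of UV' - U'V, in which the arctangent terms cancel; it defines E. -/
theorem wronskian_identity (k s : ℝ) :
    polyQ k s ^ 2 * (1 + s) ^ 4 + polyQ k s * ((polyR k s + 2 * s * polyR' k s) * (1 + s)
      - 8 * s * polyR k s) - 2 * s * polyQ' k s * polyR k s * (1 + s) =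
    32 * s ^ 2 * polyE k s := by
  simp only [polyR, polyQ, polyR', polyQ', polyE, coefQ0, coefQ1, coefQ2, coefR1, coefR2, coefR3,
    coefR4, coefE0, coefE1, coefE2, coefE3, coefE4]
  ring

/-- At a zero of `polyQ`, the Wronskian factor is determined by the slope and the remainder. -/
theorem polyE_at_root {k s : ℝ} (hs : 0 < s) (h : polyQ k s = 0) :
    16 * polyE k s = -(polyQ' k s * (s * (coefA k + coefB k * s)) * (1 + s)) := by
  have h1 := wronskian_identity k s
  have h2 := polyR_eq k s
  rw [h] at h1 h2
  rw [h2] at h1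
  have : s ^ 2 * (16 * polyE k s) =
      s ^ 2 * -(polyQ' k s * (s * (coefA k + coefB k * s)) * (1 + s)) := by linear_combination -h1 / 2
  exact mul_left_cancel₀ (pow_ne_zero 2 hs.ne') this

theorem hasDerivAt_polyQ (k s : ℝ) : HasDerivAt (polyQ k) (polyQ' k s) s := by
  have h := ((hasDerivAt_id s).const_mul (coefQ1 k)).const_add (coefQ0 k) |>.add
    (((hasDerivAt_id s).pow 2).const_mul (coefQ2 k))
  refine (h.congr_deriv ?_).congr_of_eventuallyEq (Eventually.of_forall fun y => ?_)
  · simp only [polyQ', id]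
    ring
  · simp [polyQ]

theorem hasDerivAt_sq (t : ℝ) : HasDerivAt (fun y : ℝ => y ^ 2) (2 * t) t := by
  simpa using hasDerivAt_pow 2 t

theorem hasDerivAt_polyR (k s : ℝ) : HasDerivAt (polyR k) (polyR' k s) s := by
  have h := (((((hasDerivAt_id s).const_mul (coefR1 k)).const_add (-coefQ0 k)).add
    (((hasDerivAt_id s).pow 2).const_mul (coefR2 k))).add
    (((hasDerivAt_id s).pow 3).const_mul (coefR3 k))).add
    (((hasDerivAt_id s).pow 4).const_mul (coefR4 k)) |>.add
    (((hasDerivAt_id s).pow 5).const_mul (coefQ2 k))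
  refine (h.congr_deriv ?_).congr_of_eventuallyEq (Eventually.of_forall fun y => ?_)
  · simp only [polyR', id]
    push_cast
    ring
  · simp [polyR]

theorem hasDerivAt_imageU (k t : ℝ) : HasDerivAt (imageU k) (2 * t * polyQ' k (t ^ 2)) t :=
  ((hasDerivAt_polyQ k (t ^ 2)).comp t (hasDerivAt_sq t)).congr_deriv (by ring)

theorem one_add_sq_pos (t : ℝ) : 0 < 1 + t ^ 2 := by positivity

/-- The derivative of `P (t²) arctan t + t T (t²) / (1 + t²) ^ n`. -/
theorem hasDerivAt_arctan_combination {P T : ℝ → ℝ} {t P' T' : ℝ} (n : ℕ)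
    (hP : HasDerivAt P P' (t ^ 2)) (hT : HasDerivAt T T' (t ^ 2)) :
    HasDerivAt (fun y => P (y ^ 2) * Real.arctan y + y * T (y ^ 2) / (1 + y ^ 2) ^ n)
      (2 * t * P' * Real.arctan t + (P (t ^ 2) * (1 + t ^ 2) ^ n
        + (T (t ^ 2) + 2 * t ^ 2 * T') * (1 + t ^ 2) - 2 * n * t ^ 2 * T (t ^ 2))
        / (1 + t ^ 2) ^ (n + 1)) t := by
  have hpos := (one_add_sq_pos t).ne'
  have h1 : HasDerivAt (fun y => P (y ^ 2)) (P' * (2 * t)) t :=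
    HasDerivAt.comp (h₂ := P) (h := fun y : ℝ => y ^ 2) t hP (hasDerivAt_sq t)
  have h2 : HasDerivAt (fun y => T (y ^ 2)) (T' * (2 * t)) t :=
    HasDerivAt.comp (h₂ := T) (h := fun y : ℝ => y ^ 2) t hT (hasDerivAt_sq t)
  have h3 : HasDerivAt (fun y : ℝ => (1 + y ^ 2) ^ n) (n * (1 + t ^ 2) ^ (n - 1) * (2 * t)) t :=
    ((hasDerivAt_sq t).const_add 1).pow n
  have h := (h1.mul (Real.hasDerivAt_arctan t)).add
    (((hasDerivAt_id t).mul h2).div h3 (pow_ne_zero n hpos))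
  refine h.congr_deriv ?_
  rcases n with _ | n
  · simp
    field_simp
    ring
  · simp only [Pi.mul_apply, id, Nat.add_sub_cancel]
    field_simp
    push_cast
    ring

theorem hasDerivAt_imageV (k t : ℝ) : HasDerivAt (imageV k)
    (2 * t * polyQ' k (t ^ 2) * Real.arctan t + (polyQ k (t ^ 2) * (1 + t ^ 2) ^ 4
        + (polyR k (t ^ 2) + 2 * t ^ 2 * polyR' k (t ^ 2)) * (1 + t ^ 2)
        - 8 * t ^ 2 * polyR k (t ^ 2)) / (1 + t ^ 2) ^ 5) t := by
  refine (hasDerivAt_arctan_combination 4 (hasDerivAt_polyQ k _)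
    (hasDerivAt_polyR k _)).congr_deriv ?_
  norm_num

/-! ### The quotient V/U: derivative, splitting and limits -/

theorem imageV_eq {k t : ℝ} (h : polyQ k (t ^ 2) ≠ 0) :
    imageV k t = polyQ k (t ^ 2) * quotVU k t := by
  have := (one_add_sq_pos t).ne'
  rw [imageV, quotVU]
  field_simp

theorem wronskian_image (k t : ℝ) :
    imageU k t * deriv (imageV k) t - deriv (imageU k) t * imageV k t =
      32 * t ^ 4 * polyE k (t ^ 2) / (1 + t ^ 2) ^ 5 := by
  have hpos := (one_add_sq_pos t).ne'
  rw [(hasDerivAt_imageV k t).deriv, (hasDerivAt_imageU k t).deriv, imageU, imageV]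
  have := wronskian_identity k (t ^ 2)
  field_simp
  linear_combination this

/-- The Wronskian divided by U²; hence V/U is monotone wherever E keeps a sign. -/
theorem hasDerivAt_quotVU {k t : ℝ} (h : polyQ k (t ^ 2) ≠ 0) : HasDerivAt (quotVU k)
    (32 * t ^ 4 * polyE k (t ^ 2) / (polyQ k (t ^ 2) ^ 2 * (1 + t ^ 2) ^ 5)) t := by
  have hpos := (one_add_sq_pos t).ne'
  have h1 := (hasDerivAt_imageV k t).differentiableAt.hasDerivAt.div
    (hasDerivAt_imageU k t).differentiableAt.hasDerivAt h
  refine (h1.congr_deriv ?_).congr_of_eventuallyEq ?_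
  · have := wronskian_image k t
    rw [show imageU k t = polyQ k (t ^ 2) from rfl] at *
    rw [show deriv (imageV k) t * polyQ k (t ^ 2) - imageV k t * deriv (imageU k) t =
      32 * t ^ 4 * polyE k (t ^ 2) / (1 + t ^ 2) ^ 5 by rw [← this]; ring]
    field_simp
  · have hc : ContinuousAt (imageU k) t := (hasDerivAt_imageU k t).continuousAt
    filter_upwards [hc.eventually_ne h] with y hy
    rw [Pi.div_apply, imageV_eq hy]
    exact (mul_div_cancel_left₀ _ hy).symm

theorem hasDerivAt_primPhi (t : ℝ) :
    HasDerivAt primPhi (128 / 3 * t ^ 4 / (1 + t ^ 2) ^ 5) t := by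
  have hpos := (one_add_sq_pos t).ne'
  have hT : HasDerivAt (fun s : ℝ => -1 - 11 / 3 * s + 11 / 3 * s ^ 2 + s ^ 3)
      (-(11 / 3) + 22 / 3 * t ^ 2 + 3 * (t ^ 2) ^ 2) (t ^ 2) := by
    have h := (((hasDerivAt_id (t ^ 2)).const_mul (11 / 3 : ℝ)).const_sub (-1)).add
      (((hasDerivAt_id (t ^ 2)).pow 2).const_mul (11 / 3 : ℝ)) |>.add ((hasDerivAt_id (t ^ 2)).pow 3)
    refine (h.congr_deriv ?_).congr_of_eventuallyEq (Eventually.of_forall fun y => ?_)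
    · simp only [id]
      push_cast
      ring
    · simp
  have h := hasDerivAt_arctan_combination 4 (hasDerivAt_const (t ^ 2) (1 : ℝ)) hT
  refine (h.congr_deriv ?_).congr_of_eventuallyEq (Eventually.of_forall fun y => ?_)
  · field_simp
    push_cast
    ring
  · simp [primPhi]

/-- The increasing part does not depend on k; the poles at zeros of Q and the sign relative to 0 and
π/2 sit in the rational part, which has the sign of (A + Bs)/Q. -/
theorem quotVU_eq {k t : ℝ} (h : polyQ k (t ^ 2) ≠ 0) : quotVU k t = primPhi t
    + t ^ 5 * (coefA k + coefB k * t ^ 2) / (polyQ k (t ^ 2) * (1 + t ^ 2) ^ 4) := by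
  have hpos := (one_add_sq_pos t).ne'
  rw [quotVU, primPhi, polyR_eq]
  field_simp
  ring

/-- In u = 1/t the rational part is continuous at 0 with value 0, since its denominator there is the
leading coefficient of Q. -/
theorem tendsto_quotVU {k : ℝ} (h : coefQ2 k ≠ 0) :
    Tendsto (quotVU k) atTop (𝓝 (Real.pi / 2)) := by
  have h1 : Tendsto (fun u : ℝ => u * (-coefQ0 k * u ^ 10 + coefR1 k * u ^ 8 + coefR2 k * u ^ 6
      + coefR3 k * u ^ 4 + coefR4 k * u ^ 2 + coefQ2 k)
      / ((coefQ0 k * u ^ 4 + coefQ1 k * u ^ 2 + coefQ2 k) * (1 + u ^ 2) ^ 4)) (𝓝 0) (𝓝 0) := by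
    have : ContinuousAt (fun u : ℝ => u * (-coefQ0 k * u ^ 10 + coefR1 k * u ^ 8 + coefR2 k * u ^ 6
      + coefR3 k * u ^ 4 + coefR4 k * u ^ 2 + coefQ2 k)
      / ((coefQ0 k * u ^ 4 + coefQ1 k * u ^ 2 + coefQ2 k) * (1 + u ^ 2) ^ 4)) 0 := by
      refine ContinuousAt.div (by fun_prop) (by fun_prop) ?_
      simpa using h
    simpa [ContinuousAt] using this
  have h2 := h1.comp tendsto_inv_atTop_zero
  have h3 := (tendsto_nhds_of_tendsto_nhdsWithin Real.tendsto_arctan_atTop).add h2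
  rw [add_zero] at h3
  refine h3.congr' ?_
  filter_upwards [eventually_gt_atTop 0] with t ht
  have hpos := (one_add_sq_pos t).ne'
  rw [quotVU, Function.comp_apply]
  congr 1
  have e1 : (-coefQ0 k * t⁻¹ ^ 10 + coefR1 k * t⁻¹ ^ 8 + coefR2 k * t⁻¹ ^ 6
      + coefR3 k * t⁻¹ ^ 4 + coefR4 k * t⁻¹ ^ 2 + coefQ2 k) = polyR k (t ^ 2) / t ^ 10 := by
    rw [polyR]
    field_simp
  have e2 : (coefQ0 k * t⁻¹ ^ 4 + coefQ1 k * t⁻¹ ^ 2 + coefQ2 k) = polyQ k (t ^ 2) / t ^ 4 := by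
    rw [polyQ]
    field_simp
  have e3 : (1 + t⁻¹ ^ 2) = (1 + t ^ 2) / t ^ 2 := by
    field_simp
    ring
  rw [e1, e2, e3]
  by_cases hQ : polyQ k (t ^ 2) = 0
  · simp [hQ]
  · field_simp

theorem tendsto_primPhi : Tendsto primPhi atTop (𝓝 (Real.pi / 2)) := by
  have h1 : Tendsto (fun u : ℝ => u * (-u ^ 6 - 11 / 3 * u ^ 4 + 11 / 3 * u ^ 2 + 1)
      / (1 + u ^ 2) ^ 4) (𝓝 0) (𝓝 0) := by
    have : ContinuousAt (fun u : ℝ => u * (-u ^ 6 - 11 / 3 * u ^ 4 + 11 / 3 * u ^ 2 + 1)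
      / (1 + u ^ 2) ^ 4) 0 := ContinuousAt.div (by fun_prop) (by fun_prop) (by simp)
    simpa [ContinuousAt] using this
  have h2 := h1.comp tendsto_inv_atTop_zero
  have h3 := (tendsto_nhds_of_tendsto_nhdsWithin Real.tendsto_arctan_atTop).add h2
  rw [add_zero] at h3
  refine h3.congr' ?_
  filter_upwards [eventually_gt_atTop 0] with t ht
  have hpos := (one_add_sq_pos t).ne'
  rw [primPhi, Function.comp_apply]
  congr 1
  have e3 : (1 + t⁻¹ ^ 2) = (1 + t ^ 2) / t ^ 2 := by
    field_simp
    ring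
  rw [e3]
  field_simp

theorem primPhi_zero : primPhi 0 = 0 := by simp [primPhi]

theorem quotVU_zero (k : ℝ) : quotVU k 0 = 0 := by simp [quotVU]

theorem primPhi_strictMonoOn : StrictMonoOn primPhi (Ici 0) := by
  refine strictMonoOn_of_deriv_pos (convex_Ici 0)
    (fun t _ => (hasDerivAt_primPhi t).continuousAt.continuousWithinAt) fun t ht => ?_
  rw [interior_Ici, mem_Ioi] at ht
  rw [(hasDerivAt_primPhi t).deriv]
  positivity

theorem primPhi_lt {t : ℝ} (ht : 0 < t) : primPhi t < Real.pi / 2 := by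
  have h1 : primPhi t < primPhi (t + 1) :=
    primPhi_strictMonoOn ht.le (by simp only [mem_Ici]; linarith) (by linarith)
  refine h1.trans_le (ge_of_tendsto tendsto_primPhi ?_)
  filter_upwards [eventually_ge_atTop (t + 1)] with y hy
  exact primPhi_strictMonoOn.monotoneOn (by simp only [mem_Ici]; linarith)
    (by simp only [mem_Ici]; linarith) hy

/-- Integrate the derivative after bounding (1+y²)⁵ below by 1. -/
theorem primPhi_le {t : ℝ} (ht : 0 ≤ t) : primPhi t ≤ 128 / 15 * t ^ 5 := by
  have h : MonotoneOn (fun y => 128 / 15 * y ^ 5 - primPhi y) (Ici 0) := by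
    have hd : ∀ y : ℝ, HasDerivAt (fun y => 128 / 15 * y ^ 5 - primPhi y)
        (128 / 3 * y ^ 4 - 128 / 3 * y ^ 4 / (1 + y ^ 2) ^ 5) y := fun y => by
      refine (((hasDerivAt_pow 5 y).const_mul (128 / 15 : ℝ)).sub (hasDerivAt_primPhi y)).congr_deriv
        ?_
      norm_num
      ring
    refine monotoneOn_of_deriv_nonneg (convex_Ici 0)
      (fun t _ => (hd t).continuousAt.continuousWithinAt)
      (fun t _ => (hd t).differentiableAt.differentiableWithinAt) fun y _ => ?_
    rw [(hd y).deriv, sub_nonneg]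
    refine div_le_self (by positivity) (one_le_pow₀ ?_)
    nlinarith [sq_nonneg y]
  have := h self_mem_Ici ht ht
  simp only [primPhi_zero] at this
  linarith

/-- Bounding (1+y²)⁵ below by y¹⁰ makes the derivative at most (128/3) y⁻⁶; integrate from `t` to
infinity. -/
theorem le_primPhi {t : ℝ} (ht : 0 < t) : Real.pi / 2 - 128 / 15 / t ^ 5 ≤ primPhi t := by
  have hd : ∀ y : ℝ, 0 < y → HasDerivAt (fun y => primPhi y + 128 / 15 / y ^ 5)
      (128 / 3 * y ^ 4 / (1 + y ^ 2) ^ 5 - 128 / 3 / y ^ 6) y := fun y hy => by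
    have h5 := (hasDerivAt_const y (128 / 15 : ℝ)).div (hasDerivAt_pow 5 y) (pow_ne_zero 5 hy.ne')
    refine ((hasDerivAt_primPhi y).add h5).congr_deriv ?_
    field_simp
    norm_num
    ring
  have h : AntitoneOn (fun y => primPhi y + 128 / 15 / y ^ 5) (Ici t) := by
    refine antitoneOn_of_deriv_nonpos (convex_Ici t)
      (fun y hy => (hd y (ht.trans_le hy)).continuousAt.continuousWithinAt)
      (fun y hy => (hd y ?_).differentiableAt.differentiableWithinAt) fun y hy => ?_
    · rw [interior_Ici] at hy
      exact ht.trans hy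
    · rw [interior_Ici] at hy
      have hy0 : 0 < y := ht.trans hy
      rw [(hd y hy0).deriv, sub_nonpos, div_le_div_iff₀ (by positivity) (by positivity)]
      have : (y ^ 2) ^ 5 ≤ (1 + y ^ 2) ^ 5 := pow_le_pow_left₀ (by positivity) (by linarith) 5
      nlinarith [this]
  have hl : Tendsto (fun y => primPhi y + 128 / 15 / y ^ 5) atTop (𝓝 (Real.pi / 2)) := by
    have h5 : Tendsto (fun y : ℝ => 128 / 15 / y ^ 5) atTop (𝓝 0) :=
      tendsto_const_nhds.div_atTop (tendsto_pow_atTop (by norm_num))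
    simpa using tendsto_primPhi.add h5
  have : Real.pi / 2 ≤ primPhi t + 128 / 15 / t ^ 5 := by
    refine le_of_tendsto hl ?_
    filter_upwards [eventually_ge_atTop t] with y hy
    exact h self_mem_Ici hy hy
  linarith

/-! ### Images of the two non-power functions under the annihilators -/

noncomputable section

/-- The function `(p₀ + p₁ t² + p₂ t⁴) arctan t + t T (t²) / (1 + t²) ^ n`. -/
def arctanForm (p₀ p₁ p₂ : ℝ) (T : ℝ → ℝ) (n : ℕ) (t : ℝ) : ℝ :=
  (p₀ + p₁ * t ^ 2 + p₂ * (t ^ 2) ^ 2) * Real.arctan t + t * T (t ^ 2) / (1 + t ^ 2) ^ n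

/-- The polynomial with the given coefficients, the constant one first. -/
def quartic (c₀ c₁ c₂ c₃ c₄ s : ℝ) : ℝ := c₀ + c₁ * s + c₂ * s ^ 2 + c₃ * s ^ 3 + c₄ * s ^ 4

theorem hasDerivAt_quartic (c₀ c₁ c₂ c₃ c₄ s : ℝ) : HasDerivAt (quartic c₀ c₁ c₂ c₃ c₄)
    (c₁ + 2 * c₂ * s + 3 * c₃ * s ^ 2 + 4 * c₄ * s ^ 3) s := by
  have h := ((((hasDerivAt_id s).const_mul c₁).const_add c₀).add
    (((hasDerivAt_id s).pow 2).const_mul c₂)).add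
    (((hasDerivAt_id s).pow 3).const_mul c₃) |>.add
    (((hasDerivAt_id s).pow 4).const_mul c₄)
  refine (h.congr_deriv ?_).congr_of_eventuallyEq (Eventually.of_forall fun y => ?_)
  · simp only [id]
    push_cast
    ring
  · simp [quartic]

theorem eulerOp_even (a b p₀ p₁ p₂ : ℝ) :
    eulerOp a b (fun t => p₀ + p₁ * t ^ 2 + p₂ * (t ^ 2) ^ 2) =
      fun t => b * p₀ + (2 * a + b) * p₁ * t ^ 2 + (4 * a + b) * p₂ * (t ^ 2) ^ 2 := by
  ext t
  have h : HasDerivAt (fun t : ℝ => p₀ + p₁ * t ^ 2 + p₂ * (t ^ 2) ^ 2)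
      (p₁ * (2 * t) + p₂ * (2 * t ^ 2 * (2 * t))) t := by
    refine ((((hasDerivAt_sq t).const_mul p₁).const_add p₀).add
      (((hasDerivAt_sq t).pow 2).const_mul p₂)).congr_deriv ?_
    norm_num
  rw [eulerOp_of_hasDerivAt a b h]
  ring

/-- The class of arctan forms is stable: differentiating the arctangent feeds the rational part,
whose denominator gains one power. The new numerator `N` is supplied by the caller in expanded form
and checked through `hN`. -/
theorem eulerOp_arctanForm (a b p₀ p₁ p₂ c₀ c₁ c₂ c₃ c₄ : ℝ) (n : ℕ) {N : ℝ → ℝ}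
    (hN : ∀ s, N s = a * ((p₀ + p₁ * s + p₂ * s ^ 2) * (1 + s) ^ n + (quartic c₀ c₁ c₂ c₃ c₄ s
      + 2 * s * (c₁ + 2 * c₂ * s + 3 * c₃ * s ^ 2 + 4 * c₄ * s ^ 3)) * (1 + s)
      - 2 * n * s * quartic c₀ c₁ c₂ c₃ c₄ s) + b * quartic c₀ c₁ c₂ c₃ c₄ s * (1 + s)) :
    eulerOp a b (arctanForm p₀ p₁ p₂ (quartic c₀ c₁ c₂ c₃ c₄) n) =
      arctanForm (b * p₀) ((2 * a + b) * p₁) ((4 * a + b) * p₂) N (n + 1) := by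
  ext t
  have hpos := (one_add_sq_pos t).ne'
  have hP : HasDerivAt (fun s => p₀ + p₁ * s + p₂ * s ^ 2) (p₁ + 2 * p₂ * t ^ 2) (t ^ 2) := by
    refine ((hasDerivAt_quartic p₀ p₁ p₂ 0 0 (t ^ 2)).congr_deriv (by ring)).congr_of_eventuallyEq
      (Eventually.of_forall fun y => ?_)
    simp [quartic]
  rw [eulerOp_of_hasDerivAt a b (f := arctanForm p₀ p₁ p₂ (quartic c₀ c₁ c₂ c₃ c₄) n)
    (hasDerivAt_arctan_combination n hP (hasDerivAt_quartic c₀ c₁ c₂ c₃ c₄ _)),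
    arctanForm, arctanForm, hN]
  field_simp
  ring

/-- Euler operators in `t = x ^ (k - 1)` annihilating the powers of the family divided by `x`. -/
def annihilators (k : ℝ) : List (ℝ × ℝ) :=
  [(k - 1, 3 - k), (k - 1, 3 - 2 * k), (k - 1, 1), (1, -3), (1, -1)]

/-- The non-power part of `u10`, divided by `x`, in the variable `t = x ^ (k - 1)`. -/
def factorU (k t : ℝ) : ℝ := (1 + t ^ 2) * (1 + k * t ^ 2)

/-- The non-power part of `u12`, divided by `x`, in the variable `t = x ^ (k - 1)`. -/
def factorV (k t : ℝ) : ℝ := factorU k t * Real.arctan t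

theorem eulerOps_factorU (k : ℝ) : eulerOps (annihilators k) (factorU k) = imageU k := by
  have h : factorU k = fun t => 1 + (1 + k) * t ^ 2 + k * (t ^ 2) ^ 2 := by
    ext t
    rw [factorU]
    ring
  simp only [eulerOps, annihilators, List.foldr_cons, List.foldr_nil, h, eulerOp_even]
  ext t
  simp only [imageU, polyQ, coefQ0, coefQ1, coefQ2]
  ring

theorem eulerOps_factorV (k : ℝ) : eulerOps (annihilators k) (factorV k) = imageV k := by
  have h : factorV k = arctanForm 1 (1 + k) k (quartic 0 0 0 0 0) 0 := by
    ext t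
    simp only [factorV, factorU, arctanForm, quartic]
    ring
  -- The factor 1+t² of `factorV` cancels the denominator created by the first operator. The
  -- exponent stays 0, so five operators end at (1+t²)⁴ and not at (1+t²)⁵.
  have h1 : eulerOp 1 (-1) (factorV k) = arctanForm (-1) (1 + k) (3 * k) (quartic 1 k 0 0 0) 0 := by
    rw [h, eulerOp_arctanForm 1 (-1) 1 (1 + k) k 0 0 0 0 0 0
      (N := fun s => (1 + s) * (1 + k * s)) fun s => by simp only [quartic]; push_cast; ring]
    ext t
    have hpos := (one_add_sq_pos t).ne'
    simp only [arctanForm, quartic]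
    field_simp
    ring
  have h2 : eulerOp 1 (-3) (eulerOp 1 (-1) (factorV k)) =
      arctanForm 3 (-(1 + k)) (3 * k) (quartic (-3) (-1 + k) (3 * k) 0 0) 1 := by
    rw [h1, eulerOp_arctanForm 1 (-3) _ _ _ _ _ _ _ _ 0
      (N := quartic (-3) (-1 + k) (3 * k) 0 0) fun s => by simp only [quartic]; push_cast; ring]
    congr 1 <;> ring
  have h3 : eulerOp (k - 1) 1 (eulerOp 1 (-3) (eulerOp 1 (-1) (factorV k))) =
      arctanForm 3 (1 - k - 2 * k ^ 2) (-9 * k + 12 * k ^ 2)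
        (quartic (-3) (-6 + k + 2 * k ^ 2) (1 - 16 * k + 18 * k ^ 2) (-9 * k + 12 * k ^ 2) 0) 2 := by
    rw [h2, eulerOp_arctanForm (k - 1) 1 _ _ _ _ _ _ _ _ 1
      (N := quartic (-3) (-6 + k + 2 * k ^ 2) (1 - 16 * k + 18 * k ^ 2) (-9 * k + 12 * k ^ 2) 0)
      fun s => by simp only [quartic]; push_cast; ring]
    congr 1 <;> ring
  have h4 : eulerOp (k - 1) (3 - 2 * k)
      (eulerOp (k - 1) 1 (eulerOp 1 (-3) (eulerOp 1 (-1) (factorV k)))) =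
      arctanForm (9 - 6 * k) (1 - k - 2 * k ^ 2) (9 * k - 30 * k ^ 2 + 24 * k ^ 3)
        (quartic (-9 + 6 * k) (-25 + 17 * k + 2 * k ^ 2) (-31 + 73 * k - 98 * k ^ 2 + 56 * k ^ 3)
          (1 + 23 * k - 82 * k ^ 2 + 64 * k ^ 3) (9 * k - 30 * k ^ 2 + 24 * k ^ 3)) 3 := by
    rw [h3, eulerOp_arctanForm (k - 1) (3 - 2 * k) _ _ _ _ _ _ _ _ 2
      (N := quartic (-9 + 6 * k) (-25 + 17 * k + 2 * k ^ 2) (-31 + 73 * k - 98 * k ^ 2 + 56 * k ^ 3)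
          (1 + 23 * k - 82 * k ^ 2 + 64 * k ^ 3) (9 * k - 30 * k ^ 2 + 24 * k ^ 3))
      fun s => by simp only [quartic]; push_cast; ring]
    congr 1 <;> ring
  simp only [eulerOps, annihilators, List.foldr_cons, List.foldr_nil]
  rw [h4, eulerOp_arctanForm (k - 1) (3 - k) _ _ _ _ _ _ _ _ 3 (N := polyR k) fun s => by
    simp only [quartic, polyR, coefQ0, coefQ2, coefR1, coefR2, coefR3, coefR4]; push_cast; ring]
  ext t
  simp only [arctanForm, imageV, polyQ, coefQ0, coefQ1, coefQ2]
  ring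

theorem analyticAt_arctan (t : ℝ) : AnalyticAt ℝ Real.arctan t :=
  (Real.contDiff_arctan.contDiffAt).analyticAt

theorem analyticAt_factorU (k t : ℝ) : AnalyticAt ℝ (factorU k) t := by
  unfold factorU
  fun_prop

theorem analyticAt_factorV (k t : ℝ) : AnalyticAt ℝ (factorV k) t :=
  (analyticAt_factorU k t).mul (analyticAt_arctan t)

/-! ### From the family to the images: upper bounds -/

/-- The exponents in `t = x ^ (k - 1)` of the powers in the family, divided by `x`. -/
def exponents (k : ℝ) : Fin 5 → ℝ :=
  ![-1 / (k - 1), 1, 3, (2 * k - 3) / (k - 1), (k - 3) / (k - 1)]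

/-- The function of `t = x ^ (k - 1)` corresponding to a combination of the family. -/
def pullback (k : ℝ) (c : Fin 7 → ℝ) (t : ℝ) : ℝ :=
  ∑ i : Fin 5, c (i.castLE (by norm_num)) * t ^ exponents k i + c 5 * factorU k t
    + c 6 * factorV k t

theorem analytic_pullback (k : ℝ) (c : Fin 7 → ℝ) : AnalyticOnNhd ℝ (pullback k c) (Ioi 0) :=
  fun t ht => ((analytic_sum_rpow _ _ _ t ht).add (analyticAt_const.mul
    (analyticAt_factorU k t))).add (analyticAt_const.mul (analyticAt_factorV k t))

/-- Equating two exponents gives k = 0, 1, 2 or 2/3, or a contradiction. This is where the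
exceptional values 2 and 2/3 come from. -/
theorem exponents_injective {k : ℝ} (h0 : 0 < k) (h1 : k ≠ 1) (h2 : k ≠ 2) (h3 : k ≠ 2 / 3) :
    Function.Injective (exponents k) := by
  have hm : k - 1 ≠ 0 := sub_ne_zero.2 h1
  have e1 : -1 / (k - 1) ≠ 1 := fun h => by field_simp at h; exact h0.ne' (by linarith)
  have e2 : -1 / (k - 1) ≠ 3 := fun h => by field_simp at h; exact h3 (by linarith)
  have e3 : -1 / (k - 1) ≠ (2 * k - 3) / (k - 1) := fun h => by
    field_simp at h; exact h1 (by linarith)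
  have e4 : -1 / (k - 1) ≠ (k - 3) / (k - 1) := fun h => by
    field_simp at h; exact h2 (by linarith)
  have e5 : (1 : ℝ) ≠ (2 * k - 3) / (k - 1) := fun h => by
    field_simp at h; exact h2 (by linarith)
  have e6 : (1 : ℝ) ≠ (k - 3) / (k - 1) := fun h => by field_simp at h; linarith
  have e7 : (3 : ℝ) ≠ (2 * k - 3) / (k - 1) := fun h => by
    field_simp at h; exact h0.ne' (by linarith)
  have e8 : (3 : ℝ) ≠ (k - 3) / (k - 1) := fun h => by field_simp at h; exact h0.ne' (by linarith)
  have e9 : (2 * k - 3) / (k - 1) ≠ (k - 3) / (k - 1) := fun h => by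
    field_simp at h; exact h0.ne' (by linarith)
  intro i j hij
  fin_cases i <;> fin_cases j <;> first | rfl | exfalso
  all_goals
    simp only [exponents] at hij
    first
    | exact absurd hij (by assumption)
    | exact absurd hij.symm (by assumption)
    | exact absurd hij (by norm_num)

end

theorem G9_combination_eq {k : ℝ} (h1 : k ≠ 1) (c : Fin 7 → ℝ) {x : ℝ} (hx : 0 < x) :
    ∑ i, c i * G9 k i x = x * pullback k c (x ^ (k - 1)) := by
  have hm : k - 1 ≠ 0 := sub_ne_zero.2 h1
  have hpow : ∀ p q : ℝ, 1 + (k - 1) * p = q → x ^ q = x * (x ^ (k - 1)) ^ p := fun p q h => by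
    rw [← Real.rpow_mul hx.le, ← h, Real.rpow_add hx, Real.rpow_one]
  have e0 : (1 : ℝ) = x * (x ^ (k - 1)) ^ (-1 / (k - 1)) := by
    rw [← hpow _ 0 (by field_simp; ring), Real.rpow_zero]
  have e1 := hpow 1 k (by ring)
  have e6 := hpow 3 (3 * k - 2) (by ring)
  have e5 := hpow ((2 * k - 3) / (k - 1)) (2 * k - 2) (by field_simp; ring)
  have e3 := hpow ((k - 3) / (k - 1)) (k - 2) (by field_simp; ring)
  have es : x ^ (2 * k - 2) = (x ^ (k - 1)) ^ 2 := by
    rw [← Real.rpow_natCast, ← Real.rpow_mul hx.le]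
    congr 1
    push_cast
    ring
  have es' : x ^ (2 * k - 1) = x * (x ^ (k - 1)) ^ 2 := by
    rw [hpow 2 (2 * k - 1) (by ring)]
    norm_num
  rw [Fin.sum_univ_seven, pullback, Fin.sum_univ_five]
  have a0 : G9 k 0 x = 1 := rfl
  have a1 : G9 k 1 x = x ^ k := rfl
  have a2 : G9 k 2 x = x ^ (3 * k - 2) := rfl
  have a3 : G9 k 3 x = x ^ (2 * k - 2) := rfl
  have a4 : G9 k 4 x = x ^ (k - 2) := rfl
  have a5 : G9 k 5 x = (1 + x ^ (2 * k - 2)) * (x + k * x ^ (2 * k - 1)) := rfl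
  have a6 : G9 k 6 x = (1 + x ^ (2 * k - 2)) * (x + k * x ^ (2 * k - 1))
      * Real.arctan (x ^ (k - 1)) := rfl
  have b0 : exponents k 0 = -1 / (k - 1) := rfl
  have b1 : exponents k 1 = 1 := rfl
  have b2 : exponents k 2 = 3 := rfl
  have b3 : exponents k 3 = (2 * k - 3) / (k - 1) := rfl
  have b4 : exponents k 4 = (k - 3) / (k - 1) := rfl
  have d0 : c (Fin.castLE (by norm_num) (0 : Fin 5)) = c 0 := rfl
  have d1 : c (Fin.castLE (by norm_num) (1 : Fin 5)) = c 1 := rfl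
  have d2 : c (Fin.castLE (by norm_num) (2 : Fin 5)) = c 2 := rfl
  have d3 : c (Fin.castLE (by norm_num) (3 : Fin 5)) = c 3 := rfl
  have d4 : c (Fin.castLE (by norm_num) (4 : Fin 5)) = c 4 := rfl
  rw [a0, a1, a2, a3, a4, a5, a6, b0, b1, b2, b3, b4, d0, d1, d2, d3, d4, es, es', factorV, factorU]
  -- Rewriting with `es` also replaced the member x^(2k-2) of the family itself, hence the
  -- correction `e5 - es`.
  linear_combination c 0 * e0 + c 1 * e1 + c 2 * e6 + c 3 * (e5 - es) + c 4 * e3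

/-- For k ≠ 1 the map x ↦ x^(k-1) is a local diffeomorphism of the positive axis, and the factor x
has no zero there. -/
theorem order_comp_rpow {k : ℝ} (h1 : k ≠ 1) {f F : ℝ → ℝ}
    (hF : AnalyticOnNhd ℝ F (Ioi 0)) (hf : ∀ x > 0, f x = x * F (x ^ (k - 1))) {x : ℝ} (hx : 0 < x) :
    AnalyticAt ℝ f x ∧ analyticOrderAt f x = analyticOrderAt F (x ^ (k - 1)) := by
  have hu := analyticAt_rpow (k - 1) hx
  have hF' := hF (x ^ (k - 1)) (Real.rpow_pos_of_pos hx _)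
  have hc : AnalyticAt ℝ (F ∘ fun y => y ^ (k - 1)) x :=
    AnalyticAt.comp (f := fun y : ℝ => y ^ (k - 1)) hF' hu
  have he : f =ᶠ[𝓝 x] fun y => y * (F ∘ fun y => y ^ (k - 1)) y := by
    filter_upwards [lt_mem_nhds hx] with y hy using hf y hy
  refine ⟨(analyticAt_id.mul hc).congr he.symm, ?_⟩
  rw [analyticOrderAt_congr he,
    ZerosLE.order_mul (g := fun y => y) hc analyticAt_id hx.ne',
    analyticOrderAt_comp_of_deriv_ne_zero (f := F) hu]
  rw [(Real.hasDerivAt_rpow_const (Or.inl hx.ne')).deriv]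
  exact mul_ne_zero (sub_ne_zero.2 h1) (Real.rpow_pos_of_pos hx _).ne'

theorem numPosZeros_le {k : ℝ} (h1 : k ≠ 1) {f F : ℝ → ℝ} {n : ℕ}
    (hF : AnalyticOnNhd ℝ F (Ioi 0)) (hf : ∀ x > 0, f x = x * F (x ^ (k - 1)))
    (h : ZerosLE F (Ioi 0) n) : numPosZeros f ≤ n := by
  refine iSup₂_le fun S hS => ?_
  rw [Finset.sum_congr rfl fun x hx => (zeroMult_eq_analyticOrderAt
    (order_comp_rpow h1 hF hf (hS x hx).1).1).trans (order_comp_rpow h1 hF hf (hS x hx).1).2]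
  have hc := h.comp (I := Ioi 0) (u := fun x => x ^ (k - 1))
    (fun x hx => Real.rpow_pos_of_pos hx _)
    (fun x hx y hy hxy => Real.rpow_left_injOn (sub_ne_zero.2 h1) (mem_Ioi.1 hx).le
      (mem_Ioi.1 hy).le hxy)
    (fun x hx => analyticAt_rpow _ hx) fun x hx => by
      rw [(Real.hasDerivAt_rpow_const (Or.inl (ne_of_gt hx))).deriv]
      exact mul_ne_zero (sub_ne_zero.2 h1) (Real.rpow_pos_of_pos hx _).ne'
  refine le_trans (le_of_eq (Finset.sum_congr rfl fun x hx => ?_)) (hc S fun x hx => (hS x hx).1)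
  have hx0 := (hS x hx).1
  rw [analyticOrderAt_comp_of_deriv_ne_zero (f := F) (analyticAt_rpow _ hx0)]
  rw [(Real.hasDerivAt_rpow_const (Or.inl hx0.ne')).deriv]
  exact mul_ne_zero (sub_ne_zero.2 h1) (Real.rpow_pos_of_pos hx0 _).ne'

/-- None of the zeros of the zero function is isolated, so it does no harm in the supremum. -/
theorem numPosZeros_zero : numPosZeros 0 = 0 := by
  refine le_antisymm (iSup₂_le fun S hS => ?_) zero_le
  rw [Finset.sum_eq_zero]
  intro x hx
  obtain ⟨y, hy⟩ := (hS x hx).2.2.exists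
  exact absurd rfl hy

theorem eulerSymbol_exponents {k : ℝ} (h1 : k ≠ 1) (i : Fin 5) :
    eulerSymbol (annihilators k) (exponents k i) = 0 := by
  have hm : k - 1 ≠ 0 := sub_ne_zero.2 h1
  refine List.prod_eq_zero ?_
  fin_cases i
  · refine List.mem_map.2 ⟨(k - 1, 1), by simp [annihilators], ?_⟩
    simp only [exponents]
    norm_num
    field_simp
    ring
  · exact List.mem_map.2 ⟨(1, -1), by simp [annihilators], by simp [exponents]⟩
  · exact List.mem_map.2 ⟨(1, -3), by simp [annihilators], by simp [exponents]⟩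
  · refine List.mem_map.2 ⟨(k - 1, 3 - 2 * k), by simp [annihilators], ?_⟩
    simp only [exponents]
    norm_num
    field_simp
    ring
  · refine List.mem_map.2 ⟨(k - 1, 3 - k), by simp [annihilators], ?_⟩
    simp only [exponents]
    norm_num
    field_simp
    ring

theorem eulerOps_pullback {k : ℝ} (h1 : k ≠ 1) (c : Fin 7 → ℝ) :
    EqOn (eulerOps (annihilators k) (pullback k c))
      (fun t => c 5 * imageU k t + c 6 * imageV k t) (Ioi 0) := fun t ht => by
  -- The powers and the two extra functions are gathered into one indexed sum, so that linearity
  -- applies once.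
  have h : pullback k c = fun t => ∑ i : Option (Option (Fin 5)),
      (Option.elim i (c 6) fun j => Option.elim j (c 5) fun i => c (i.castLE (by norm_num))) *
      (Option.elim i (factorV k) fun j => Option.elim j (factorU k) fun i => fun t =>
        t ^ exponents k i) t := by
    ext t
    simp only [pullback, Fintype.sum_option, Option.elim]
    ring
  rw [h, eulerOps_sum _ _ _ _ isOpen_Ioi _ ht]
  · simp only [Fintype.sum_option, Option.elim, eulerOps_factorU, eulerOps_factorV]
    rw [Finset.sum_eq_zero fun i _ => by
      rw [eulerOps_rpow _ _ ht, eulerSymbol_exponents h1]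
      simp]
    ring
  · rintro (_ | _ | i) - t ht
    · exact analyticAt_factorV k t
    · exact analyticAt_factorU k t
    · exact analyticAt_rpow _ ht

/-- The combinations of the two images have at most `n` positive zeros, with multiplicity. -/
def ImageZerosLE (k : ℝ) (n : ℕ) : Prop :=
  ∀ α β : ℝ, (α ≠ 0 ∨ β ≠ 0) → ZerosLE (fun t => α * imageU k t + β * imageV k t) (Ioi 0) n

theorem annihilators_ne_zero {k : ℝ} (h1 : k ≠ 1) : ∀ ab ∈ annihilators k, ab.1 ≠ 0 := by
  have hm : k - 1 ≠ 0 := sub_ne_zero.2 h1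
  simp [annihilators, hm]

/-- The five operators account for the extra 5. If both non-power coefficients vanish, the image is
zero and says nothing; then five distinct powers have at most 4 zeros. -/
theorem maxPosZeros_le {k : ℝ} (h0 : 0 < k) (h1 : k ≠ 1) (h2 : k ≠ 2) (h3 : k ≠ 2 / 3) {n : ℕ}
    (h : ImageZerosLE k n) : maxPosZeros (G9 k) ≤ ((n + 5 : ℕ) : ℕ∞) := by
  refine iSup₂_le fun f hf => ?_
  obtain ⟨c, rfl⟩ := (Submodule.mem_span_range_iff_exists_fun ℝ).1 hf
  by_cases hc : c = 0
  · simp [hc, numPosZeros_zero]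
  have hfun : (∑ i, c i • G9 k i) = fun x => ∑ i, c i * G9 k i x := by
    ext x
    simp
  rw [hfun]
  refine numPosZeros_le h1 (analytic_pullback k c) (fun x hx => G9_combination_eq h1 c hx) ?_
  by_cases h56 : c 5 ≠ 0 ∨ c 6 ≠ 0
  · exact ZerosLE.of_eulerOps (annihilators_ne_zero h1) (analytic_pullback k c)
      ((h _ _ h56).congr isOpen_Ioi (eulerOps_pullback h1 c))
  · push Not at h56
    have hz := zerosLE_sum_rpow_of_injOn Finset.univ (fun i : Fin 5 => c (i.castLE (by norm_num)))
      (exponents k) ((exponents_injective h0 h1 h2 h3).injOn) (by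
        by_contra hcon
        push Not at hcon
        refine hc (funext fun i => ?_)
        by_cases hi : (i : ℕ) < 5
        · exact hcon ⟨i, hi⟩ (Finset.mem_univ _)
        · have : i = 5 ∨ i = 6 := by omega
          rcases this with rfl | rfl
          · exact h56.1
          · exact h56.2)
    refine ZerosLE.mono_nat (m := 4) ?_ (by omega)
    refine hz.congr isOpen_Ioi fun t _ => ?_
    simp [pullback, h56.1, h56.2]

/-! ### Lifting zeros of the images: the lower bounds 6 and 7 -/

theorem annihilators_pairwise {k : ℝ} (h0 : 0 < k) (h1 : k ≠ 1) (h2 : k ≠ 2) (h3 : k ≠ 2 / 3) :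
    (annihilators k).Pairwise fun x y => -x.2 / x.1 ≠ -y.2 / y.1 := by
  have hi := exponents_injective h0 h1 h2 h3
  have e0 : exponents k 0 = -1 / (k - 1) := rfl
  have e1 : exponents k 1 = - -1 / 1 := by rw [neg_neg, div_one]; rfl
  have e2 : exponents k 2 = - -3 / 1 := by rw [neg_neg, div_one]; rfl
  have e3 : exponents k 3 = -(3 - 2 * k) / (k - 1) := by rw [neg_sub]; rfl
  have e4 : exponents k 4 = -(3 - k) / (k - 1) := by rw [neg_sub]; rfl
  simp only [annihilators, List.pairwise_cons, List.mem_cons, List.not_mem_nil, or_false,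
    forall_eq_or_imp, forall_eq, ← e0, ← e1, ← e2, ← e3, ← e4, hi.ne_iff]
  simp

theorem exists_span_of_kernelPowers {k : ℝ} (h1 : k ≠ 1) {g : ℝ → ℝ}
    (hg : g ∈ Submodule.span ℝ (kernelPowers (annihilators k))) :
    ∃ f ∈ Submodule.span ℝ (range (G9 k)), ∀ x > 0, f x = x * g (x ^ (k - 1)) := by
  induction hg using Submodule.span_induction with
  | mem g hg =>
    obtain ⟨ab, hab, rfl⟩ := hg
    have hex : ∃ i : Fin 5, exponents k i = -ab.2 / ab.1 := by
      simp only [annihilators, List.mem_cons, List.not_mem_nil, or_false] at hab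
      rcases hab with rfl | rfl | rfl | rfl | rfl
      · exact ⟨4, by rw [neg_sub]; rfl⟩
      · exact ⟨3, by rw [neg_sub]; rfl⟩
      · exact ⟨0, rfl⟩
      · exact ⟨2, by rw [neg_neg, div_one]; rfl⟩
      · exact ⟨1, by rw [neg_neg, div_one]; rfl⟩
    obtain ⟨i, hi⟩ := hex
    refine ⟨G9 k (i.castLE (by norm_num)), Submodule.subset_span ⟨_, rfl⟩, fun x hx => ?_⟩
    have := G9_combination_eq h1 (Pi.single (i.castLE (by norm_num)) 1) hx
    rw [Finset.sum_eq_single (i.castLE (by norm_num)) (fun j _ hj => by simp [hj]) (by simp)] at this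
    rw [Pi.single_eq_same, one_mul] at this
    rw [this, pullback, Finset.sum_eq_single i (fun j _ hj => by
      rw [Pi.single_eq_of_ne, zero_mul]
      exact fun h => hj (Fin.castLE_injective _ h)) (by simp), ← hi, Pi.single_eq_same, one_mul]
    rw [Pi.single_eq_of_ne, Pi.single_eq_of_ne]
    · simp
    all_goals
      intro h
      have := congrArg Fin.val h
      have := i.isLt
      simp at *
      omega
  | zero => exact ⟨0, zero_mem _, fun x _ => by simp⟩
  | add g₁ g₂ _ _ ih₁ ih₂ =>
    obtain ⟨f₁, hf₁, h₁⟩ := ih₁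
    obtain ⟨f₂, hf₂, h₂⟩ := ih₂
    exact ⟨f₁ + f₂, add_mem hf₁ hf₂, fun x hx => by
      rw [Pi.add_apply, Pi.add_apply, h₁ x hx, h₂ x hx, mul_add]⟩
  | smul a g _ ih =>
    obtain ⟨f, hf, h⟩ := ih
    exact ⟨a • f, Submodule.smul_mem _ _ hf, fun x hx => by
      rw [Pi.smul_apply, Pi.smul_apply, h x hx, smul_eq_mul, smul_eq_mul]
      ring⟩

/-- A zero of order `n` of a combination of the two images gives a function in the span of the
family with a zero of multiplicity at least `n + 5`. -/
theorem le_maxPosZeros {k : ℝ} (h0 : 0 < k) (h1 : k ≠ 1) (h2 : k ≠ 2) (h3 : k ≠ 2 / 3) {n N : ℕ}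
    (h : ImageZerosLE k N) {α β t : ℝ} (hαβ : α ≠ 0 ∨ β ≠ 0) (ht : 0 < t)
    (hord : n ≤ analyticOrderAt (fun t => α * imageU k t + β * imageV k t) t) :
    ((n + 5 : ℕ) : ℕ∞) ≤ maxPosZeros (G9 k) := by
  set c : Fin 7 → ℝ := ![0, 0, 0, 0, 0, α, β] with hc
  have hP := eulerOps_pullback h1 c
  have hP' : analyticOrderAt (eulerOps (annihilators k) (pullback k c)) t
      = analyticOrderAt (fun t => α * imageU k t + β * imageV k t) t := by
    refine analyticOrderAt_congr ?_
    filter_upwards [lt_mem_nhds ht] with y hy using hP hy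
  obtain ⟨g, hg, hgo⟩ := exists_order_eq_add_length _ (annihilators_ne_zero h1)
    (annihilators_pairwise h0 h1 h2 h3) ht (analytic_pullback k c)
  rw [hP'] at hgo
  obtain ⟨f₁, hf₁, hfg⟩ := exists_span_of_kernelPowers h1 hg
  set f₂ : ℝ → ℝ := ∑ i, c i • G9 k i with hf₂
  have hf₂' : ∀ x > 0, f₂ x = x * pullback k c (x ^ (k - 1)) := fun x hx => by
    rw [← G9_combination_eq h1 c hx, hf₂]
    simp
  set x := t ^ (k - 1)⁻¹ with hx
  have hx0 : 0 < x := Real.rpow_pos_of_pos ht _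
  have hxt : x ^ (k - 1) = t := by
    rw [hx, ← Real.rpow_mul ht.le, inv_mul_cancel₀ (sub_ne_zero.2 h1), Real.rpow_one]
  have hga : AnalyticOnNhd ℝ g (Ioi 0) := by
    clear hgo hfg
    induction hg using Submodule.span_induction with
    | mem g hg =>
      obtain ⟨ab, -, rfl⟩ := hg
      exact fun y hy => analyticAt_rpow _ hy
    | zero => exact analyticOnNhd_const
    | add g₁ g₂ _ _ ih₁ ih₂ => exact ih₁.add ih₂
    | smul a g _ ih => exact ih.const_smul
  obtain ⟨hfa, hfo⟩ := order_comp_rpow h1 (f := f₂ + f₁) (F := fun y => pullback k c y + g y)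
    ((analytic_pullback k c).add hga) (fun y hy => by
      rw [Pi.add_apply, hf₂' y hy, hfg y hy, mul_add]) hx0
  rw [hxt, hgo] at hfo
  have hlen : (annihilators k).length = 5 := rfl
  -- Finiteness of the order is what makes the lifted zero isolated.
  have hnt : analyticOrderAt (fun t => α * imageU k t + β * imageV k t) t ≠ ⊤ :=
    (h α β hαβ).ne_top ht
  have hle : ((n + 5 : ℕ) : ℕ∞) ≤ analyticOrderAt (f₂ + f₁) x := by
    rw [hfo, hlen]
    push_cast
    gcongr
  have hnt' : analyticOrderAt (f₂ + f₁) x ≠ ⊤ := by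
    rw [hfo]
    exact fun h => (ENat.add_eq_top.1 h).elim hnt (ENat.natCast_ne_top _)
  have hmem : f₂ + f₁ ∈ Submodule.span ℝ (range (G9 k)) :=
    add_mem (Submodule.sum_mem _ fun i _ => Submodule.smul_mem _ _
      (Submodule.subset_span ⟨i, rfl⟩)) hf₁
  refine le_iSup₂_of_le _ hmem (le_iSup₂_of_le {x} ?_ ?_)
  · intro y hy
    rw [Finset.mem_singleton] at hy
    subst hy
    refine ⟨hx0, apply_eq_zero_of_analyticOrderAt_ne_zero fun h => ?_, ?_⟩
    · rw [h] at hle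
      simp at hle
    · refine hfa.eventually_eq_zero_or_eventually_ne_zero.resolve_left fun h => hnt' ?_
      exact analyticOrderAt_eq_top.2 h
  · rw [Finset.sum_singleton, zeroMult_eq_analyticOrderAt hfa]
    exact hle

theorem analyticAt_imageU (k t : ℝ) : AnalyticAt ℝ (imageU k) t := by
  unfold imageU polyQ
  fun_prop

theorem analyticAt_imageV (k t : ℝ) : AnalyticAt ℝ (imageV k) t := by
  refine ((analyticAt_imageU k t).mul (analyticAt_arctan t)).add (AnalyticAt.div ?_ ?_ ?_)
  · unfold polyR
    fun_prop
  · fun_prop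
  · exact pow_ne_zero _ (one_add_sq_pos t).ne'

theorem analyticAt_image (k α β t : ℝ) :
    AnalyticAt ℝ (fun t => α * imageU k t + β * imageV k t) t :=
  (analyticAt_const.mul (analyticAt_imageU k t)).add (analyticAt_const.mul (analyticAt_imageV k t))

/-- Some nontrivial combination of U and V vanishes at t = 1, as at any other point; lift it. -/
theorem six_le_maxPosZeros {k : ℝ} (h0 : 0 < k) (h1 : k ≠ 1) (h2 : k ≠ 2) (h3 : k ≠ 2 / 3) {N : ℕ}
    (h : ImageZerosLE k N) : 6 ≤ maxPosZeros (G9 k) := by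
  obtain ⟨α, β, hαβ, hz⟩ : ∃ α β : ℝ, (α ≠ 0 ∨ β ≠ 0) ∧ α * imageU k 1 + β * imageV k 1 = 0 := by
    by_cases hU : imageU k 1 = 0
    · exact ⟨1, 0, Or.inl one_ne_zero, by simp [hU]⟩
    · exact ⟨-imageV k 1, imageU k 1, Or.inr hU, by ring⟩
  refine le_maxPosZeros h0 h1 h2 h3 h (n := 1) hαβ one_pos ?_
  exact_mod_cast Order.one_le_iff_ne_zero.2
    ((analyticAt_image k α β 1).analyticOrderAt_ne_zero.2 hz)

/-- At a zero of the Wronskian the vectors (U, V) and (U', V') are dependent, so a nontrivial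
combination vanishes to order 2. -/
theorem seven_le_maxPosZeros {k : ℝ} (h0 : 0 < k) (h1 : k ≠ 1) (h2 : k ≠ 2) (h3 : k ≠ 2 / 3) {N : ℕ}
    (h : ImageZerosLE k N) (hE : ∃ s > 0, polyE k s = 0) : 7 ≤ maxPosZeros (G9 k) := by
  obtain ⟨s, hs, hs0⟩ := hE
  set t := Real.sqrt s with ht
  have ht0 : 0 < t := Real.sqrt_pos.2 hs
  have hts : t ^ 2 = s := Real.sq_sqrt hs.le
  have hW := wronskian_image k t
  rw [hts, hs0, mul_zero, zero_div] at hW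
  obtain ⟨α, β, hαβ, hz, hz'⟩ : ∃ α β : ℝ, (α ≠ 0 ∨ β ≠ 0) ∧
      α * imageU k t + β * imageV k t = 0 ∧
      α * deriv (imageU k) t + β * deriv (imageV k) t = 0 := by
    by_cases hU : imageU k t = 0
    · by_cases hU' : deriv (imageU k) t = 0
      · exact ⟨1, 0, Or.inl one_ne_zero, by simp [hU], by simp [hU']⟩
      · refine ⟨-deriv (imageV k) t, deriv (imageU k) t, Or.inr hU', ?_, by ring⟩
        linarith
    · exact ⟨-imageV k t, imageU k t, Or.inr hU, by ring, by linarith⟩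
  refine le_maxPosZeros h0 h1 h2 h3 h (n := 2) hαβ ht0 ?_
  rw [natCast_le_analyticOrderAt_iff_iteratedDeriv_eq_zero (analyticAt_image k α β t)]
  intro i hi
  interval_cases i
  · simpa using hz
  · rw [iteratedDeriv_one]
    have hd := ((hasDerivAt_imageU k t).differentiableAt.hasDerivAt.const_mul α).add
      ((hasDerivAt_imageV k t).differentiableAt.hasDerivAt.const_mul β)
    exact hd.deriv.trans hz'

/-! ### Distributing zeros over intervals; the level functions V - cU -/

/-- Take for m the least bound on `I`. It is attained by a finite set, which leaves at most n - m
zeros for `J`. -/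
theorem ZerosLE.exists_split {f : ℝ → ℝ} {I J K : Set ℝ} {n : ℕ} (h : ZerosLE f K n)
    (hI : I ⊆ K) (hJ : J ⊆ K) (hIJ : Disjoint I J) :
    ∃ m m', m + m' = n ∧ ZerosLE f I m ∧ ZerosLE f J m' := by
  classical
  have hex : ∃ m, ZerosLE f I m := ⟨n, h.mono_set hI⟩
  set m := Nat.find hex with hm
  have hmI : ZerosLE f I m := Nat.find_spec hex
  have hmn : m ≤ n := Nat.find_le (h.mono_set hI)
  obtain ⟨S, hS, hSm⟩ : ∃ S : Finset ℝ, (∀ x ∈ S, x ∈ I) ∧ (m : ℕ∞) ≤ ∑ x ∈ S, analyticOrderAt f x := by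
    rcases Nat.eq_zero_or_pos m with h0 | hpos
    · exact ⟨∅, by simp, by simp [h0]⟩
    have hnot : ¬ ZerosLE f I (m - 1) := Nat.find_min hex (by omega)
    unfold ZerosLE at hnot
    push Not at hnot
    obtain ⟨S, hS, hlt⟩ := hnot
    refine ⟨S, hS, ?_⟩
    have := Order.add_one_le_of_lt hlt
    refine le_trans (le_of_eq ?_) this
    norm_cast
    omega
  refine ⟨m, n - m, by omega, hmI, fun T hT => ?_⟩
  have hd : Disjoint S T := Finset.disjoint_left.2 fun x hx hx' =>
    Set.disjoint_left.1 hIJ (hS x hx) (hT x hx')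
  have hU := h (S ∪ T) fun x hx => by
    rcases Finset.mem_union.1 hx with hx | hx
    · exact hI (hS x hx)
    · exact hJ (hT x hx)
  rw [Finset.sum_union hd] at hU
  have h2 : (m : ℕ∞) + ∑ x ∈ T, analyticOrderAt f x ≤ m + (n - m : ℕ) := by
    refine (add_le_add_left hSm _).trans (hU.trans (le_of_eq ?_))
    norm_cast
    omega
  exact (ENat.add_le_add_iff_left (ENat.natCast_ne_top m)).1 h2

/-- Between negative end values, a positive value would force two zeros and a touching maximum a
double one. -/
theorem neg_of_zerosLE_one {f : ℝ → ℝ} {a b : ℝ} (hf : ∀ x, AnalyticAt ℝ f x) (ha : f a < 0)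
    (hb : f b < 0) (h : ZerosLE f (Ioo a b) 1) : ∀ x ∈ Ioo a b, f x < 0 := by
  have hcont : Continuous f := continuous_iff_continuousAt.2 fun x => (hf x).continuousAt
  have hnonpos : ∀ x ∈ Ioo a b, f x ≤ 0 := by
    intro x hx
    by_contra hpos
    push Not at hpos
    obtain ⟨y, hy, hy0⟩ := intermediate_value_Ioo hx.1.le hcont.continuousOn ⟨ha, hpos⟩
    obtain ⟨z, hz, hz0⟩ := intermediate_value_Ioo' hx.2.le hcont.continuousOn ⟨hb, hpos⟩
    have hyz : y ≠ z := (hy.2.trans hz.1).ne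
    have := h {y, z} (by
      intro w hw
      rcases Finset.mem_insert.1 hw with rfl | hw
      · exact ⟨hy.1, hy.2.trans hx.2⟩
      · rw [Finset.mem_singleton.1 hw]
        exact ⟨hx.1.trans hz.1, hz.2⟩)
    rw [Finset.sum_pair hyz] at this
    have h1 := Order.one_le_iff_ne_zero.2 ((hf y).analyticOrderAt_ne_zero.2 hy0)
    have h2 := Order.one_le_iff_ne_zero.2 ((hf z).analyticOrderAt_ne_zero.2 hz0)
    have h3 := (add_le_add h1 h2).trans this
    norm_num at h3
  intro x hx
  refine (hnonpos x hx).lt_of_ne fun hx0 => ?_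
  have hmax : IsLocalMax f x := by
    filter_upwards [Ioo_mem_nhds hx.1 hx.2] with y hy
    rw [hx0]
    exact hnonpos y hy
  have h2 : ((2 : ℕ) : ℕ∞) ≤ analyticOrderAt f x := by
    rw [natCast_le_analyticOrderAt_iff_iteratedDeriv_eq_zero (hf x)]
    intro i hi
    interval_cases i
    · simpa using hx0
    · rw [iteratedDeriv_one]
      exact hmax.deriv_eq_zero
  have h1 := h {x} (by simpa using hx)
  rw [Finset.sum_singleton] at h1
  have := h2.trans h1
  norm_num at this

noncomputable section

/-- The Wronskian factor as a function of `t`. -/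
def wronskE (k t : ℝ) : ℝ := polyE k (t ^ 2)

/-- The combination whose zeros away from those of `imageU` are the solutions of `quotVU k t = c`. -/
def levelFun (k c t : ℝ) : ℝ := imageV k t - c * imageU k t

end

theorem analyticAt_wronskE (k t : ℝ) : AnalyticAt ℝ (wronskE k) t := by
  unfold wronskE polyE
  fun_prop

theorem continuous_wronskE (k : ℝ) : Continuous (wronskE k) :=
  continuous_iff_continuousAt.2 fun t => (analyticAt_wronskE k t).continuousAt

theorem analyticAt_levelFun (k c t : ℝ) : AnalyticAt ℝ (levelFun k c) t :=
  (analyticAt_imageV k t).sub (analyticAt_const.mul (analyticAt_imageU k t))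

theorem imageZerosLE_of_level {k : ℝ} {n : ℕ} (hU : ZerosLE (imageU k) (Ioi 0) n)
    (hV : ∀ c, ZerosLE (levelFun k c) (Ioi 0) n) : ImageZerosLE k n := by
  intro α β hαβ
  by_cases hβ : β = 0
  · have hα : α ≠ 0 := hαβ.resolve_right fun h => h hβ
    refine (hU.mul_left (g := fun _ => α) (fun t _ => analyticAt_imageU k t)
      (fun t _ => analyticAt_const) fun t _ => hα).congr isOpen_Ioi fun t _ => ?_
    simp [hβ]
  · refine ((hV (-α / β)).mul_left (g := fun _ => β) (fun t _ => analyticAt_levelFun k _ t)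
      (fun t _ => analyticAt_const) fun t _ => hβ).congr isOpen_Ioi fun t _ => ?_
    rw [levelFun]
    field_simp
    ring

theorem levelFun_eq {k c t : ℝ} (h : imageU k t ≠ 0) :
    levelFun k c t = imageU k t * (quotVU k t - c) := by
  rw [levelFun, imageV_eq h, imageU]
  ring

theorem analyticAt_quotVU {k t : ℝ} (h : imageU k t ≠ 0) : AnalyticAt ℝ (quotVU k) t := by
  refine ((analyticAt_imageV k t).div (analyticAt_imageU k t) h).congr ?_
  filter_upwards [(analyticAt_imageU k t).continuousAt.eventually_ne h] with y hy
  rw [Pi.div_apply, imageV_eq hy]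
  exact mul_div_cancel_left₀ _ hy

section pieces

variable {k c : ℝ} {J : Set ℝ} {n : ℕ}

/-- Where U ≠ 0 the level function is U (V/U - c), and (V/U)' is E times a nonvanishing factor, so
Rolle applies. -/
theorem levelFun_zerosLE_succ (hJ : J.OrdConnected) (hopen : IsOpen J) (hpos : ∀ t ∈ J, 0 < t)
    (hU : ∀ t ∈ J, imageU k t ≠ 0) (h : ZerosLE (wronskE k) J n) :
    ZerosLE (levelFun k c) J (n + 1) := by
  have hq : AnalyticOnNhd ℝ (quotVU k) J := fun t ht => analyticAt_quotVU (hU t ht)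
  have h1 : ZerosLE (deriv fun t => quotVU k t - c) J n := by
    refine (h.mul_left (g := fun t => 32 * t ^ 4 / (imageU k t ^ 2 * (1 + t ^ 2) ^ 5))
      (fun t _ => analyticAt_wronskE k t) (fun t ht => ?_) fun t ht => ?_).congr hopen
        fun t ht => ?_
    · refine AnalyticAt.div (by fun_prop) (((analyticAt_imageU k t).pow 2).mul (by fun_prop)) ?_
      exact mul_ne_zero (pow_ne_zero _ (hU t ht)) (pow_ne_zero _ (one_add_sq_pos t).ne')
    · exact div_ne_zero (mul_ne_zero (by norm_num) (pow_ne_zero _ (hpos t ht).ne'))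
        (mul_ne_zero (pow_ne_zero _ (hU t ht)) (pow_ne_zero _ (one_add_sq_pos t).ne'))
    · rw [deriv_sub_const_fun, (hasDerivAt_quotVU (hU t ht)).deriv, wronskE, imageU]
      ring
  have h2 := (h1.rolle hJ (hq.sub analyticOnNhd_const)).mul_left (g := imageU k)
    (hq.sub analyticOnNhd_const) (fun t _ => analyticAt_imageU k t) hU
  exact h2.congr hopen fun t ht => levelFun_eq (hU t ht)

theorem levelFun_zerosLE_of_ne (hU : ∀ t ∈ J, imageU k t ≠ 0) (h : ∀ t ∈ J, quotVU k t ≠ c) :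
    ZerosLE (levelFun k c) J n := ZerosLE.of_ne_zero fun t ht => by
  rw [levelFun_eq (hU t ht)]
  exact mul_ne_zero (hU t ht) (sub_ne_zero.2 (h t ht))

end pieces

/-- At a zero of U only the rational term of V remains, and by `polyR_eq` its numerator is t⁵ (A +
Bt²). -/
theorem levelFun_ne_at_root {k c t : ℝ} (ht : 0 < t) (hU : imageU k t = 0)
    (hAB : coefA k + coefB k * t ^ 2 ≠ 0) : levelFun k c t ≠ 0 := by
  rw [levelFun, hU, mul_zero, sub_zero, imageV]
  rw [imageU] at hU
  rw [hU, zero_mul, zero_add, polyR_eq, hU, zero_mul, zero_add]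
  have := (one_add_sq_pos t).ne'
  positivity

/-- The remainder does not vanish at positive zeros of `polyQ`. -/
def RemainderNeZero (k : ℝ) : Prop := ∀ s > 0, polyQ k s = 0 → coefA k + coefB k * s ≠ 0

theorem levelFun_zerosLE_singleton {k c t : ℝ} (hR : RemainderNeZero k) (ht : 0 < t)
    (hU : imageU k t = 0) : ZerosLE (levelFun k c) {t} 0 := ZerosLE.of_ne_zero fun y hy => by
  rw [mem_singleton_iff.1 hy]
  exact levelFun_ne_at_root ht hU (hR _ (by positivity) hU)

/-! ### Crude bounds from the numbers of zeros of Q and E -/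

section templates

variable {k : ℝ}

theorem levelFun_of_pos {c : ℝ} {n : ℕ} (hU : ∀ t > 0, imageU k t ≠ 0)
    (h : ZerosLE (wronskE k) (Ioi 0) n) : ZerosLE (levelFun k c) (Ioi 0) (n + 1) :=
  levelFun_zerosLE_succ ordConnected_Ioi isOpen_Ioi (fun _ ht => ht) hU h

theorem imageZerosLE_of_pos {n : ℕ} (hU : ∀ t > 0, imageU k t ≠ 0)
    (h : ZerosLE (wronskE k) (Ioi 0) n) : ImageZerosLE k (n + 1) :=
  imageZerosLE_of_level (ZerosLE.of_ne_zero hU) fun _ => levelFun_of_pos hU h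

theorem levelFun_glue {c t₀ : ℝ} {m n : ℕ} (hR : RemainderNeZero k) (ht : 0 < t₀)
    (hU : imageU k t₀ = 0) {a : ℝ} {J : Set ℝ} (hm : ZerosLE (levelFun k c) (Ioo a t₀) m)
    (hn : ZerosLE (levelFun k c) J n) (hJ : Ioi t₀ ⊆ J) :
    ZerosLE (levelFun k c) (Ioi a) (m + n) := by
  have h := hm.union ((levelFun_zerosLE_singleton hR ht hU).union hn (subset_refl _))
    (K := Ioi a) fun t h0 => by
      rcases lt_trichotomy t t₀ with h | h | h
      · exact Or.inl ⟨h0, h⟩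
      · exact Or.inr (Or.inl h)
      · exact Or.inr (Or.inr (hJ h))
  rwa [zero_add] at h

/-- A zero of U cuts the axis into two intervals, each allowing one solution more than it has zeros
of E. -/
theorem imageZerosLE_of_le_one {n : ℕ} (hR : RemainderNeZero k)
    (hU : ZerosLE (imageU k) (Ioi 0) 1) (h : ZerosLE (wronskE k) (Ioi 0) n) :
    ImageZerosLE k (n + 2) := by
  refine imageZerosLE_of_level (hU.mono_nat (by omega)) fun c => ?_
  by_cases hno : ∀ t > 0, imageU k t ≠ 0
  · exact (levelFun_of_pos hno h).mono_nat (by omega)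
  push Not at hno
  obtain ⟨t₀, ht₀, hUt⟩ := hno
  have hne : ∀ t > 0, t ≠ t₀ → imageU k t ≠ 0 := fun t ht htt hUt' => by
    have := hU.diff_singleton (n := 0) ht₀ (analyticAt_imageU k t₀) hUt {t}
      (by simpa using ⟨ht, htt⟩)
    rw [Finset.sum_singleton] at this
    exact (analyticAt_imageU k t).analyticOrderAt_ne_zero.2 hUt' (le_antisymm this zero_le)
  obtain ⟨m, m', hmm, h1, h2⟩ := h.exists_split (I := Ioo 0 t₀) (J := Ioi t₀)
    (fun t ht => ht.1) (fun t ht => ht₀.trans ht)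
    (Set.disjoint_left.2 fun t h1 h2 => absurd h1.2 (not_lt.2 (le_of_lt h2)))
  have := levelFun_glue hR ht₀ hUt (c := c)
    (levelFun_zerosLE_succ ordConnected_Ioo isOpen_Ioo (fun t ht => ht.1)
      (fun t ht => hne t ht.1 ht.2.ne) h1)
    (levelFun_zerosLE_succ ordConnected_Ioi isOpen_Ioi (fun t ht => ht₀.trans ht)
      (fun t ht => hne t (ht₀.trans ht) (ne_of_gt ht)) h2) subset_rfl
  exact this.mono_nat (by omega)

theorem imageZerosLE_of_le_two {n : ℕ} (hR : RemainderNeZero k)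
    (hU : ZerosLE (imageU k) (Ioi 0) 2) (h : ZerosLE (wronskE k) (Ioi 0) n) :
    ImageZerosLE k (n + 3) := by
  by_cases hone : ZerosLE (imageU k) (Ioi 0) 1
  · intro α β hαβ
    exact (imageZerosLE_of_le_one hR hone h α β hαβ).mono_nat (by omega)
  refine imageZerosLE_of_level (hU.mono_nat (by omega)) fun c => ?_
  by_cases hno : ∀ t > 0, imageU k t ≠ 0
  · exact (levelFun_of_pos hno h).mono_nat (by omega)
  push Not at hno
  obtain ⟨t₀, ht₀, hUt⟩ := hno
  -- Equality is allowed when U has just one distinct zero; the middle interval is then empty.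
  have key : ∃ t₁ t₂, 0 < t₁ ∧ t₁ ≤ t₂ ∧ imageU k t₁ = 0 ∧ imageU k t₂ = 0 ∧
      ∀ t > 0, t ≠ t₁ → t ≠ t₂ → imageU k t ≠ 0 := by
    by_cases hno' : ∀ t > 0, t ≠ t₀ → imageU k t ≠ 0
    · exact ⟨t₀, t₀, ht₀, le_rfl, hUt, hUt, fun t ht h1 _ => hno' t ht h1⟩
    push Not at hno'
    obtain ⟨t₁, ht₁, hne, hUt₁⟩ := hno'
    have hthird : ∀ t > 0, t ≠ t₀ → t ≠ t₁ → imageU k t ≠ 0 := fun t ht h0 h1 hUt' => by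
      have := (hU.diff_singleton (n := 1) ht₀ (analyticAt_imageU k t₀) hUt).diff_singleton (n := 0)
        (x := t₁) ⟨ht₁, hne⟩ (analyticAt_imageU k t₁) hUt₁ {t} (by simpa using ⟨⟨ht, h0⟩, h1⟩)
      rw [Finset.sum_singleton] at this
      exact (analyticAt_imageU k t).analyticOrderAt_ne_zero.2 hUt' (le_antisymm this zero_le)
    rcases lt_or_gt_of_ne hne with hlt | hlt
    · exact ⟨t₁, t₀, ht₁, hlt.le, hUt₁, hUt, fun t ht h1 h2 => hthird t ht h2 h1⟩
    · exact ⟨t₀, t₁, ht₀, hlt.le, hUt, hUt₁, hthird⟩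
  obtain ⟨t₁, t₂, ht₁, h12, hU1, hU2, hne⟩ := key
  have ht₂ := ht₁.trans_le h12
  obtain ⟨m, m', hmm, h1, h2⟩ := h.exists_split (I := Ioo 0 t₁) (J := Ioi t₁)
    (fun t ht => ht.1) (fun t ht => ht₁.trans ht)
    (Set.disjoint_left.2 fun t h1 h2 => absurd h1.2 (not_lt.2 (le_of_lt h2)))
  obtain ⟨p, p', hpp, h3, h4⟩ := h2.exists_split (I := Ioo t₁ t₂) (J := Ioi t₂)
    (fun t ht => ht.1) (fun t ht => h12.trans_lt ht)
    (Set.disjoint_left.2 fun t h1 h2 => absurd h1.2 (not_lt.2 (le_of_lt h2)))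
  have l1 := levelFun_zerosLE_succ (c := c) ordConnected_Ioo isOpen_Ioo (fun t ht => ht.1)
      (fun t ht => hne t ht.1 ht.2.ne (ht.2.trans_le h12).ne) h1
  have l2 := levelFun_zerosLE_succ (c := c) ordConnected_Ioo isOpen_Ioo (fun t ht => ht₁.trans ht.1)
      (fun t ht => hne t (ht₁.trans ht.1) ht.1.ne' ht.2.ne) h3
  have l3 := levelFun_zerosLE_succ (c := c) ordConnected_Ioi isOpen_Ioi (fun t ht => ht₂.trans ht)
      (fun t ht => hne t (ht₂.trans ht) (h12.trans_lt ht).ne' (ne_of_gt ht)) h4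
  exact (levelFun_glue hR ht₁ hU1 l1 (levelFun_glue hR ht₂ hU2 l2 l3 subset_rfl)
    subset_rfl).mono_nat (by omega)

end templates

/-! ### Comparing V/U with its end values 0 and π/2 -/

section values

variable {k t : ℝ}

theorem quotVU_neg (ht : 0 < t) (hE : ∀ y ∈ Ioo 0 t, wronskE k y < 0)
    (hU : ∀ y ∈ Icc 0 t, imageU k y ≠ 0) : quotVU k t < 0 := by
  have h : StrictAntiOn (quotVU k) (Icc 0 t) := by
    refine strictAntiOn_of_deriv_neg (convex_Icc 0 t) (fun y hy =>
      (hasDerivAt_quotVU (hU y hy)).continuousAt.continuousWithinAt) fun y hy => ?_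
    rw [interior_Icc] at hy
    have hQ := hU y ⟨hy.1.le, hy.2.le⟩
    have hy0 := hy.1
    have hQ2 : 0 < polyQ k (y ^ 2) ^ 2 := by
      rw [imageU] at hQ
      positivity
    rw [(hasDerivAt_quotVU hQ).deriv]
    exact div_neg_of_neg_of_pos (mul_neg_of_pos_of_neg (by positivity) (hE y hy)) (by positivity)
  have := h ⟨le_rfl, ht.le⟩ ⟨ht.le, le_rfl⟩ ht
  rwa [quotVU_zero] at this

theorem quotVU_pos (ht : 0 < t) (hE : ∀ y ∈ Ioo 0 t, 0 < wronskE k y)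
    (hU : ∀ y ∈ Icc 0 t, imageU k y ≠ 0) : 0 < quotVU k t := by
  have h : StrictMonoOn (quotVU k) (Icc 0 t) := by
    refine strictMonoOn_of_deriv_pos (convex_Icc 0 t) (fun y hy =>
      (hasDerivAt_quotVU (hU y hy)).continuousAt.continuousWithinAt) fun y hy => ?_
    rw [interior_Icc] at hy
    have hQ := hU y ⟨hy.1.le, hy.2.le⟩
    have hy0 := hy.1
    have hE' : 0 < polyE k (y ^ 2) := hE y hy
    rw [(hasDerivAt_quotVU hQ).deriv]
    rw [imageU] at hQ
    positivity
  have := h ⟨le_rfl, ht.le⟩ ⟨ht.le, le_rfl⟩ ht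
  rwa [quotVU_zero] at this

theorem lt_quotVU (hc : coefQ2 k ≠ 0) (ht : 0 < t) (hE : ∀ y > t, wronskE k y < 0)
    (hU : ∀ y ≥ t, imageU k y ≠ 0) : Real.pi / 2 < quotVU k t := by
  have h : StrictAntiOn (quotVU k) (Ici t) := by
    refine strictAntiOn_of_deriv_neg (convex_Ici t) (fun y hy =>
      (hasDerivAt_quotVU (hU y hy)).continuousAt.continuousWithinAt) fun y hy => ?_
    rw [interior_Ici] at hy
    have hQ := hU y (le_of_lt hy)
    have hy0 : 0 < y := ht.trans hy
    have hQ2 : 0 < polyQ k (y ^ 2) ^ 2 := by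
      rw [imageU] at hQ
      positivity
    rw [(hasDerivAt_quotVU hQ).deriv]
    exact div_neg_of_neg_of_pos (mul_neg_of_pos_of_neg (by positivity) (hE y hy)) (by positivity)
  have h1 : quotVU k (t + 1) < quotVU k t :=
    h self_mem_Ici (by simp only [mem_Ici]; linarith) (by linarith)
  refine lt_of_le_of_lt (le_of_tendsto (tendsto_quotVU hc) ?_) h1
  filter_upwards [eventually_ge_atTop (t + 1)] with y hy
  exact h.antitoneOn (by simp only [mem_Ici]; linarith) (by simp only [mem_Ici]; linarith) hy

theorem quotVU_lt (hc : coefQ2 k ≠ 0) (ht : 0 < t) (hE : ∀ y > t, 0 < wronskE k y)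
    (hU : ∀ y ≥ t, imageU k y ≠ 0) : quotVU k t < Real.pi / 2 := by
  have h : StrictMonoOn (quotVU k) (Ici t) := by
    refine strictMonoOn_of_deriv_pos (convex_Ici t) (fun y hy =>
      (hasDerivAt_quotVU (hU y hy)).continuousAt.continuousWithinAt) fun y hy => ?_
    rw [interior_Ici] at hy
    have hQ := hU y (le_of_lt hy)
    have hy0 : 0 < y := ht.trans hy
    have hE' : 0 < polyE k (y ^ 2) := hE y hy
    rw [(hasDerivAt_quotVU hQ).deriv]
    rw [imageU] at hQ
    positivity
  have h1 : quotVU k t < quotVU k (t + 1) :=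
    h self_mem_Ici (by simp only [mem_Ici]; linarith) (by linarith)
  refine lt_of_lt_of_le h1 (ge_of_tendsto (tendsto_quotVU hc) ?_)
  filter_upwards [eventually_ge_atTop (t + 1)] with y hy
  exact h.monotoneOn (by simp only [mem_Ici]; linarith) (by simp only [mem_Ici]; linarith) hy

end values

/-! ### Sharp bounds when U has a single zero -/

section single

/-- `t₀` is the only nonnegative zero of `imageU k`. -/
structure OnlyZero (k t₀ : ℝ) : Prop where
  pos : 0 < t₀
  zero : imageU k t₀ = 0
  ne : ∀ t ≥ 0, t ≠ t₀ → imageU k t ≠ 0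

variable {k t₀ : ℝ}

/-- Both branches of V/U decrease. The left one starts at 0 and takes negative values only; the
right one tends to π/2 and stays above it. The ranges are disjoint, so a level is met at most once.
-/
theorem imageZerosLE_of_wronskE_neg (hR : RemainderNeZero k) (hc : coefQ2 k ≠ 0)
    (hU : ZerosLE (imageU k) (Ioi 0) 1) (h0 : OnlyZero k t₀) (hE : ∀ t > 0, wronskE k t < 0) :
    ImageZerosLE k 1 := by
  refine imageZerosLE_of_level hU fun c => ?_
  have hz : ∀ J : Set ℝ, (∀ t ∈ J, 0 < t) → ZerosLE (wronskE k) J 0 := fun J hJ =>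
    ZerosLE.of_ne_zero fun t ht => (hE t (hJ t ht)).ne
  have hl : ∀ t ∈ Ioo 0 t₀, imageU k t ≠ 0 := fun t ht => h0.ne t ht.1.le ht.2.ne
  have hr : ∀ t ∈ Ioi t₀, imageU k t ≠ 0 := fun t ht =>
    h0.ne t (h0.pos.trans ht).le (ne_of_gt ht)
  rcases lt_or_ge c 0 with hc0 | hc0
  · refine levelFun_glue hR h0.pos h0.zero (m := 1) (n := 0)
      (levelFun_zerosLE_succ ordConnected_Ioo isOpen_Ioo (fun t ht => ht.1) hl
        (hz _ fun t ht => ht.1)) (levelFun_zerosLE_of_ne hr fun t ht => ?_) subset_rfl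
    have := lt_quotVU hc (h0.pos.trans ht) (fun y hy => hE y ((h0.pos.trans ht).trans hy))
      fun y hy => hr y (lt_of_lt_of_le ht hy)
    linarith [Real.pi_pos]
  · refine levelFun_glue hR h0.pos h0.zero (m := 0) (n := 1)
      (levelFun_zerosLE_of_ne hl fun t ht => ?_)
      (levelFun_zerosLE_succ ordConnected_Ioi isOpen_Ioi (fun t ht => h0.pos.trans ht) hr
        (hz _ fun t ht => h0.pos.trans ht)) subset_rfl
    have := quotVU_neg ht.1 (fun y hy => hE y hy.1)
      fun y hy => h0.ne y hy.1 (hy.2.trans_lt ht.2).ne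
    linarith

/-- The left branch stays below π/2 and meets a level at most twice; the right one decreases to π/2
from above and meets a level at most once. No level meets both. -/
theorem imageZerosLE_of_left_lt (hR : RemainderNeZero k) (hc : coefQ2 k ≠ 0)
    (hU : ZerosLE (imageU k) (Ioi 0) 1) (h0 : OnlyZero k t₀)
    (hE : ZerosLE (wronskE k) (Ioi 0) 1) (hEr : ∀ t > t₀, wronskE k t < 0)
    (hl : ∀ t ∈ Ioo 0 t₀, quotVU k t < Real.pi / 2) : ImageZerosLE k 2 := by
  refine imageZerosLE_of_level (hU.mono_nat (by omega)) fun c => ?_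
  have hl' : ∀ t ∈ Ioo 0 t₀, imageU k t ≠ 0 := fun t ht => h0.ne t ht.1.le ht.2.ne
  have hr : ∀ t ∈ Ioi t₀, imageU k t ≠ 0 := fun t ht =>
    h0.ne t (h0.pos.trans ht).le (ne_of_gt ht)
  rcases lt_or_ge c (Real.pi / 2) with hc0 | hc0
  · refine levelFun_glue hR h0.pos h0.zero (m := 2) (n := 0)
      (levelFun_zerosLE_succ ordConnected_Ioo isOpen_Ioo (fun t ht => ht.1) hl'
        (hE.mono_set fun t ht => ht.1)) (levelFun_zerosLE_of_ne hr fun t ht => ?_) subset_rfl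
    have := lt_quotVU hc (h0.pos.trans ht) (fun y hy => hEr y (lt_trans ht hy))
      fun y hy => hr y (lt_of_lt_of_le ht hy)
    linarith
  · refine (levelFun_glue hR h0.pos h0.zero (m := 0) (n := 1)
      (levelFun_zerosLE_of_ne hl' fun t ht => ?_)
      (levelFun_zerosLE_succ ordConnected_Ioi isOpen_Ioi (fun t ht => h0.pos.trans ht) hr
        (ZerosLE.of_ne_zero fun t ht => (hEr t ht).ne)) subset_rfl).mono_nat (by omega)
    linarith [hl t ht]

theorem exists_first_zero {f : ℝ → ℝ} (hf : Continuous f) {a b : ℝ} (ha : f a < 0)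
    (hab : ∃ x ∈ Ioo a b, 0 ≤ f x) :
    ∃ τ ∈ Ioo a b, f τ = 0 ∧ ∀ x ∈ Ico a τ, f x < 0 := by
  obtain ⟨x, hx, hfx⟩ := hab
  have hne : (Icc a x ∩ f ⁻¹' Ici 0).Nonempty := ⟨x, ⟨hx.1.le, le_rfl⟩, hfx⟩
  obtain ⟨τ, ⟨hτ, hτ0⟩, hleast⟩ :=
    (isCompact_Icc.inter_right (isClosed_Ici.preimage hf)).exists_isLeast hne
  have hlt : ∀ y ∈ Ico a τ, f y < 0 := fun y hy => by
    by_contra hcon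
    exact absurd (hleast ⟨⟨hy.1, hy.2.le.trans hτ.2⟩, not_lt.1 hcon⟩) (not_le.2 hy.2)
  have haτ : a < τ := lt_of_le_of_ne hτ.1 fun h => by
    rw [← h] at hτ0
    exact absurd ha (not_lt.2 hτ0)
  refine ⟨τ, ⟨haτ, hτ.2.trans_lt hx.2⟩, le_antisymm ?_ hτ0, hlt⟩
  have := ge_of_tendsto (b := 0) ((hf.tendsto τ).neg.mono_left nhdsWithin_le_nhds : Tendsto _ (𝓝[<] τ) _) (by
    filter_upwards [Ioo_mem_nhdsLT haτ] with y hy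
    linarith [hlt y ⟨hy.1.le, hy.2⟩])
  linarith

theorem exists_last_zero {f : ℝ → ℝ} (hf : Continuous f) {a b : ℝ} (hb : f b < 0)
    (hab : ∃ x ∈ Ioo a b, 0 ≤ f x) :
    ∃ τ ∈ Ioo a b, f τ = 0 ∧ ∀ x ∈ Ioc τ b, f x < 0 := by
  obtain ⟨x, hx, hfx⟩ := hab
  obtain ⟨τ, hτ, hτ0, hlt⟩ := exists_first_zero (f := fun y => f (-y)) (hf.comp continuous_neg)
    (a := -b) (b := -a) (by simpa using hb) ⟨-x, ⟨neg_lt_neg hx.2, neg_lt_neg hx.1⟩, by simpa using hfx⟩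
  refine ⟨-τ, ⟨by linarith [hτ.2], by linarith [hτ.1]⟩, hτ0, fun y hy => ?_⟩
  simpa using hlt (-y) ⟨by linarith [hy.2], by linarith [hy.1]⟩

/-- Up to the first zero τ of E the quotient decreases from 0 and misses every level c ≥ 0. Beyond τ
only one zero of E is left, which saves one against the general count. -/
theorem levelFun_left_le_two {c : ℝ} (hc : 0 ≤ c) (h0 : OnlyZero k t₀)
    (hE0 : wronskE k 0 < 0) (hE : ZerosLE (wronskE k) (Ioi 0) 2) :
    ZerosLE (levelFun k c) (Ioo 0 t₀) 2 := by
  have hl : ∀ t ∈ Ioo 0 t₀, imageU k t ≠ 0 := fun t ht => h0.ne t ht.1.le ht.2.ne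
  have hne : ∀ τ, τ < t₀ → (∀ x ∈ Ico 0 τ, wronskE k x < 0) → ∀ t ∈ Ioc 0 τ, quotVU k t ≠ c :=
    fun τ hτ h t ht => by
      have := quotVU_neg (k := k) ht.1 (fun y hy => h y ⟨hy.1.le, hy.2.trans_le ht.2⟩)
        fun y hy => h0.ne y hy.1 ((hy.2.trans ht.2).trans_lt hτ).ne
      linarith
  by_cases hneg : ∃ x ∈ Ioo 0 t₀, 0 ≤ wronskE k x
  · obtain ⟨τ, hτ, hτ0, hlt⟩ := exists_first_zero (continuous_wronskE k) hE0 hneg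
    have h1 := (hE.diff_singleton hτ.1 (analyticAt_wronskE k τ) hτ0).mono_set
      (J := Ioo τ t₀) fun t ht => ⟨hτ.1.trans ht.1, ht.1.ne'⟩
    have h2 := levelFun_zerosLE_succ (c := c) ordConnected_Ioo isOpen_Ioo
      (fun t ht => hτ.1.trans ht.1) (fun t ht => hl t ⟨hτ.1.trans ht.1, ht.2⟩) h1
    have h3 : ZerosLE (levelFun k c) (Ioc 0 τ) 0 := levelFun_zerosLE_of_ne
      (fun t ht => hl t ⟨ht.1, ht.2.trans_lt hτ.2⟩) (hne τ hτ.2 hlt)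
    have h4 := h3.union h2 (K := Ioo 0 t₀) fun t ht =>
      (le_or_gt t τ).imp (fun h => ⟨ht.1, h⟩) fun h => ⟨h, ht.2⟩
    rwa [zero_add] at h4
  · push Not at hneg
    refine levelFun_zerosLE_of_ne hl fun t ht => hne t ht.2 (fun x hx => ?_) t ⟨ht.1, le_rfl⟩
    rcases hx.1.eq_or_lt with rfl | h
    · exact hE0
    · exact hneg x ⟨h, hx.2.trans ht.2⟩

/-- Mirror image at infinity: beyond the last zero of E the quotient decreases to π/2 and misses
every level c ≤ π/2. -/
theorem levelFun_right_le_two {c : ℝ} (hc : c ≤ Real.pi / 2) (hQ2 : coefQ2 k ≠ 0)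
    (h0 : OnlyZero k t₀) {M : ℝ} (hEM : ∀ t ≥ M, wronskE k t < 0)
    (hE : ZerosLE (wronskE k) (Ioi 0) 2) : ZerosLE (levelFun k c) (Ioi t₀) 2 := by
  have hr : ∀ t ∈ Ioi t₀, imageU k t ≠ 0 := fun t ht =>
    h0.ne t (h0.pos.trans ht).le (ne_of_gt ht)
  have hne : ∀ τ > t₀, (∀ x > τ, wronskE k x < 0) → ∀ t ≥ τ, quotVU k t ≠ c :=
    fun τ hτ h t ht => by
      have := lt_quotVU (k := k) hQ2 ((h0.pos.trans hτ).trans_le ht)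
        (fun y hy => h y (lt_of_le_of_lt ht hy)) fun y hy => hr y (lt_of_lt_of_le hτ (ht.trans hy))
      linarith
  by_cases hneg : ∃ x > t₀, 0 ≤ wronskE k x
  · obtain ⟨x, hx, hx0⟩ := hneg
    have hxM : x < M := by
      by_contra hcon
      exact absurd (hEM x (not_lt.1 hcon)) (not_lt.2 hx0)
    obtain ⟨τ, hτ, hτ0, hlt⟩ := exists_last_zero (continuous_wronskE k) (hEM M le_rfl)
      ⟨x, ⟨hx, hxM⟩, hx0⟩
    have hτpos := h0.pos.trans hτ.1
    have h1 := (hE.diff_singleton hτpos (analyticAt_wronskE k τ) hτ0).mono_set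
      (J := Ioo t₀ τ) fun t ht => ⟨h0.pos.trans ht.1, ht.2.ne⟩
    have h2 := levelFun_zerosLE_succ (c := c) ordConnected_Ioo isOpen_Ioo
      (fun t ht => h0.pos.trans ht.1) (fun t ht => hr t ht.1) h1
    have h3 : ZerosLE (levelFun k c) (Ici τ) 0 := levelFun_zerosLE_of_ne
      (fun t ht => hr t (lt_of_lt_of_le hτ.1 ht)) (hne τ hτ.1 fun x hx =>
        (le_total x M).elim (fun h => hlt x ⟨hx, h⟩) fun h => hEM x h)
    have h4 := h2.union h3 (K := Ioi t₀) fun t ht =>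
      (lt_or_ge t τ).imp (fun h => ⟨ht, h⟩) fun h => h
    rwa [add_zero] at h4
  · push Not at hneg
    exact levelFun_zerosLE_of_ne hr fun t ht => hne t ht (fun x hx => hneg x (lt_trans ht hx)) t le_rfl

/-- E is negative at 0, at t₀ and at infinity, so its at most two zeros lie on one side of t₀. On
the other side V/U is monotone. Comparing c with the end value of that side, either the monotone
side is missed and the other gives 3, or it gives 1 and the other side only 2. -/
theorem imageZerosLE_three (hR : RemainderNeZero k) (hQ2 : coefQ2 k ≠ 0)
    (hU : ZerosLE (imageU k) (Ioi 0) 1) (h0 : OnlyZero k t₀) (hE0 : wronskE k 0 < 0)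
    (hEt : wronskE k t₀ < 0) {M : ℝ} (hEM : ∀ t ≥ M, wronskE k t < 0)
    (hE : ZerosLE (wronskE k) (Ioi 0) 2) : ImageZerosLE k 3 := by
  refine imageZerosLE_of_level (hU.mono_nat (by omega)) fun c => ?_
  have hl : ∀ t ∈ Ioo 0 t₀, imageU k t ≠ 0 := fun t ht => h0.ne t ht.1.le ht.2.ne
  have hr : ∀ t ∈ Ioi t₀, imageU k t ≠ 0 := fun t ht =>
    h0.ne t (h0.pos.trans ht).le (ne_of_gt ht)
  have hside : (∀ t ∈ Ioo 0 t₀, wronskE k t < 0) ∨ ∀ t > t₀, wronskE k t < 0 := by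
    obtain ⟨m, m', hmm, h1, h2⟩ := hE.exists_split (I := Ioo 0 t₀) (J := Ioi t₀)
      (fun t ht => ht.1) (fun t ht => h0.pos.trans ht)
      (Set.disjoint_left.2 fun t h1 h2 => absurd h1.2 (not_lt.2 (le_of_lt h2)))
    rcases Nat.lt_or_ge 1 m with hm | hm
    · right
      intro t ht
      rcases le_or_gt M t with h | h
      · exact hEM t h
      · exact neg_of_zerosLE_one (analyticAt_wronskE k) hEt (hEM M le_rfl)
          ((h2.mono_nat (by omega)).mono_set fun x hx => hx.1) t ⟨ht, h⟩
    · exact Or.inl (neg_of_zerosLE_one (analyticAt_wronskE k) hE0 hEt (h1.mono_nat hm))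
  rcases hside with hneg | hneg
  · rcases lt_or_ge c 0 with hc | hc
    · exact levelFun_glue hR h0.pos h0.zero (m := 1) (n := 2)
        (levelFun_zerosLE_succ ordConnected_Ioo isOpen_Ioo (fun t ht => ht.1) hl
          (ZerosLE.of_ne_zero fun t ht => (hneg t ht).ne))
        (levelFun_right_le_two (by linarith [Real.pi_pos]) hQ2 h0 hEM hE) subset_rfl
    · refine levelFun_glue hR h0.pos h0.zero (m := 0) (n := 3)
        (levelFun_zerosLE_of_ne hl fun t ht => ?_)
        (levelFun_zerosLE_succ ordConnected_Ioi isOpen_Ioi (fun t ht => h0.pos.trans ht) hr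
          (hE.mono_set fun t ht => h0.pos.trans ht)) subset_rfl
      have := quotVU_neg ht.1 (fun y hy => hneg y ⟨hy.1, hy.2.trans ht.2⟩)
        fun y hy => h0.ne y hy.1 (hy.2.trans_lt ht.2).ne
      linarith
  · rcases le_or_gt c (Real.pi / 2) with hc | hc
    · refine levelFun_glue hR h0.pos h0.zero (m := 3) (n := 0)
        (levelFun_zerosLE_succ ordConnected_Ioo isOpen_Ioo (fun t ht => ht.1) hl
          (hE.mono_set fun t ht => ht.1)) (levelFun_zerosLE_of_ne hr fun t ht => ?_) subset_rfl
      have := lt_quotVU hQ2 (h0.pos.trans ht) (fun y hy => hneg y (lt_trans ht hy))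
        fun y hy => hr y (lt_of_lt_of_le ht hy)
      linarith
    · exact levelFun_glue hR h0.pos h0.zero (m := 2) (n := 1)
        (levelFun_left_le_two (by linarith [Real.pi_pos]) h0 hE0 hE)
        (levelFun_zerosLE_succ ordConnected_Ioi isOpen_Ioi (fun t ht => h0.pos.trans ht) hr
          (ZerosLE.of_ne_zero fun t ht => (hneg t ht).ne)) subset_rfl

end single

/-! ### Sharp bounds when U has two zeros -/

section double

variable {k t₁ t₂ : ℝ}

/-- `t₁ ≤ t₂` are the only nonnegative zeros of `imageU k`. -/
structure OnlyTwoZeros (k t₁ t₂ : ℝ) : Prop where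
  pos : 0 < t₁
  le : t₁ ≤ t₂
  zero₁ : imageU k t₁ = 0
  zero₂ : imageU k t₂ = 0
  ne : ∀ t ≥ 0, t ≠ t₁ → t ≠ t₂ → imageU k t ≠ 0

/-- The left branch is negative, the middle one above π/2, and the right one increases to π/2 from
below. A level c ≤ π/2 gives at most 1 + 0 + 1 solutions, a level c > π/2 at most 0 + 2 + 0. -/
theorem imageZerosLE_of_mid_gt (hR : RemainderNeZero k) (hQ2 : coefQ2 k ≠ 0)
    (hU : ZerosLE (imageU k) (Ioi 0) 2) (h0 : OnlyTwoZeros k t₁ t₂)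
    (hE : ZerosLE (wronskE k) (Ioi 0) 1) (hEl : ∀ t ∈ Ioo 0 t₁, wronskE k t < 0)
    (hEr : ∀ t > t₂, 0 < wronskE k t) (hm : ∀ t ∈ Ioo t₁ t₂, Real.pi / 2 < quotVU k t) :
    ImageZerosLE k 2 := by
  refine imageZerosLE_of_level hU fun c => ?_
  have ht₂ := h0.pos.trans_le h0.le
  have ul : ∀ t ∈ Ioo 0 t₁, imageU k t ≠ 0 := fun t ht =>
    h0.ne t ht.1.le ht.2.ne (ht.2.trans_le h0.le).ne
  have um : ∀ t ∈ Ioo t₁ t₂, imageU k t ≠ 0 := fun t ht =>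
    h0.ne t (h0.pos.trans ht.1).le ht.1.ne' ht.2.ne
  have ur : ∀ t ∈ Ioi t₂, imageU k t ≠ 0 := fun t ht =>
    h0.ne t (ht₂.trans ht).le (h0.le.trans_lt ht).ne' (ne_of_gt ht)
  have ll : ZerosLE (levelFun k c) (Ioo 0 t₁) 1 :=
    levelFun_zerosLE_succ ordConnected_Ioo isOpen_Ioo (fun t ht => ht.1) ul
      (ZerosLE.of_ne_zero fun t ht => (hEl t ht).ne)
  have lm : ZerosLE (levelFun k c) (Ioo t₁ t₂) 2 :=
    levelFun_zerosLE_succ ordConnected_Ioo isOpen_Ioo (fun t ht => h0.pos.trans ht.1) um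
      (hE.mono_set fun t ht => h0.pos.trans ht.1)
  have lr : ZerosLE (levelFun k c) (Ioi t₂) 1 :=
    levelFun_zerosLE_succ ordConnected_Ioi isOpen_Ioi (fun t ht => ht₂.trans ht) ur
      (ZerosLE.of_ne_zero fun t ht => (hEr t ht).ne')
  have ll0 : 0 ≤ c → ZerosLE (levelFun k c) (Ioo 0 t₁) 0 := fun hc =>
    levelFun_zerosLE_of_ne ul fun t ht => by
      have := quotVU_neg ht.1 (fun y hy => hEl y ⟨hy.1, hy.2.trans ht.2⟩) fun y hy =>
        h0.ne y hy.1 (hy.2.trans_lt ht.2).ne ((hy.2.trans_lt ht.2).trans_le h0.le).ne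
      linarith
  have lm0 : c ≤ Real.pi / 2 → ZerosLE (levelFun k c) (Ioo t₁ t₂) 0 := fun hc =>
    levelFun_zerosLE_of_ne um fun t ht => by linarith [hm t ht]
  have lr0 : Real.pi / 2 ≤ c → ZerosLE (levelFun k c) (Ioi t₂) 0 := fun hc =>
    levelFun_zerosLE_of_ne ur fun t ht => by
      have := quotVU_lt hQ2 (ht₂.trans ht) (fun y hy => hEr y (lt_trans ht hy))
        fun y hy => ur y (lt_of_lt_of_le ht hy)
      linarith
  have glue : ∀ {a b d : ℕ}, ZerosLE (levelFun k c) (Ioo 0 t₁) a →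
      ZerosLE (levelFun k c) (Ioo t₁ t₂) b → ZerosLE (levelFun k c) (Ioi t₂) d →
      ZerosLE (levelFun k c) (Ioi 0) (a + (b + d)) := fun ha hb hd =>
    levelFun_glue hR h0.pos h0.zero₁ ha (levelFun_glue hR ht₂ h0.zero₂ hb hd subset_rfl) subset_rfl
  rcases le_or_gt c (Real.pi / 2) with hc | hc
  · exact glue ll (lm0 hc) lr
  · exact glue (ll0 (by linarith [Real.pi_pos])) lm (lr0 hc.le)

/-- The signs are reversed: the left branch is positive, the middle one negative, the right one
above π/2. Negative levels give at most 0 + 2 + 0 solutions, the others at most 1 + 0 + 1. -/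
theorem imageZerosLE_of_mid_neg (hR : RemainderNeZero k) (hQ2 : coefQ2 k ≠ 0)
    (hU : ZerosLE (imageU k) (Ioi 0) 2) (h0 : OnlyTwoZeros k t₁ t₂)
    (hE : ZerosLE (wronskE k) (Ioi 0) 1) (hEl : ∀ t ∈ Ioo 0 t₁, 0 < wronskE k t)
    (hEr : ∀ t > t₂, wronskE k t < 0) (hm : ∀ t ∈ Ioo t₁ t₂, quotVU k t < 0) :
    ImageZerosLE k 2 := by
  refine imageZerosLE_of_level hU fun c => ?_
  have ht₂ := h0.pos.trans_le h0.le
  have ul : ∀ t ∈ Ioo 0 t₁, imageU k t ≠ 0 := fun t ht =>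
    h0.ne t ht.1.le ht.2.ne (ht.2.trans_le h0.le).ne
  have um : ∀ t ∈ Ioo t₁ t₂, imageU k t ≠ 0 := fun t ht =>
    h0.ne t (h0.pos.trans ht.1).le ht.1.ne' ht.2.ne
  have ur : ∀ t ∈ Ioi t₂, imageU k t ≠ 0 := fun t ht =>
    h0.ne t (ht₂.trans ht).le (h0.le.trans_lt ht).ne' (ne_of_gt ht)
  have ll : ZerosLE (levelFun k c) (Ioo 0 t₁) 1 :=
    levelFun_zerosLE_succ ordConnected_Ioo isOpen_Ioo (fun t ht => ht.1) ul
      (ZerosLE.of_ne_zero fun t ht => (hEl t ht).ne')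
  have lm : ZerosLE (levelFun k c) (Ioo t₁ t₂) 2 :=
    levelFun_zerosLE_succ ordConnected_Ioo isOpen_Ioo (fun t ht => h0.pos.trans ht.1) um
      (hE.mono_set fun t ht => h0.pos.trans ht.1)
  have lr : ZerosLE (levelFun k c) (Ioi t₂) 1 :=
    levelFun_zerosLE_succ ordConnected_Ioi isOpen_Ioi (fun t ht => ht₂.trans ht) ur
      (ZerosLE.of_ne_zero fun t ht => (hEr t ht).ne)
  have ll0 : c ≤ 0 → ZerosLE (levelFun k c) (Ioo 0 t₁) 0 := fun hc =>
    levelFun_zerosLE_of_ne ul fun t ht => by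
      have := quotVU_pos ht.1 (fun y hy => hEl y ⟨hy.1, hy.2.trans ht.2⟩) fun y hy =>
        h0.ne y hy.1 (hy.2.trans_lt ht.2).ne ((hy.2.trans_lt ht.2).trans_le h0.le).ne
      linarith
  have lm0 : 0 ≤ c → ZerosLE (levelFun k c) (Ioo t₁ t₂) 0 := fun hc =>
    levelFun_zerosLE_of_ne um fun t ht => by linarith [hm t ht]
  have lr0 : c ≤ Real.pi / 2 → ZerosLE (levelFun k c) (Ioi t₂) 0 := fun hc =>
    levelFun_zerosLE_of_ne ur fun t ht => by
      have := lt_quotVU hQ2 (ht₂.trans ht) (fun y hy => hEr y (lt_trans ht hy))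
        fun y hy => ur y (lt_of_lt_of_le ht hy)
      linarith
  have glue : ∀ {a b d : ℕ}, ZerosLE (levelFun k c) (Ioo 0 t₁) a →
      ZerosLE (levelFun k c) (Ioo t₁ t₂) b → ZerosLE (levelFun k c) (Ioi t₂) d →
      ZerosLE (levelFun k c) (Ioi 0) (a + (b + d)) := fun ha hb hd =>
    levelFun_glue hR h0.pos h0.zero₁ ha (levelFun_glue hR ht₂ h0.zero₂ hb hd subset_rfl) subset_rfl
  rcases lt_or_ge c 0 with hc | hc
  · exact glue (ll0 hc.le) lm (lr0 (by linarith [Real.pi_pos]))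
  · exact glue ll (lm0 hc) lr

end double

/-! ### A certificate checker for positivity of integer polynomials on boxes -/

/-- Addition of coefficient lists. -/
def addL : List ℤ → List ℤ → List ℤ
  | [], q => q
  | a :: p, [] => a :: p
  | a :: p, b :: q => (a + b) :: addL p q

/-- Multiplication of a coefficient list by a constant. -/
def smulL (c : ℤ) : List ℤ → List ℤ
  | [] => []
  | a :: p => c * a :: smulL c p

/-- Multiplication of a coefficient list by the linear polynomial `a X + b`. -/
def linL (a b : ℤ) (p : List ℤ) : List ℤ := addL (smulL b p) (0 :: smulL a p)

/-- The coefficient list of `(c X + d) ^ (n - 1) * p ((a X + b) / (c X + d))`, together with that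
of `(c X + d) ^ n`. -/
def mobL (a b c d : ℤ) : ℕ → List ℤ → List ℤ × List ℤ
  | 0, _ => ([], [1])
  | n + 1, p => (addL (smulL (p.headD 0) (mobL a b c d n p.tail).2)
      (linL a b (mobL a b c d n p.tail).1), linL c d (mobL a b c d n p.tail).2)

/-- Addition of lists of coefficient lists. -/
def addLL : List (List ℤ) → List (List ℤ) → List (List ℤ)
  | [], q => q
  | a :: p, [] => a :: p
  | a :: p, b :: q => addL a b :: addLL p q

/-- Multiplication of a list of coefficient lists by a constant. -/
def smulLL (c : ℤ) : List (List ℤ) → List (List ℤ)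
  | [] => []
  | a :: p => smulL c a :: smulLL c p

/-- Multiplication by a linear polynomial in the outer variable. -/
def linLL (a b : ℤ) (p : List (List ℤ)) : List (List ℤ) := addLL (smulLL b p) ([] :: smulLL a p)

/-- The list of products of a coefficient list with constants. -/
def outerL (q : List ℤ) : List ℤ → List (List ℤ)
  | [] => []
  | a :: w => smulL a q :: outerL q w

/-- The Möbius substitution in the outer variable. -/
def mobLL (a b c d : ℤ) : List (List ℤ) → List (List ℤ) × List ℤ
  | [] => ([], [1])
  | q :: p => (addLL (outerL q (mobLL a b c d p).2) (linLL a b (mobLL a b c d p).1),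
      linL c d (mobLL a b c d p).2)

/-- The length of the longest coefficient list. -/
def maxLen : List (List ℤ) → ℕ
  | [] => 0
  | q :: p => max q.length (maxLen p)

/-- The Möbius substitution in the inner variable, for lists of length at most `n`. -/
def innerLL (a b c d : ℤ) (n : ℕ) : List (List ℤ) → List (List ℤ)
  | [] => []
  | q :: p => (mobL a b c d n q).1 :: innerLL a b c d n p

/-- The value of the polynomial with a given coefficient list. -/
def evalL (x : ℝ) : List ℤ → ℝ
  | [] => 0
  | a :: p => a + x * evalL x p

/-- The value of the polynomial in two variables with a given list of coefficient lists. -/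
def evalLL (x y : ℝ) : List (List ℤ) → ℝ
  | [] => 0
  | q :: p => evalL x q + y * evalLL x y p

theorem evalL_addL (x : ℝ) : ∀ p q, evalL x (addL p q) = evalL x p + evalL x q
  | [], q => by simp [addL, evalL]
  | a :: p, [] => by simp [addL, evalL]
  | a :: p, b :: q => by
    simp only [addL, evalL, evalL_addL x p q, Int.cast_add]
    ring

theorem evalL_smulL (x : ℝ) (c : ℤ) : ∀ p, evalL x (smulL c p) = c * evalL x p
  | [] => by simp [smulL, evalL]
  | a :: p => by
    simp only [smulL, evalL, evalL_smulL x c p, Int.cast_mul]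
    ring

theorem evalL_linL (x : ℝ) (a b : ℤ) (p : List ℤ) :
    evalL x (linL a b p) = (a * x + b) * evalL x p := by
  simp only [linL, evalL_addL, evalL, evalL_smulL, Int.cast_zero]
  ring

theorem evalLL_addLL (x y : ℝ) : ∀ p q, evalLL x y (addLL p q) = evalLL x y p + evalLL x y q
  | [], q => by simp [addLL, evalLL]
  | a :: p, [] => by simp [addLL, evalLL]
  | a :: p, b :: q => by
    simp only [addLL, evalLL, evalLL_addLL x y p q, evalL_addL]
    ring

theorem evalLL_smulLL (x y : ℝ) (c : ℤ) : ∀ p, evalLL x y (smulLL c p) = c * evalLL x y p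
  | [] => by simp [smulLL, evalLL]
  | a :: p => by
    simp only [smulLL, evalLL, evalLL_smulLL x y c p, evalL_smulL]
    ring

theorem evalLL_linLL (x y : ℝ) (a b : ℤ) (p : List (List ℤ)) :
    evalLL x y (linLL a b p) = (a * y + b) * evalLL x y p := by
  simp only [linLL, evalLL_addLL, evalLL, evalL, evalLL_smulLL]
  ring

theorem evalLL_outerL (x y : ℝ) (q : List ℤ) : ∀ w, evalLL x y (outerL q w) = evalL x q * evalL y w
  | [] => by simp [outerL, evalLL, evalL]
  | a :: w => by
    simp only [outerL, evalLL, evalL, evalLL_outerL x y q w, evalL_smulL]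
    ring

theorem evalL_mobL_snd (u : ℝ) (a b c d : ℤ) : ∀ n p,
    evalL u (mobL a b c d n p).2 = (c * u + d) ^ n
  | 0, _ => by simp [mobL, evalL]
  | n + 1, p => by
    simp only [mobL, evalL_linL, evalL_mobL_snd u a b c d n p.tail]
    ring

theorem evalL_eq_headD (x : ℝ) (p : List ℤ) :
    evalL x p = (p.headD 0 : ℤ) + x * evalL x p.tail := by
  cases p <;> simp [evalL]

/-- A list of length n has degree at most n - 1, so only n - 1 denominators are cleared; the extra
factor on the left avoids a truncated exponent. -/
theorem evalL_mobL_fst {u x : ℝ} {a b c d : ℤ} (h : x * (c * u + d) = a * u + b) : ∀ n p,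
    p.length ≤ n → evalL u (mobL a b c d n p).1 * (c * u + d) = (c * u + d) ^ n * evalL x p
  | 0, p => fun hp => by
    obtain rfl : p = [] := List.length_eq_zero_iff.1 (Nat.le_zero.1 hp)
    simp [mobL, evalL]
  | n + 1, p => fun hp => by
    have h1 := evalL_mobL_fst h n p.tail (by simpa using hp)
    simp only [mobL, evalL_addL, evalL_smulL, evalL_linL, evalL_mobL_snd]
    rw [evalL_eq_headD x p, add_mul, mul_assoc (_ + _) _ (_ + _), h1, ← h]
    ring

theorem evalL_mobLL_snd (v : ℝ) (a b c d : ℤ) : ∀ p,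
    evalL v (mobLL a b c d p).2 = (c * v + d) ^ p.length
  | [] => by simp [mobLL, evalL]
  | q :: p => by
    simp only [mobLL, evalL_linL, evalL_mobLL_snd v a b c d p, List.length_cons]
    ring

theorem evalLL_mobLL_fst {x v y : ℝ} {a b c d : ℤ} (h : y * (c * v + d) = a * v + b) : ∀ p,
    evalLL x v (mobLL a b c d p).1 * (c * v + d) = (c * v + d) ^ p.length * evalLL x y p
  | [] => by simp [mobLL, evalLL]
  | q :: p => by
    have h1 := evalLL_mobLL_fst (x := x) h p
    simp only [mobLL, evalLL_addLL, evalLL_outerL, evalLL_linLL, evalL_mobLL_snd, evalLL,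
      List.length_cons]
    rw [add_mul, mul_assoc (_ + _) _ (_ + _), h1, ← h]
    ring

theorem evalLL_innerLL {u x y : ℝ} {a b c d : ℤ} (h : x * (c * u + d) = a * u + b) {n : ℕ} : ∀ p,
    maxLen p ≤ n → evalLL u y (innerLL a b c d n p) * (c * u + d) = (c * u + d) ^ n * evalLL x y p
  | [] => by simp [innerLL, evalLL]
  | q :: p => fun hp => by
    have h1 := evalLL_innerLL (y := y) h p ((le_max_right _ _).trans hp)
    have h2 := evalL_mobL_fst h n q ((le_max_left _ _).trans hp)
    simp only [innerLL, evalLL]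
    rw [add_mul, h2, mul_assoc, h1]
    ring

/-- Whether all coefficients are nonnegative and the constant coefficient is positive. -/
def corner (p : List (List ℤ)) : Bool :=
  p.all (fun q => q.all fun a => decide (0 ≤ a)) && decide (0 < (p.headD []).headD 0)

/-- Whether a polynomial in two variables is recognized as positive on the quadrant, by splitting
the quadrant along a given schedule: `true` splits the outer variable at `1`, `false` the inner
one. -/
def check : List Bool → List (List ℤ) → Bool
  | [], p => corner p
  | true :: l, p => corner p ||
      (check l (mobLL 1 0 1 1 p).1 && check l (mobLL 1 1 0 1 p).1)
  | false :: l, p => corner p ||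
      (check l (innerLL 1 0 1 1 (maxLen p) p) && check l (innerLL 1 1 0 1 (maxLen p) p))

theorem evalL_nonneg {x : ℝ} (hx : 0 ≤ x) : ∀ p : List ℤ, (∀ a ∈ p, 0 ≤ a) → 0 ≤ evalL x p
  | [], _ => le_rfl
  | a :: p, h => add_nonneg (Int.cast_nonneg (h a (by simp)))
    (mul_nonneg hx (evalL_nonneg hx p fun b hb => h b (by simp [hb])))

theorem evalLL_nonneg {x y : ℝ} (hx : 0 ≤ x) (hy : 0 ≤ y) :
    ∀ p : List (List ℤ), (∀ q ∈ p, ∀ a ∈ q, 0 ≤ a) → 0 ≤ evalLL x y p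
  | [], _ => le_rfl
  | q :: p, h => add_nonneg (evalL_nonneg hx q (h q (by simp)))
    (mul_nonneg hy (evalLL_nonneg hx hy p fun b hb => h b (by simp [hb])))

theorem evalLL_pos_of_corner {x y : ℝ} (hx : 0 ≤ x) (hy : 0 ≤ y) {p : List (List ℤ)}
    (h : corner p = true) : 0 < evalLL x y p := by
  simp only [corner, Bool.and_eq_true, List.all_eq_true, decide_eq_true_eq] at h
  obtain ⟨h1, h2⟩ := h
  match p, h1, h2 with
  | (a :: q) :: p, h1, h2 =>
    have h3 : (0 : ℝ) < a := by exact_mod_cast h2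
    have h4 := evalL_nonneg hx q fun b hb => h1 (a :: q) (by simp) b (by simp [hb])
    have h5 := evalLL_nonneg hx hy p fun b hb => h1 b (by simp [hb])
    simp only [evalLL, evalL]
    positivity

/-- A variable below 1 is v/(1+v) and one at least 1 is 1+v, with v ≥ 0. Both pieces are again
quadrants, and the cleared denominators are positive. -/
theorem evalLL_pos_of_check : ∀ (l : List Bool) (p : List (List ℤ)), check l p = true →
    ∀ x ≥ 0, ∀ y ≥ 0, 0 < evalLL x y p
  | [], p, h, x, hx, y, hy => evalLL_pos_of_corner hx hy h
  | true :: l, p, h, x, hx, y, hy => by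
    simp only [check, Bool.or_eq_true, Bool.and_eq_true] at h
    rcases h with h | ⟨h1, h2⟩
    · exact evalLL_pos_of_corner hx hy h
    rcases lt_or_ge y 1 with hy1 | hy1
    · have h3 := evalLL_pos_of_check l _ h1 x hx (y / (1 - y)) (div_nonneg hy (by linarith))
      have h0 : (0 : ℝ) < 1 - y := by linarith
      have h4 : (0 : ℝ) < (1 : ℤ) * (y / (1 - y)) + (1 : ℤ) := by
        have := div_nonneg hy h0.le
        push_cast
        linarith
      have h5 := evalLL_mobLL_fst (x := x) (y := y) (v := y / (1 - y)) (a := 1) (b := 0) (c := 1)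
        (d := 1) (by push_cast; field_simp; ring) p
      exact pos_of_mul_pos_right (h5 ▸ mul_pos h3 h4) (by positivity)
    · have h3 := evalLL_pos_of_check l _ h2 x hx (y - 1) (by linarith)
      have h5 := evalLL_mobLL_fst (x := x) (y := y) (v := y - 1) (a := 1) (b := 1) (c := 0)
        (d := 1) (by push_cast; ring) p
      simp only [Int.cast_zero, Int.cast_one, zero_mul, zero_add, mul_one, one_pow, one_mul] at h5
      exact h5 ▸ h3
  | false :: l, p, h, x, hx, y, hy => by
    simp only [check, Bool.or_eq_true, Bool.and_eq_true] at h
    rcases h with h | ⟨h1, h2⟩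
    · exact evalLL_pos_of_corner hx hy h
    rcases lt_or_ge x 1 with hx1 | hx1
    · have h3 := evalLL_pos_of_check l _ h1 (x / (1 - x)) (div_nonneg hx (by linarith)) y hy
      have h0 : (0 : ℝ) < 1 - x := by linarith
      have h4 : (0 : ℝ) < (1 : ℤ) * (x / (1 - x)) + (1 : ℤ) := by
        have := div_nonneg hx h0.le
        push_cast
        linarith
      have h5 := evalLL_innerLL (x := x) (y := y) (u := x / (1 - x)) (a := 1) (b := 0) (c := 1)
        (d := 1) (by push_cast; field_simp; ring) p le_rfl
      exact pos_of_mul_pos_right (h5 ▸ mul_pos h3 h4) (by positivity)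
    · have h3 := evalLL_pos_of_check l _ h2 (x - 1) (by linarith) y hy
      have h5 := evalLL_innerLL (x := x) (y := y) (u := x - 1) (a := 1) (b := 1) (c := 0)
        (d := 1) (by push_cast; ring) p le_rfl
      simp only [Int.cast_zero, Int.cast_one, zero_mul, zero_add, mul_one, one_pow, one_mul] at h5
      exact h5 ▸ h3

/-- A range of a real variable that is the image of the nonnegative reals under a Möbius
transformation with integer coefficients. -/
def HasCoord (m : ℤ × ℤ × ℤ × ℤ) (x : ℝ) : Prop :=
  ∃ u ≥ (0 : ℝ), 0 < m.2.2.1 * u + m.2.2.2 ∧ x * (m.2.2.1 * u + m.2.2.2) = m.1 * u + m.2.1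

/-- The coordinate u = (qx-l)/(h-qx) sends the closed end to 0 and the open end to infinity;
`hasCoord_Ioc` exchanges the ends. -/
theorem hasCoord_Ico {l h q : ℤ} {x : ℝ} (hq : 0 < q) (h1 : l ≤ q * x) (h2 : q * x < h) :
    HasCoord (h, l, q, q) x := by
  have h0 : (0 : ℝ) < h - q * x := by linarith
  have hq' : (0 : ℝ) < q := by exact_mod_cast hq
  have h3 : 0 ≤ (q * x - l) / (h - q * x) := div_nonneg (by linarith) h0.le
  refine ⟨(q * x - l) / (h - q * x), h3, by positivity, ?_⟩
  linear_combination -div_mul_cancel₀ ((q : ℝ) * x - l) h0.ne'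

theorem hasCoord_Ioc {l h q : ℤ} {x : ℝ} (hq : 0 < q) (h1 : l < q * x) (h2 : q * x ≤ h) :
    HasCoord (l, h, q, q) x := by
  have h0 : (0 : ℝ) < q * x - l := by linarith
  have hq' : (0 : ℝ) < q := by exact_mod_cast hq
  have h3 : 0 ≤ (h - q * x) / (q * x - l) := div_nonneg (by linarith) h0.le
  refine ⟨(h - q * x) / (q * x - l), h3, by positivity, ?_⟩
  linear_combination div_mul_cancel₀ ((h : ℝ) - q * x) h0.ne'

theorem hasCoord_Ici {l q : ℤ} {x : ℝ} (hq : 0 < q) (h1 : l ≤ q * x) :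
    HasCoord (q, l, 0, q) x := by
  have hq' : (0 : ℝ) < q := by exact_mod_cast hq
  refine ⟨x - l / q, ?_, by simpa using hq, ?_⟩
  · rw [ge_iff_le, sub_nonneg, div_le_iff₀ hq']
    linarith
  · push_cast
    field_simp
    ring

/-- Whether a polynomial in one variable is recognized as positive on a range. -/
def posOn (m : ℤ × ℤ × ℤ × ℤ) (l : List Bool) (p : List ℤ) : Bool :=
  check l [(mobL m.1 m.2.1 m.2.2.1 m.2.2.2 p.length p).1]

theorem evalL_pos {m : ℤ × ℤ × ℤ × ℤ} {x : ℝ} (hx : HasCoord m x) (l : List Bool) (p : List ℤ)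
    (h : posOn m l p = true) : 0 < evalL x p := by
  obtain ⟨u, hu, hD, hN⟩ := hx
  have h1 := evalLL_pos_of_check l _ h u hu 0 le_rfl
  simp only [evalLL, mul_zero, add_zero] at h1
  have h2 := evalL_mobL_fst hN p.length p le_rfl
  exact pos_of_mul_pos_right (h2 ▸ mul_pos h1 hD) (by positivity)

/-- Whether a polynomial in two variables is recognized as positive on a product of ranges. -/
def posOnProd (m n : ℤ × ℤ × ℤ × ℤ) (l : List Bool) (p : List (List ℤ)) : Bool :=
  check l (innerLL m.1 m.2.1 m.2.2.1 m.2.2.2 (maxLen p)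
    (mobLL n.1 n.2.1 n.2.2.1 n.2.2.2 p).1) &&
    -- The inner substitution clears denominators for lists of length `maxLen p`, so the outer one
    -- must not have produced longer lists.
    decide (maxLen (mobLL n.1 n.2.1 n.2.2.1 n.2.2.2 p).1 ≤ maxLen p)

theorem evalLL_pos {m n : ℤ × ℤ × ℤ × ℤ} {x y : ℝ} (hx : HasCoord m x) (hy : HasCoord n y)
    (l : List Bool) (p : List (List ℤ)) (h : posOnProd m n l p = true) : 0 < evalLL x y p := by
  obtain ⟨u, hu, hD, hN⟩ := hx
  obtain ⟨v, hv, hD', hN'⟩ := hy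
  simp only [posOnProd, Bool.and_eq_true, decide_eq_true_eq] at h
  have h1 := evalLL_pos_of_check l _ h.1 u hu v hv
  have h2 := evalLL_innerLL (y := v) hN _ h.2
  have h3 := evalLL_mobLL_fst (x := x) hN' p
  have h4 : 0 < evalLL x v (mobLL n.1 n.2.1 n.2.2.1 n.2.2.2 p).1 :=
    pos_of_mul_pos_right (h2 ▸ mul_pos h1 hD) (by positivity)
  exact pos_of_mul_pos_right (h3 ▸ mul_pos h4 hD') (by positivity)

/-! ### Roots of integer polynomials: uniqueness and irrationality -/

/-- Whether the first coefficient is positive and the coefficients change sign at most once. -/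
def oneSign : List ℤ → Bool
  | [] => false
  | a :: p => decide (0 < a) && (p.all (fun b => decide (b ≤ 0)) || oneSign p)

theorem evalL_antitone {p : List ℤ} (h : ∀ a ∈ p, a ≤ 0) {u v : ℝ} (hu : 0 ≤ u) (huv : u ≤ v) :
    evalL v p ≤ evalL u p ∧ evalL v p ≤ 0 := by
  induction p with
  | nil => simp [evalL]
  | cons a p ih =>
    have h1 := ih fun b hb => h b (by simp [hb])
    have h2 : (a : ℝ) ≤ 0 := by exact_mod_cast h a (by simp)
    simp only [evalL]
    constructor <;> nlinarith [h1.1, h1.2]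

/-- Once a polynomial whose coefficients change sign once is nonpositive, it decreases. -/
theorem evalL_le_of_oneSign {p : List ℤ} (h : oneSign p = true) {u v : ℝ} (hu : 0 ≤ u)
    (huv : u < v) (hp : evalL u p ≤ 0) : evalL v p < evalL u p := by
  induction p with
  | nil => simp [oneSign] at h
  | cons a p ih =>
    simp only [oneSign, Bool.and_eq_true, decide_eq_true_eq, Bool.or_eq_true, List.all_eq_true] at h
    have ha : (0 : ℝ) < a := by exact_mod_cast h.1
    simp only [evalL] at hp ⊢
    -- A positive constant term forces the tail to be negative; the tail does not grow, and
    -- multiplying it by the larger v makes the product strictly smaller.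
    have h1 : evalL u p < 0 := by
      by_contra! h2
      linarith [mul_nonneg hu h2]
    have h2 : evalL v p ≤ evalL u p := by
      rcases h.2 with h3 | h3
      · exact (evalL_antitone h3 hu huv.le).1
      · exact (ih h3 h1.le).le
    nlinarith

/-- In the Möbius coordinate the coefficients change sign once, so after its first zero the
numerator is strictly negative. -/
theorem evalL_root_unique {p : List ℤ} {m : ℤ × ℤ × ℤ × ℤ}
    (h : oneSign (mobL m.1 m.2.1 m.2.2.1 m.2.2.2 p.length p).1 = true) {x y : ℝ}
    (hx : HasCoord m x) (hy : HasCoord m y) (hpx : evalL x p = 0) (hpy : evalL y p = 0) :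
    x = y := by
  obtain ⟨u, hu, hD, hN⟩ := hx
  obtain ⟨v, hv, hD', hN'⟩ := hy
  have h1 := evalL_mobL_fst hN p.length p le_rfl
  have h2 := evalL_mobL_fst hN' p.length p le_rfl
  rw [hpx, mul_zero, mul_eq_zero, or_iff_left hD.ne'] at h1
  rw [hpy, mul_zero, mul_eq_zero, or_iff_left hD'.ne'] at h2
  obtain rfl : u = v := by
    rcases lt_trichotomy u v with h3 | h3 | h3
    · have := evalL_le_of_oneSign h hu h3 h1.le
      linarith
    · exact h3
    · have := evalL_le_of_oneSign h hv h3 h2.le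
      linarith
  exact mul_right_cancel₀ hD.ne' (hN.trans hN'.symm)

theorem continuous_evalL (p : List ℤ) : Continuous fun x => evalL x p := by
  induction p with
  | nil => exact continuous_const
  | cons a p ih => exact continuous_const.add (continuous_id.mul ih)

/-- A sign change together with a certificate of uniqueness locates the only root. -/
theorem exists_isTheRootIn {p : List ℤ} {q : ℝ → ℝ} (hq : ∀ x, q x = evalL x p)
    {m : ℤ × ℤ × ℤ × ℤ} {a b c d : ℝ}
    (h : oneSign (mobL m.1 m.2.1 m.2.2.1 m.2.2.2 p.length p).1 = true)
    (hm : ∀ x ∈ Ioo a b, HasCoord m x) (hac : a < c) (hcd : c ≤ d) (hdb : d < b)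
    (hs : q c * q d < 0) : ∃ r ∈ Ioo c d, IsTheRootIn q a b r := by
  have hcont : ContinuousOn q (Icc c d) :=
    ((continuous_evalL p).congr fun x => (hq x).symm).continuousOn
  obtain ⟨r, hr, h0⟩ : ∃ r ∈ Icc c d, q r = 0 := by
    rcases mul_neg_iff.1 hs with ⟨h1, h2⟩ | ⟨h1, h2⟩
    · exact intermediate_value_Icc' hcd hcont ⟨h2.le, h1.le⟩
    · exact intermediate_value_Icc hcd hcont ⟨h1.le, h2.le⟩
  have hc : r ≠ c := by
    rintro rfl
    simp [h0] at hs
  have hd : r ≠ d := by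
    rintro rfl
    simp [h0] at hs
  have hr' : r ∈ Ioo c d := ⟨hr.1.lt_of_ne' hc, hr.2.lt_of_ne hd⟩
  have hrab : r ∈ Ioo a b := ⟨hac.trans hr'.1, hr'.2.trans hdb⟩
  refine ⟨r, hr', ?_⟩
  ext x
  simp only [mem_ofPred_eq, mem_singleton_iff]
  constructor
  · rintro ⟨hx, hx0⟩
    exact evalL_root_unique h (hm x hx) (hm r hrab) (by rw [← hq, hx0]) (by rw [← hq, h0])
  · rintro rfl
    exact ⟨hrab, h0⟩

theorem IsTheRootIn.eq {q : ℝ → ℝ} {a b r x : ℝ} (h : IsTheRootIn q a b r) (ha : a < x)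
    (hb : x < b) (hx : q x = 0) : x = r := by
  have : x ∈ {x : ℝ | x ∈ Ioo a b ∧ q x = 0} := ⟨⟨ha, hb⟩, hx⟩
  rwa [show {x : ℝ | x ∈ Ioo a b ∧ q x = 0} = {r} from h] at this

theorem IsTheRootIn.root {q : ℝ → ℝ} {a b r : ℝ} (h : IsTheRootIn q a b r) : q r = 0 := by
  have : r ∈ {x : ℝ | x ∈ Ioo a b ∧ q x = 0} := by
    rw [show {x : ℝ | x ∈ Ioo a b ∧ q x = 0} = {r} from h]
    rfl
  exact this.2

/-- The homogenization of the polynomial with a given coefficient list. -/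
def homL {R : Type*} [CommRing R] (n d : R) : List ℤ → R
  | [] => 0
  | a :: p => a * d ^ p.length + n * homL n d p

theorem evalL_mul_pow (n d x : ℝ) (h : x * d = n) : ∀ p : List ℤ,
    evalL x p * d ^ p.length = d * homL n d p
  | [] => by simp [evalL, homL]
  | a :: p => by
    have h1 := evalL_mul_pow n d x h p
    simp only [evalL, homL, List.length_cons]
    rw [← h] at h1 ⊢
    linear_combination d * x * h1

theorem map_homL {R S : Type*} [CommRing R] [CommRing S] (f : R →+* S) (n d : R) : ∀ p : List ℤ,
    f (homL n d p) = homL (f n) (f d) p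
  | [] => by simp [homL]
  | a :: p => by simp [homL, map_homL f n d p]

/-- A polynomial whose homogenization has no nontrivial zero modulo `N` has irrational roots. -/
theorem irrational_of_homL {p : List ℤ} {N : ℕ} (hN : 1 < N)
    (h : ∀ n d : ZMod N, homL n d p = 0 → n = 0 ∧ d = 0) {x : ℝ} (hx : evalL x p = 0) :
    Irrational x := by
  rintro ⟨r, rfl⟩
  have hd : (r.den : ℝ) ≠ 0 := by exact_mod_cast r.den_nz
  have h1 := evalL_mul_pow (r.num : ℝ) (r.den : ℝ) r (by exact_mod_cast Rat.mul_den_eq_num r) p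
  rw [hx, zero_mul, eq_comm, mul_eq_zero, or_iff_right hd] at h1
  have h2 : homL r.num (r.den : ℤ) p = 0 := by
    have h3 := map_homL (Int.castRingHom ℝ) r.num (r.den : ℤ) p
    simp only [eq_intCast, Int.cast_natCast] at h3
    rw [h1] at h3
    exact_mod_cast h3
  have h3 := map_homL (Int.castRingHom (ZMod N)) r.num (r.den : ℤ) p
  rw [h2, map_zero] at h3
  obtain ⟨h4, h5⟩ := h _ _ h3.symm
  have h6 : (N : ℤ) ∣ r.num := (ZMod.intCast_zmod_eq_zero_iff_dvd _ _).1 h4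
  have h7 : N ∣ r.den := by
    exact_mod_cast (ZMod.intCast_zmod_eq_zero_iff_dvd _ _).1 h5
  have h8 : N ∣ r.num.natAbs := Int.natCast_dvd.1 h6
  -- `N` would divide both numerator and denominator of a fraction in lowest terms.
  have h9 := Nat.dvd_gcd h8 h7
  rw [r.reduced] at h9
  exact hN.ne' (Nat.dvd_one.1 h9)

/-- The coefficients of `q1`. -/
def listq1 : List ℤ := [48, -444, 1234, -1625, 894, -153, 2]

/-- The coefficients of `q2`. -/
def listq2 : List ℤ := [19744, 11249208, -563207524, 3311923726, 15757275163, -227233713561,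
  997977148820, -2344796073539, 3259827826136, -2645532232771, 1027573184492, 102470736381,
  -293774330511, 129626832188, -29387373904, 5969663136, -1447424208, 177586560]

/-- The coefficients of `q3`. -/
def listq3 : List ℤ := [1, 974, -5186, 8308, -4831, 862]

theorem q1_eq (x : ℝ) : q1 x = evalL x listq1 := by
  simp only [q1, listq1, evalL]
  push_cast
  ring

theorem q2_eq (x : ℝ) : q2 x = evalL x listq2 := by
  simp only [q2, listq2, evalL]
  push_cast
  ring

theorem q3_eq (x : ℝ) : q3 x = evalL x listq3 := by
  simp only [q3, listq3, evalL]
  push_cast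
  ring

/-- The moduli 17, 31 and 11 are primes for which q₁, q₂ and q₃ respectively have no root on the
projective line over the prime field, checked exhaustively. -/
theorem irrational_of_q1 {x : ℝ} (h : q1 x = 0) : Irrational x :=
  irrational_of_homL (N := 17) (by norm_num) (by decide +kernel) ((q1_eq x).symm.trans h)

theorem irrational_of_q2 {x : ℝ} (h : q2 x = 0) : Irrational x :=
  irrational_of_homL (N := 31) (by norm_num) (by decide +kernel) ((q2_eq x).symm.trans h)

theorem irrational_of_q3 {x : ℝ} (h : q3 x = 0) : Irrational x :=
  irrational_of_homL (N := 11) (by norm_num) (by decide +kernel) ((q3_eq x).symm.trans h)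

/-- Besides locating the root, the narrow bracket links it to the rational ranges of the sign
analysis; likewise for the roots below. -/
theorem exists_root_q1 : ∃ r ∈ Ioo (17 / 100 : ℝ) (18 / 100), IsTheRootIn q1 0 (1 / 5) r :=
  exists_isTheRootIn q1_eq (m := (1, 0, 5, 5)) (by decide +kernel)
    (fun x hx => hasCoord_Ico (by norm_num) (by push_cast; linarith [hx.1])
      (by push_cast; linarith [hx.2])) (by norm_num) (by norm_num) (by norm_num)
    (by norm_num [q1])

theorem exists_root_q2_zero : ∃ r ∈ Ioo (1 / 100 : ℝ) (3 / 100), IsTheRootIn q2 0 (1 / 5) r :=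
  exists_isTheRootIn q2_eq (m := (1, 0, 5, 5)) (by decide +kernel)
    (fun x hx => hasCoord_Ico (by norm_num) (by push_cast; linarith [hx.1])
      (by push_cast; linarith [hx.2])) (by norm_num) (by norm_num) (by norm_num)
    (by norm_num [q2])

/-- `oneSign` asks for a positive first coefficient, so the coordinate starts at an end where the
polynomial is positive, here the right one. -/
theorem exists_root_q2_fifth :
    ∃ r ∈ Ioo (22 / 100 : ℝ) (23 / 100), IsTheRootIn q2 (1 / 5) (1 / 3) r :=
  exists_isTheRootIn q2_eq (m := (3, 5, 15, 15)) (by decide +kernel)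
    (fun x hx => hasCoord_Ioc (by norm_num) (by push_cast; linarith [hx.1])
      (by push_cast; linarith [hx.2])) (by norm_num) (by norm_num) (by norm_num)
    (by norm_num [q2])

theorem exists_root_q2_three_half :
    ∃ r ∈ Ioo (176 / 100 : ℝ) (178 / 100), IsTheRootIn q2 (3 / 2) 2 r :=
  exists_isTheRootIn q2_eq (m := (4, 3, 2, 2)) (by decide +kernel)
    (fun x hx => hasCoord_Ico (by norm_num) (by push_cast; linarith [hx.1])
      (by push_cast; linarith [hx.2])) (by norm_num) (by norm_num) (by norm_num)
    (by norm_num [q2])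

theorem exists_root_q2_three :
    ∃ r ∈ Ioo (310 / 100 : ℝ) (315 / 100), IsTheRootIn q2 3 4 r :=
  exists_isTheRootIn q2_eq (m := (3, 4, 1, 1)) (by decide +kernel)
    (fun x hx => hasCoord_Ioc (by norm_num) (by push_cast; linarith [hx.1])
      (by push_cast; linarith [hx.2])) (by norm_num) (by norm_num) (by norm_num)
    (by norm_num [q2])

theorem exists_root_q3 : ∃ r ∈ Ioo (305 / 100 : ℝ) (306 / 100), IsTheRootIn q3 3 4 r :=
  exists_isTheRootIn q3_eq (m := (3, 4, 1, 1)) (by decide +kernel)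
    (fun x hx => hasCoord_Ioc (by norm_num) (by push_cast; linarith [hx.1])
      (by push_cast; linarith [hx.2])) (by norm_num) (by norm_num) (by norm_num)
    (by norm_num [q3])

/-! ### Double roots of the Wronskian factor -/

/-- The derivative of `polyE k`. -/
def polyE' (k s : ℝ) : ℝ :=
  coefE1 k + 2 * coefE2 k * s + 3 * coefE3 k * s ^ 2 + 4 * coefE4 k * s ^ 3

/-- A factor of the discriminant of `polyE k`. -/
def discFactor (k : ℝ) : ℝ :=
  32400 * k ^ 12 - 189990 * k ^ 11 + 503307 * k ^ 10 - 781069 * k ^ 9 + 742059 * k ^ 8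
    - 352440 * k ^ 7 - 84219 * k ^ 6 + 253647 * k ^ 5 - 161955 * k ^ 4 + 28332 * k ^ 3
    + 22032 * k ^ 2 - 15336 * k + 3296

/-- The discriminant of a quartic polynomial. -/
def discQuartic (e d c b a : ℝ) : ℝ :=
  256*a^3*e^3 - 192*a^2*b*d*e^2 - 128*a^2*c^2*e^2 + 144*a^2*c*d^2*e - 27*a^2*d^4
    + 144*a*b^2*c*e^2 - 6*a*b^2*d^2*e - 80*a*b*c^2*d*e + 18*a*b*c*d^3 + 16*a*c^4*e
    - 4*a*c^3*d^2 - 27*b^4*e^2 + 18*b^3*c*d*e - 4*b^3*d^3 - 4*b^2*c^3*e + b^2*c^2*d^2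

/-- The two equations can be solved for d and e; after substitution the discriminant vanishes
identically. -/
theorem discQuartic_eq_zero {e d c b a s : ℝ} (h : e + d * s + c * s ^ 2 + b * s ^ 3 + a * s ^ 4 = 0)
    (h' : d + 2 * c * s + 3 * b * s ^ 2 + 4 * a * s ^ 3 = 0) : discQuartic e d c b a = 0 := by
  obtain rfl : d = -(2 * c * s + 3 * b * s ^ 2 + 4 * a * s ^ 3) := by linarith
  obtain rfl : e = c * s ^ 2 + 2 * b * s ^ 3 + 3 * a * s ^ 4 := by linarith
  simp only [discQuartic]
  ring

/-- This is the origin of q₂: besides it, the discriminant of E has only explicit rational roots and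
`discFactor`, which is positive on (0, 5]. -/
theorem discQuartic_coefE (k : ℝ) :
    discQuartic (coefE0 k) (coefE1 k) (coefE2 k) (coefE3 k) (coefE4 k) =
    -192 * (k - 1) ^ 12 * (2 * k - 1) * (3 * k - 2) * (3 * k - 4) ^ 2 * (5 * k - 4) * q2 k
      * discFactor k := by
  simp only [discQuartic, coefE0, coefE1, coefE2, coefE3, coefE4, q2, discFactor]
  ring

theorem hasDerivAt_polyE (k s : ℝ) : HasDerivAt (polyE k) (polyE' k s) s := by
  have h := (((((hasDerivAt_id s).const_mul (coefE1 k)).const_add (coefE0 k)).add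
    (((hasDerivAt_id s).pow 2).const_mul (coefE2 k))).add
    (((hasDerivAt_id s).pow 3).const_mul (coefE3 k))).add
    (((hasDerivAt_id s).pow 4).const_mul (coefE4 k))
  refine (h.congr_deriv ?_).congr_of_eventuallyEq (Eventually.of_forall fun y => ?_)
  · simp only [polyE', id]
    push_cast
    ring
  · simp [polyE]

/-- Negativity on a compact interval persists along a family that is negative at the end points and
has no double zeros inside. -/
theorem neg_of_no_double_zero {F F' : ℝ → ℝ → ℝ} (hF : Continuous fun p : ℝ × ℝ => F p.1 p.2)
    (hF' : ∀ κ s, HasDerivAt (F κ) (F' κ s) s) {W : Set ℝ} (hW : IsPreconnected W) {a b : ℝ}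
    (hab : a ≤ b) (ha : ∀ κ ∈ W, F κ a < 0) (hb : ∀ κ ∈ W, F κ b < 0)
    (hd : ∀ κ ∈ W, ∀ s ∈ Ioo a b, F κ s = 0 → F' κ s ≠ 0) {k₀ : ℝ} (hk₀ : k₀ ∈ W)
    (h₀ : ∀ s ∈ Icc a b, F k₀ s < 0) {k : ℝ} (hk : k ∈ W) : ∀ s ∈ Icc a b, F k s < 0 := by
  -- The maximum over [a, b] depends continuously on κ. If it ever became nonnegative it would equal
  -- 0 for some κ; the maximizer is then interior, hence a double zero.
  have hM : Continuous fun κ => sSup (F κ '' Icc a b) :=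
    isCompact_Icc.continuous_sSup hF
  have hmax : ∀ κ, ∃ s ∈ Icc a b, F κ s = sSup (F κ '' Icc a b) ∧ ∀ y ∈ Icc a b, F κ y ≤ F κ s := by
    intro κ
    obtain ⟨s, hs, h1, h2⟩ := isCompact_Icc.exists_sSup_image_eq_and_ge (nonempty_Icc.2 hab)
      (hF.comp (Continuous.prodMk_right κ)).continuousOn
    exact ⟨s, hs, h1.symm, h2⟩
  by_contra! h
  obtain ⟨s, hs, h1⟩ := h
  have h2 : 0 ≤ sSup (F k '' Icc a b) := by
    obtain ⟨y, hy, h3, h4⟩ := hmax k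
    rw [← h3]
    exact h1.trans (h4 s hs)
  have h3 : sSup (F k₀ '' Icc a b) ≤ 0 := by
    obtain ⟨y, hy, h3, h4⟩ := hmax k₀
    rw [← h3]
    exact (h₀ y hy).le
  obtain ⟨κ, hκ, h5⟩ := hW.intermediate_value hk₀ hk hM.continuousOn ⟨h3, h2⟩
  obtain ⟨y, hy, h6, h7⟩ := hmax κ
  have h8 : F κ y = 0 := h6.trans h5
  have hya : y ≠ a := by
    rintro rfl
    exact (ha κ hκ).ne h8
  have hyb : y ≠ b := by
    rintro rfl
    exact (hb κ hκ).ne h8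
  have hy' : y ∈ Ioo a b := ⟨hy.1.lt_of_ne' hya, hy.2.lt_of_ne hyb⟩
  have h9 : IsLocalMax (F κ) y :=
    (IsMaxOn.isLocalMax (s := Icc a b) (fun z hz => h7 z hz) (Icc_mem_nhds hy'.1 hy'.2))
  exact hd κ hκ y hy' h8 (h9.hasDerivAt_eq_zero (hF' κ y))

theorem continuous_uncurry_polyE : Continuous fun p : ℝ × ℝ => polyE p.1 p.2 := by
  simp only [polyE, coefE0, coefE1, coefE2, coefE3, coefE4]
  fun_prop

theorem discFactor_pos {k : ℝ} (h0 : 0 < k) (h5 : k ≤ 5) : 0 < discFactor k := by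
  have h := evalL_pos (m := (0, 5, 1, 1)) (x := k) (hasCoord_Ioc (by norm_num)
    (by push_cast; linarith) (by push_cast; linarith)) [false, false, false, false]
    [3296, -15336, 22032, 28332, -161955, 253647, -84219, -352440, 742059, -781069, 503307,
      -189990, 32400] (by decide +kernel)
  simp only [evalL] at h
  push_cast at h
  rw [discFactor]
  linear_combination h

theorem polyE'_ne_zero {k s : ℝ} (h0 : 0 < k) (h5 : k ≤ 5) (h1 : k ≠ 1) (h2 : k ≠ 1 / 2)
    (h3 : k ≠ 2 / 3) (h4 : k ≠ 4 / 3) (h6 : k ≠ 4 / 5) (hq : q2 k ≠ 0) (h : polyE k s = 0) :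
    polyE' k s ≠ 0 := by
  intro h'
  have hd := discQuartic_eq_zero h h'
  rw [discQuartic_coefE] at hd
  have g1 : k - 1 ≠ 0 := sub_ne_zero.2 h1
  have g2 : 2 * k - 1 ≠ 0 := fun h => h2 (by linarith)
  have g3 : 3 * k - 2 ≠ 0 := fun h => h3 (by linarith)
  have g4 : 3 * k - 4 ≠ 0 := fun h => h4 (by linarith)
  have g6 : 5 * k - 4 ≠ 0 := fun h => h6 (by linarith)
  have g5 := (discFactor_pos h0 h5).ne'
  simp [g1, g2, g3, g4, g5, g6, hq] at hd

/-! ### Zeros of the two polynomials in terms of the signs of their coefficients -/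

/-- The coefficients of `polyE k`. -/
noncomputable def coefE (k : ℝ) : ℕ → ℝ
  | 0 => coefE0 k
  | 1 => coefE1 k
  | 2 => coefE2 k
  | 3 => coefE3 k
  | 4 => coefE4 k
  | _ => 0

theorem polyE_eq_sum (k s : ℝ) : polyE k s = ∑ j ∈ Finset.range 5, coefE k j * s ^ j := by
  simp [Finset.sum_range_succ, coefE, polyE]

theorem wronskE_eq_sum (k t : ℝ) :
    wronskE k t = ∑ j ∈ Finset.range 5, coefE k j * t ^ (((2 * j : ℕ) : ℝ)) := by
  rw [wronskE, polyE_eq_sum]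
  refine Finset.sum_congr rfl fun j _ => ?_
  rw [Real.rpow_natCast, pow_mul]

theorem wronskE_zerosLE {k : ℝ} (ε : ℝ) (q : List ℝ)
    (h0 : ∀ j < 5, 0 ≤ ε * coefE k j * (q.map (((2 * j : ℕ) : ℝ) - ·)).prod)
    (h1 : ∃ j < 5, ε * coefE k j * (q.map (((2 * j : ℕ) : ℝ) - ·)).prod ≠ 0) :
    ZerosLE (wronskE k) (Ioi 0) q.length := by
  have hε : ε ≠ 0 := by
    rintro rfl
    obtain ⟨j, -, h⟩ := h1
    simp at h
  have h := zerosLE_sum_rpow (Finset.range 5) (fun j => ε * coefE k j)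
    (fun j => ((2 * j : ℕ) : ℝ)) q (fun j hj => h0 j (Finset.mem_range.1 hj))
    (let ⟨j, hj, h⟩ := h1; ⟨j, Finset.mem_range.2 hj, h⟩)
  refine ((h.mul_left (g := fun _ => ε⁻¹) (fun t ht => ?_) (fun t _ => analyticAt_const)
    fun t _ => inv_ne_zero hε)).congr isOpen_Ioi fun t _ => ?_
  · exact Finset.analyticAt_fun_sum _ fun j _ => analyticAt_const.mul (analyticAt_rpow _ ht)
  · rw [wronskE_eq_sum, Finset.mul_sum]
    refine Finset.sum_congr rfl fun j _ => ?_
    rw [mul_assoc ε, inv_mul_cancel_left₀ hε]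

theorem wronskE_zerosLE_four {k : ℝ} (h : ∃ j < 5, coefE k j ≠ 0) :
    ZerosLE (wronskE k) (Ioi 0) 4 := by
  have h := zerosLE_sum_rpow_of_injOn (Finset.range 5) (coefE k) (fun j => ((2 * j : ℕ) : ℝ))
    (fun i _ j _ hij => by simpa using hij) (let ⟨j, hj, h⟩ := h; ⟨j, Finset.mem_range.2 hj, h⟩)
  exact h.congr isOpen_Ioi fun t _ => wronskE_eq_sum k t

/-- In t the exponents are 0, 2, 4, 6, 8, so odd entries of `q` mark the places where the
coefficients change sign. -/
theorem wronskE_zerosLE_coef {k : ℝ} (ε : ℝ) (q : List ℝ)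
    (h0 : 0 ≤ ε * coefE0 k * (q.map (0 - ·)).prod) (h1 : 0 ≤ ε * coefE1 k * (q.map (2 - ·)).prod)
    (h2 : 0 ≤ ε * coefE2 k * (q.map (4 - ·)).prod) (h3 : 0 ≤ ε * coefE3 k * (q.map (6 - ·)).prod)
    (h4 : 0 ≤ ε * coefE4 k * (q.map (8 - ·)).prod) (hne : ε * coefE0 k * (q.map (0 - ·)).prod ≠ 0) :
    ZerosLE (wronskE k) (Ioi 0) q.length := by
  refine wronskE_zerosLE ε q (fun j hj => ?_) ⟨0, by norm_num, by simpa [coefE] using hne⟩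
  interval_cases j
  · simpa [coefE] using h0
  all_goals
    norm_num [coefE]
    assumption

/-- The coefficients of `ε • polyE k` change sign once, from `-` to `+`, just before degree `m`. -/
structure OneChange (k ε : ℝ) (m : ℕ) : Prop where
  pos : 0 < m
  zero : ε * coefE0 k < 0
  left : ∀ j < m, ε * coefE k j ≤ 0
  right : ∀ j ≥ m, 0 ≤ ε * coefE k j

theorem OneChange.zerosLE {k ε : ℝ} {m : ℕ} (h : OneChange k ε m) :
    ZerosLE (wronskE k) (Ioi 0) 1 := by
  have hm : (1 : ℝ) ≤ m := by exact_mod_cast h.pos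
  -- 2m - 1 separates the exponents 2(m-1) and 2m, between which the sign changes.
  refine wronskE_zerosLE ε [2 * m - 1] (fun j _ => ?_) ⟨0, by norm_num, ?_⟩
  · simp only [List.map_cons, List.map_nil, List.prod_cons, List.prod_nil, mul_one]
    rcases lt_or_ge j m with hj | hj
    · have h1 : (j : ℝ) + 1 ≤ m := by exact_mod_cast hj
      refine mul_nonneg_of_nonpos_of_nonpos (h.left j hj) ?_
      push_cast
      linarith
    · have h1 : (m : ℝ) ≤ j := by exact_mod_cast hj
      refine mul_nonneg (h.right j hj) ?_
      push_cast
      linarith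
  · simp only [List.map_cons, List.map_nil, List.prod_cons, List.prod_nil, mul_one, coefE]
    refine mul_ne_zero h.zero.ne ?_
    push_cast
    linarith

/-- εE(s)/s^m is strictly increasing: nonpositive coefficients go with negative exponents and
nonnegative ones with nonnegative exponents. -/
theorem OneChange.rising {k ε : ℝ} {m : ℕ} (h : OneChange k ε m) {a b : ℝ} (ha : 0 < a)
    (hab : a < b) (hE : 0 ≤ ε * polyE k a) : 0 < ε * polyE k b := by
  obtain ⟨r, rfl⟩ : ∃ r, b = a * r := ⟨b / a, by field_simp⟩
  have hr : 1 < r := by nlinarith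
  have h1 : r ^ m * (ε * polyE k a) < ε * polyE k (a * r) := by
    rw [polyE_eq_sum, polyE_eq_sum, Finset.mul_sum, Finset.mul_sum, Finset.mul_sum]
    refine Finset.sum_lt_sum (fun j _ => ?_) ⟨0, by simp, ?_⟩
    · rw [mul_pow]
      rcases lt_or_ge j m with hj | hj
      · have h2 := mul_nonneg (mul_nonneg (neg_nonneg.2 (h.left j hj)) (pow_pos ha j).le)
          (sub_nonneg.2 (pow_le_pow_right₀ hr.le hj.le))
        linear_combination h2
      · have h2 := mul_nonneg (mul_nonneg (h.right j hj) (pow_pos ha j).le)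
          (sub_nonneg.2 (pow_le_pow_right₀ hr.le hj))
        linear_combination h2
    · have h2 : 1 < r ^ m := one_lt_pow₀ hr h.pos.ne'
      have h3 := h.zero
      simp only [coefE, pow_zero, mul_one]
      nlinarith
  exact (mul_nonneg (pow_nonneg (by linarith) m) hE).trans_lt h1

theorem polyE_pos_of_large {k ε : ℝ} (h : 0 < ε * coefE4 k) :
    ∃ M > 0, ∀ s ≥ M, 0 < ε * polyE k s := by
  have h0 := neg_abs_le (ε * coefE0 k)
  have h1 := neg_abs_le (ε * coefE1 k)
  have h2 := neg_abs_le (ε * coefE2 k)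
  have h3 := neg_abs_le (ε * coefE3 k)
  set S := |ε * coefE0 k| + |ε * coefE1 k| + |ε * coefE2 k| + |ε * coefE3 k| with hS
  have hS0 : 0 ≤ S := by positivity
  refine ⟨S / (ε * coefE4 k) + 1, by positivity, fun s hs => ?_⟩
  have hs1 : 1 ≤ s := le_trans (by linarith [div_nonneg hS0 h.le]) hs
  have hs2 : S < ε * coefE4 k * s := by
    have : S / (ε * coefE4 k) < s := by linarith
    rwa [div_lt_iff₀ h, mul_comm] at this
  have hp : ∀ {c : ℝ} {j : ℕ}, j ≤ 3 → -(|c| * s ^ 3) ≤ c * s ^ j := fun {c j} hj => by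
    have h5 : s ^ j ≤ s ^ 3 := pow_le_pow_right₀ hs1 hj
    have h6 : (0 : ℝ) ≤ s ^ j := by positivity
    nlinarith [neg_abs_le c, abs_nonneg c]
  have g0 := hp (c := ε * coefE0 k) (j := 0) (by norm_num)
  have g1 := hp (c := ε * coefE1 k) (j := 1) (by norm_num)
  have g2 := hp (c := ε * coefE2 k) (j := 2) (by norm_num)
  have g3 := hp (c := ε * coefE3 k) (j := 3) (by norm_num)
  have g4 : 0 < s ^ 3 * (ε * coefE4 k * s - S) := mul_pos (by positivity) (by linarith)
  rw [hS] at g4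
  rw [polyE]
  linarith

theorem continuous_polyE (k : ℝ) : Continuous (polyE k) := by
  unfold polyE
  fun_prop

theorem exists_polyE_root_of_sign {k ε s : ℝ} (h : ε * coefE0 k < 0) (hs : 0 < s)
    (hE : 0 < ε * polyE k s) : ∃ s > 0, polyE k s = 0 := by
  have hε : ε ≠ 0 := by
    rintro rfl
    simp at h
  obtain ⟨r, hr, h0⟩ := intermediate_value_Ioo hs.le
    (f := fun s => ε * polyE k s) (continuous_const.mul (continuous_polyE k)).continuousOn
    (show (0 : ℝ) ∈ Ioo (ε * polyE k 0) (ε * polyE k s) from ⟨by simpa [polyE] using h, hE⟩)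
  exact ⟨r, hr.1, (mul_eq_zero.1 h0).resolve_left hε⟩

theorem exists_polyE_root {k ε : ℝ} (h : ε * coefE0 k < 0) (h4 : 0 < ε * coefE4 k) :
    ∃ s > 0, polyE k s = 0 := by
  obtain ⟨M, hM, h1⟩ := polyE_pos_of_large h4
  exact exists_polyE_root_of_sign h hM (h1 M le_rfl)

theorem imageU_eq_sum (k t : ℝ) : imageU k t = ∑ j ∈ Finset.range 3,
    (![coefQ0 k, coefQ1 k, coefQ2 k] : Fin 3 → ℝ) (Fin.ofNat 3 j) * t ^ (((2 * j : ℕ) : ℝ)) := by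
  simp only [Finset.sum_range_succ, Real.rpow_natCast, imageU, polyQ]
  simp [Fin.ofNat, ← pow_mul]

theorem imageU_zerosLE {k : ℝ} (ε : ℝ) (q : List ℝ)
    (h0 : 0 ≤ ε * coefQ0 k * (q.map (0 - ·)).prod) (h1 : 0 ≤ ε * coefQ1 k * (q.map (2 - ·)).prod)
    (h2 : 0 ≤ ε * coefQ2 k * (q.map (4 - ·)).prod)
    (hne : ε * coefQ0 k * (q.map (0 - ·)).prod ≠ 0 ∨ ε * coefQ2 k * (q.map (4 - ·)).prod ≠ 0) :
    ZerosLE (imageU k) (Ioi 0) q.length := by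
  have hε : ε ≠ 0 := by
    rintro rfl
    simp at hne
  have h := zerosLE_sum_rpow (Finset.range 3)
    (fun j => ε * (![coefQ0 k, coefQ1 k, coefQ2 k] : Fin 3 → ℝ) (Fin.ofNat 3 j))
    (fun j => ((2 * j : ℕ) : ℝ)) q (fun j hj => ?_) ?_
  · refine ((h.mul_left (g := fun _ => ε⁻¹) (fun t ht => ?_) (fun t _ => analyticAt_const)
      fun t _ => inv_ne_zero hε)).congr isOpen_Ioi fun t _ => ?_
    · exact Finset.analyticAt_fun_sum _ fun j _ => analyticAt_const.mul (analyticAt_rpow _ ht)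
    · rw [imageU_eq_sum, Finset.mul_sum]
      refine Finset.sum_congr rfl fun j _ => ?_
      rw [mul_assoc ε, inv_mul_cancel_left₀ hε]
  · have hj3 := Finset.mem_range.1 hj
    interval_cases j
    · simpa [Fin.ofNat] using h0
    · simpa [Fin.ofNat] using h1
    · have : (((2 * 2 : ℕ) : ℕ) : ℝ) = 4 := by norm_num
      rw [this]
      simpa [Fin.ofNat] using h2
  · rcases hne with h | h
    · exact ⟨0, by simp, by simpa [Fin.ofNat] using h⟩
    · refine ⟨2, by simp, ?_⟩
      have : (((2 * 2 : ℕ) : ℕ) : ℝ) = 4 := by norm_num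
      rw [this]
      simpa [Fin.ofNat] using h

/-- The entry 2 kills the middle term of Q, whose sign is not controlled, and gives the outer terms
opposite factors. -/
theorem imageU_zerosLE_one {k : ℝ} (h : coefQ0 k * coefQ2 k ≤ 0)
    (hne : coefQ0 k ≠ 0 ∨ coefQ2 k ≠ 0) : ZerosLE (imageU k) (Ioi 0) 1 := by
  rcases hne with h0 | h2
  · have h1 := mul_self_pos.2 h0
    refine imageU_zerosLE (-coefQ0 k) [2] ?_ ?_ ?_ (Or.inl ?_) <;> norm_num
    · linarith
    · linarith
    · exact h0
  · have h1 := mul_self_pos.2 h2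
    refine imageU_zerosLE (coefQ2 k) [2] ?_ ?_ ?_ (Or.inr ?_) <;> norm_num
    · linarith
    · linarith
    · exact h2

theorem imageU_zerosLE_two {k : ℝ} (h2 : coefQ2 k ≠ 0) : ZerosLE (imageU k) (Ioi 0) 2 := by
  have h1 := mul_self_pos.2 h2
  refine imageU_zerosLE (coefQ2 k) [0, 2] ?_ ?_ ?_ (Or.inr ?_) <;> norm_num
  · linarith
  · exact h2

theorem polyQ_factor {k : ℝ} (h2 : coefQ2 k ≠ 0) (hD : 0 ≤ coefQ1 k ^ 2 - 4 * coefQ0 k * coefQ2 k) :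
    ∃ a b, a ≤ b ∧ ∀ s, polyQ k s = coefQ2 k * (s - a) * (s - b) := by
  set r := Real.sqrt (coefQ1 k ^ 2 - 4 * coefQ0 k * coefQ2 k) with hr
  have hr2 : r ^ 2 = coefQ1 k ^ 2 - 4 * coefQ0 k * coefQ2 k := Real.sq_sqrt hD
  have key : ∀ s, polyQ k s = coefQ2 k * (s - (-coefQ1 k - r) / (2 * coefQ2 k))
      * (s - (-coefQ1 k + r) / (2 * coefQ2 k)) := by
    intro s
    rw [polyQ]
    field_simp
    linear_combination hr2
  rcases le_total ((-coefQ1 k - r) / (2 * coefQ2 k)) ((-coefQ1 k + r) / (2 * coefQ2 k)) with h | h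
  · exact ⟨_, _, h, key⟩
  · exact ⟨_, _, h, fun s => by rw [key]; ring⟩

theorem polyQ'_eq_of_factor {k a b : ℝ} (h : ∀ s, polyQ k s = coefQ2 k * (s - a) * (s - b))
    (s : ℝ) : polyQ' k s = coefQ2 k * ((s - a) + (s - b)) := by
  have h0 := h 0
  have h1 := h 1
  simp only [polyQ] at h0 h1
  rw [polyQ']
  linear_combination h1 - h0

/-- If the outer coefficients of `polyQ k` have opposite signs, it has a single positive root. -/
theorem polyQ_factor_of_neg {k : ℝ} (h : coefQ0 k * coefQ2 k < 0) :
    ∃ a < 0, ∃ b > 0, ∀ s, polyQ k s = coefQ2 k * (s - a) * (s - b) := by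
  have h2 : coefQ2 k ≠ 0 := fun h2 => by simp [h2] at h
  obtain ⟨a, b, hab, hf⟩ := polyQ_factor h2 (by nlinarith [sq_nonneg (coefQ1 k)])
  have h0 : coefQ0 k = coefQ2 k * a * b := by
    have := hf 0
    simp only [polyQ] at this
    linear_combination this
  have h3 : a * b < 0 := by
    have h4 := mul_self_pos.2 h2
    rw [h0] at h
    by_contra! h5
    nlinarith [mul_nonneg h4.le h5]
  rcases mul_neg_iff.1 h3 with ⟨ha, hb⟩ | ⟨ha, hb⟩
  · linarith
  · exact ⟨a, ha, b, hb, hf⟩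

theorem imageU_ne_of_factor {k a b t : ℝ} (h2 : coefQ2 k ≠ 0)
    (h : ∀ s, polyQ k s = coefQ2 k * (s - a) * (s - b)) (ha : t ^ 2 ≠ a) (hb : t ^ 2 ≠ b) :
    imageU k t ≠ 0 := by
  rw [imageU, h]
  exact mul_ne_zero (mul_ne_zero h2 (sub_ne_zero.2 ha)) (sub_ne_zero.2 hb)

/-- A single positive root of `polyQ k`, at which the Wronskian factor is negative. -/
theorem exists_onlyZero {k : ℝ} (h : coefQ0 k * coefQ2 k < 0)
    (hA : 0 < coefQ2 k * coefA k) (hB : 0 < coefQ2 k * coefB k) :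
    ∃ t₀, OnlyZero k t₀ ∧ wronskE k t₀ < 0 ∧ ∀ t ∈ Ioo 0 t₀, polyQ k (t ^ 2) * coefQ2 k < 0 := by
  have h2 : coefQ2 k ≠ 0 := fun h2 => by simp [h2] at h
  obtain ⟨a, ha, b, hb, hf⟩ := polyQ_factor_of_neg h
  have hsq : Real.sqrt b ^ 2 = b := Real.sq_sqrt hb.le
  refine ⟨Real.sqrt b, ⟨Real.sqrt_pos.2 hb, by simp [imageU, hsq, hf], fun t ht hne => ?_⟩, ?_,
    fun t ht => ?_⟩
  · refine imageU_ne_of_factor h2 hf (by nlinarith) fun h3 => hne ?_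
    rw [← h3, Real.sqrt_sq ht]
  -- At the larger root, Q' and A + Bs both have the sign of the leading coefficient, so their
  -- product is positive and E is negative.
  · have h3 := polyE_at_root hb (k := k) (by simp [hf])
    rw [polyQ'_eq_of_factor hf] at h3
    have h4 : 0 < coefQ2 k * (coefA k + coefB k * b) := by nlinarith
    have h5 : 0 < (b - a) * b * (1 + b) := by
      have : 0 < b - a := by linarith
      positivity
    rw [wronskE, hsq]
    nlinarith [mul_pos h4 h5]
  · have h3 : t ^ 2 < b := by
      rw [← hsq]
      exact pow_lt_pow_left₀ ht.2 ht.1.le two_ne_zero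
    rw [hf]
    have h4 := mul_pos (mul_self_pos.2 h2) (mul_pos (show 0 < t ^ 2 - a by nlinarith [sq_nonneg t])
      (show 0 < b - t ^ 2 by linarith))
    nlinarith

/-- If the outer coefficients of `polyQ k` are positive, it has no positive roots or two. -/
theorem polyQ_pos_or_factor {k : ℝ} (h0 : 0 < coefQ0 k) (h2 : 0 < coefQ2 k) :
    (∀ s > 0, 0 < polyQ k s) ∨
      ∃ a > 0, ∃ b, a ≤ b ∧ ∀ s, polyQ k s = coefQ2 k * (s - a) * (s - b) := by
  rcases lt_or_ge (coefQ1 k ^ 2 - 4 * coefQ0 k * coefQ2 k) 0 with hD | hD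
  · refine Or.inl fun s _ => ?_
    have : 0 < 4 * coefQ2 k * polyQ k s := by
      rw [polyQ]
      nlinarith [sq_nonneg (2 * coefQ2 k * s + coefQ1 k)]
    exact pos_of_mul_pos_right this (by positivity)
  obtain ⟨a, b, hab, hf⟩ := polyQ_factor h2.ne' hD
  have h3 : coefQ0 k = coefQ2 k * a * b := by
    have := hf 0
    simp only [polyQ] at this
    linear_combination this
  have h4 : 0 < a * b := by
    rw [h3, mul_assoc] at h0
    exact pos_of_mul_pos_right h0 h2.le
  rcases mul_pos_iff.1 h4 with ⟨ha, hb⟩ | ⟨ha, hb⟩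
  · exact Or.inr ⟨a, ha, b, hab, hf⟩
  · refine Or.inl fun s hs => ?_
    rw [hf]
    exact mul_pos (mul_pos h2 (by linarith)) (by linarith)

theorem onlyTwoZeros_of_factor {k a b : ℝ} (h2 : coefQ2 k ≠ 0) (ha : 0 < a) (hab : a ≤ b)
    (hf : ∀ s, polyQ k s = coefQ2 k * (s - a) * (s - b)) :
    OnlyTwoZeros k (Real.sqrt a) (Real.sqrt b) := by
  have h3 := Real.sq_sqrt ha.le
  have h4 := Real.sq_sqrt (ha.le.trans hab)
  refine ⟨Real.sqrt_pos.2 ha, Real.sqrt_le_sqrt hab, by simp [imageU, h3, hf],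
    by simp [imageU, h4, hf], fun t ht hn1 hn2 => imageU_ne_of_factor h2 hf ?_ ?_⟩
  · rintro rfl
    exact hn1 (Real.sqrt_sq ht).symm
  · rintro rfl
    exact hn2 (Real.sqrt_sq ht).symm

theorem quotVU_lt_of_neg {k t : ℝ} (hA : coefA k < 0) (hB : coefB k < 0) (ht : 0 < t)
    (hQ : 0 < polyQ k (t ^ 2)) : quotVU k t < Real.pi / 2 := by
  rw [quotVU_eq hQ.ne']
  have h1 : t ^ 5 * (coefA k + coefB k * t ^ 2) / (polyQ k (t ^ 2) * (1 + t ^ 2) ^ 4) < 0 := by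
    refine div_neg_of_neg_of_pos (mul_neg_of_pos_of_neg (by positivity) ?_) (by positivity)
    nlinarith [sq_nonneg t]
  linarith [primPhi_lt ht]

/-! ### Certified signs -/

theorem evalL_neg {m : ℤ × ℤ × ℤ × ℤ} {x : ℝ} (hx : HasCoord m x) (l : List Bool) (p : List ℤ)
    (h : posOn m l (smulL (-1) p) = true) : evalL x p < 0 := by
  have h1 := evalL_pos hx l _ h
  rw [evalL_smulL] at h1
  push_cast at h1
  linarith

theorem evalLL_neg {m n : ℤ × ℤ × ℤ × ℤ} {x y : ℝ} (hx : HasCoord m x) (hy : HasCoord n y)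
    (l : List Bool) (p : List (List ℤ)) (h : posOnProd m n l (smulLL (-1) p) = true) :
    evalLL x y p < 0 := by
  have h1 := evalLL_pos hx hy l _ h
  rw [evalLL_smulLL] at h1
  push_cast at h1
  linarith

/-- The coefficients of `coefA`, up to a constant. -/
def listA : List ℤ := [-20, 6, 45, -65, 30]

/-- The coefficients of `coefB`, up to a constant. -/
def listB : List ℤ := [-16, 24, 24, -85, 57]

/-- The coefficients of the nonlinear factor of `coefE1`. -/
def listF1 : List ℤ := [-52, 76, 150, -176, 38, -4]

/-- The coefficients of the nonlinear factor of `coefE2`. -/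
def listF2 : List ℤ := [-38, 201, -930, 2034, -1830, 885, -610, 240]

/-- The coefficients of the nonlinear factor of `coefE3`. -/
def listF3 : List ℤ := [4, -70, 236, 178, -940, 716, -156]

theorem coefA_eq (k : ℝ) : coefA k = 32 / 3 * evalL k listA := by
  simp only [coefA, listA, evalL]
  push_cast
  ring

theorem coefB_eq (k : ℝ) : coefB k = 32 / 3 * evalL k listB := by
  simp only [coefB, listB, evalL]
  push_cast
  ring

theorem coefE1_eq (k : ℝ) : coefE1 k = (3 * k - 2) * (5 * k - 4) * evalL k listF1 := by
  simp only [coefE1, listF1, evalL]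
  push_cast
  ring

theorem coefE2_eq (k : ℝ) : coefE2 k = (3 * k - 4) * evalL k listF2 := by
  simp only [coefE2, listF2, evalL]
  push_cast
  ring

theorem coefE3_eq (k : ℝ) : coefE3 k = (2 * k - 1) * (3 * k - 4) * evalL k listF3 := by
  simp only [coefE3, listF3, evalL]
  push_cast
  ring

/-- The coefficients of `polyE` without its constant coefficient. -/
def listTailE : List (List ℤ) :=
  [[-416, 1752, -1252, -3568, 6426, -3508, 658, -60],
   [152, -918, 4323, -10926, 13422, -9030, 5095, -2790, 720],
   [16, -324, 1738, -2304, -4302, 14272, -14140, 6012, -936],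
   [0, -240, 1988, -6328, 9993, -8446, 3827, -858, 72]]

/-- The coefficients of `polyE`. -/
def listE : List (List ℤ) := [72, -774, 2959, -5322, 4773, -2000, 300] :: listTailE

/-- The coefficients of `2 y p' - b p`, for a polynomial `p` in the outer variable `y`. -/
def slopeLL : ℤ → List (List ℤ) → List (List ℤ)
  | _, [] => []
  | b, q :: p => smulL (-b) q :: slopeLL (b - 2) p

theorem evalLL_listTailE (k s : ℝ) : evalLL k s listTailE =
    coefE1 k + coefE2 k * s + coefE3 k * s ^ 2 + coefE4 k * s ^ 3 := by
  simp only [listTailE, evalLL, evalL, coefE1, coefE2, coefE3, coefE4]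
  push_cast
  ring

theorem polyE_eq_tail (k s : ℝ) : polyE k s = coefE0 k + s * evalLL k s listTailE := by
  rw [evalLL_listTailE, polyE]
  ring

theorem evalLL_listE (k s : ℝ) : evalLL k s listE = polyE k s := by
  rw [polyE_eq_tail]
  simp only [listE, evalLL, evalL, coefE0]
  push_cast
  ring

theorem evalLL_slope_five (k s : ℝ) :
    evalLL k s (slopeLL 5 listE) = 2 * s * polyE' k s - 5 * polyE k s := by
  simp only [listE, listTailE, slopeLL, smulL, evalLL, evalL, polyE, polyE', coefE0, coefE1,
    coefE2, coefE3, coefE4]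
  push_cast
  ring

/-- Degree j of the tail is degree j + 1 of E, so b = -2 produces the weights 2(j + 1). -/
theorem evalLL_slope_tail (k s : ℝ) :
    evalLL k s (slopeLL (-2) listTailE) = 2 * polyE' k s := by
  simp only [listTailE, slopeLL, smulL, evalLL, evalL, polyE', coefE1, coefE2, coefE3, coefE4]
  push_cast
  ring

/-! ### Signs of the Wronskian factor -/

theorem coefA_neg {k : ℝ} (h0 : 0 < k) (h1 : k ≤ 4 / 5) : coefA k < 0 := by
  have h := evalL_neg (x := k) (hasCoord_Ioc (l := 0) (h := 4) (q := 5) (by norm_num)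
    (by push_cast; linarith) (by push_cast; linarith)) [] listA (by decide +kernel)
  rw [coefA_eq]
  linarith

theorem coefB_neg {k : ℝ} (h0 : 0 < k) (h1 : k ≤ 4 / 5) : coefB k < 0 := by
  have h := evalL_neg (x := k) (hasCoord_Ioc (l := 0) (h := 4) (q := 5) (by norm_num)
    (by push_cast; linarith) (by push_cast; linarith)) [] listB (by decide +kernel)
  rw [coefB_eq]
  linarith

theorem coefA_pos {k : ℝ} (h0 : 4 / 3 < k) (h1 : k ≤ 5) : 0 < coefA k := by
  have h := evalL_pos (x := k) (hasCoord_Ioc (l := 4) (h := 15) (q := 3) (by norm_num)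
    (by push_cast; linarith) (by push_cast; linarith)) [] listA (by decide +kernel)
  rw [coefA_eq]
  linarith

theorem coefB_pos {k : ℝ} (h0 : 4 / 3 < k) (h1 : k ≤ 5) : 0 < coefB k := by
  have h := evalL_pos (x := k) (hasCoord_Ioc (l := 4) (h := 15) (q := 3) (by norm_num)
    (by push_cast; linarith) (by push_cast; linarith)) [] listB (by decide +kernel)
  rw [coefB_eq]
  linarith

theorem remainderNeZero_of_le {k : ℝ} (h0 : 0 < k) (h1 : k ≤ 4 / 5) : RemainderNeZero k :=
  fun s hs _ => by nlinarith [coefA_neg h0 h1, coefB_neg h0 h1]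

theorem remainderNeZero_of_gt {k : ℝ} (h0 : 4 / 3 < k) (h1 : k ≤ 5) : RemainderNeZero k :=
  fun s hs _ => by nlinarith [coefA_pos h0 h1, coefB_pos h0 h1]

/-! #### Near the root of `q2` between `1 / 5` and `1 / 3` -/

/-- The constant coefficient vanishes at k = 1/5, where the checker demands strict positivity. Its
sign is read off its factorization and only the tail is certified; likewise at 3/2. -/
theorem polyE_neg_of_fifth {k s : ℝ} (h0 : 1 / 5 < k) (h1 : k < 221 / 1000) (hs : 0 ≤ s) :
    polyE k s < 0 := by
  have h := evalLL_neg (x := k) (y := s) (hasCoord_Ico (l := 200) (h := 221) (q := 1000)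
    (by norm_num) (by push_cast; linarith) (by push_cast; linarith))
    (hasCoord_Ici (l := 0) (q := 1) (by norm_num) (by push_cast; linarith))
    [false, true, false, true, false, true] listTailE (by decide +kernel)
  have h2 : coefE0 k < 0 := by
    have h := mul_pos (mul_pos (mul_pos (mul_pos (mul_pos (show (0 : ℝ) < 1 - 2 * k by linarith)
      (show (0 : ℝ) < 5 * k - 1 by linarith))
      (show (0 : ℝ) < 2 - 3 * k by linarith))
      (show (0 : ℝ) < 3 - k by linarith))
      (show (0 : ℝ) < 3 - 2 * k by linarith))
      (show (0 : ℝ) < 4 - 5 * k by linarith)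
    rw [coefE0]
    linear_combination h
  rw [polyE_eq_tail]
  nlinarith

theorem polyE_neg_near_fifth {k s : ℝ} (h0 : 22 / 100 ≤ k) (h1 : k < 23 / 100)
    (hs : s ∈ Ico 0 (3 / 2) ∪ Ici 4) : polyE k s < 0 := by
  rw [← evalLL_listE]
  rcases hs with hs | hs
  · exact evalLL_neg (hasCoord_Ico (l := 22) (h := 23) (q := 100) (by norm_num)
      (by push_cast; linarith) (by push_cast; linarith))
      (hasCoord_Ico (l := 0) (h := 3) (q := 2) (by norm_num)
      (by push_cast; linarith [hs.1]) (by push_cast; linarith [hs.2])) [] _ (by decide +kernel)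
  · rw [mem_Ici] at hs
    exact evalLL_neg (hasCoord_Ico (l := 22) (h := 23) (q := 100) (by norm_num)
      (by push_cast; linarith) (by push_cast; linarith))
      (hasCoord_Ici (l := 4) (q := 1) (by norm_num) (by push_cast; linarith)) [] _
      (by decide +kernel)

/-- Near `1 / 5`, the Wronskian factor keeps its sign as long as `q2` does. -/
theorem polyE_neg_propagate_fifth {W : Set ℝ} (hW : IsPreconnected W)
    (hW' : ∀ κ ∈ W, 22 / 100 ≤ κ ∧ κ < 23 / 100) (hq : ∀ κ ∈ W, q2 κ ≠ 0) {k₀ k : ℝ} (hk₀ : k₀ ∈ W)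
    (hk : k ∈ W) (h : ∀ s > 0, polyE k₀ s < 0) {s : ℝ} (hs : 0 ≤ s) : polyE k s < 0 := by
  have hn : ∀ κ ∈ W, ∀ s ∈ Ico (0 : ℝ) (3 / 2) ∪ Ici 4, polyE κ s < 0 := fun κ hκ s hs =>
    polyE_neg_near_fifth (hW' κ hκ).1 (hW' κ hκ).2 hs
  rcases lt_or_ge s (3 / 2) with h1 | h1
  · exact hn k hk s (Or.inl ⟨hs, h1⟩)
  rcases lt_or_ge 4 s with h2 | h2
  · exact hn k hk s (Or.inr h2.le)
  -- The ends 1 and 4 lie in the region of certified negativity, so a zero could only enter as a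
  -- double zero inside.
  refine neg_of_no_double_zero continuous_uncurry_polyE hasDerivAt_polyE hW
    (show (1 : ℝ) ≤ 4 by norm_num) (fun κ hκ => hn κ hκ 1 (Or.inl ⟨by norm_num, by norm_num⟩))
    (fun κ hκ => hn κ hκ 4 (Or.inr self_mem_Ici)) (fun κ hκ s _ h0 => ?_) hk₀
    (fun s hs => h s (by linarith [hs.1])) hk s ⟨by linarith, h2⟩
  have h1 := (hW' κ hκ).1
  have h2 := (hW' κ hκ).2
  exact polyE'_ne_zero (by linarith) (by linarith) (by linarith) (by linarith) (by linarith)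
    (by linarith) (by linarith) (hq κ hκ) h0

/-- Certificates reach 221/1000; from the seed 22/100 negativity propagates up to k₂, because q₂ has
no earlier root. -/
theorem polyE_neg_of_lt_root_fifth {k₂ k s : ℝ} (hk₂ : IsTheRootIn q2 (1 / 5) (1 / 3) k₂)
    (h2 : k₂ < 23 / 100) (h0 : 1 / 5 < k) (h1 : k < k₂) (hs : 0 ≤ s) : polyE k s < 0 := by
  rcases lt_or_ge k (221 / 1000) with h3 | h3
  · exact polyE_neg_of_fifth h0 h3 hs
  refine polyE_neg_propagate_fifth (W := Ico (22 / 100) k₂) isPreconnected_Ico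
    (fun κ hκ => ⟨hκ.1, hκ.2.trans h2⟩) (fun κ hκ hq => ?_) (k₀ := 22 / 100) (k := k)
    ⟨le_rfl, by linarith⟩ ⟨by linarith, h1⟩
    (fun s hs => polyE_neg_of_fifth (by norm_num) (by norm_num) hs.le) hs
  exact hκ.2.ne (hk₂.eq (by linarith [hκ.1]) (by linarith [hκ.2]) hq)

theorem polyE_at_pos_fifth {k : ℝ} (h0 : 229 / 1000 ≤ k) (h1 : k < 1 / 3) :
    0 < polyE k (12 / 5) := by
  have h := evalL_pos (x := k) (hasCoord_Ico (l := 687) (h := 1000) (q := 3000) (by norm_num)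
    (by push_cast; linarith) (by push_cast; linarith)) []
    ([106440, -8936550, 71773663, -199135818, 230986893, -90846176, -23296428, 24018192, -4002048]) (by decide +kernel)
  simp only [evalL] at h
  push_cast at h
  simp only [polyE, coefE0, coefE1, coefE2, coefE3, coefE4]
  linear_combination h / 625

/-- If E were negative just above k₂, the sign would propagate to k = 2295/10000, where E is
certified positive at s = 12/5. -/
theorem exists_polyE_root_of_gt_fifth {k₂ k : ℝ} (hk₂ : IsTheRootIn q2 (1 / 5) (1 / 3) k₂)
    (h2 : 22 / 100 < k₂) (h0 : k₂ < k) (h1 : k < 1 / 3) :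
    ∃ s > 0, polyE k s = 0 := by
  have hE0 : coefE0 k < 0 := by
    have h := mul_pos (mul_pos (mul_pos (mul_pos (mul_pos (show (0 : ℝ) < 1 - 2 * k by linarith)
      (show (0 : ℝ) < 5 * k - 1 by linarith))
      (show (0 : ℝ) < 2 - 3 * k by linarith))
      (show (0 : ℝ) < 3 - k by linarith))
      (show (0 : ℝ) < 3 - 2 * k by linarith))
      (show (0 : ℝ) < 4 - 5 * k by linarith)
    rw [coefE0]
    linear_combination h
  suffices h : ∃ s > 0, 0 ≤ polyE k s by
    obtain ⟨s, hs, h⟩ := h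
    rcases h.eq_or_lt with h | h
    · exact ⟨s, hs, h.symm⟩
    · exact exists_polyE_root_of_sign (ε := 1) (by linarith) hs (by linarith)
  rcases lt_or_ge k (2295 / 10000) with h3 | h3
  · by_contra! h
    have h4 := polyE_neg_propagate_fifth (W := Ioo k₂ (23 / 100)) isPreconnected_Ioo
      (fun κ hκ => ⟨by linarith [hκ.1], hκ.2⟩) (fun κ hκ hq => ?_) (k₀ := k)
      (k := 2295 / 10000) ⟨h0, by linarith⟩ ⟨by linarith, by norm_num⟩ h
      (s := 12 / 5) (by norm_num)
    · exact lt_asymm h4 (polyE_at_pos_fifth (by norm_num) (by norm_num))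
    · exact hκ.1.ne' (hk₂.eq (by linarith [hκ.1]) (by linarith [hκ.2]) hq)
  · exact ⟨12 / 5, by norm_num, (polyE_at_pos_fifth (by linarith) h1).le⟩

/-! #### Near the root of `q2` between `3 / 2` and `2` -/

theorem polyE_neg_of_three_half {k s : ℝ} (h0 : 3 / 2 < k) (h1 : k < 1761 / 1000) (hs : 0 ≤ s) :
    polyE k s < 0 := by
  have h := evalLL_neg (x := k) (y := s) (hasCoord_Ico (l := 1500) (h := 1761) (q := 1000)
    (by norm_num) (by push_cast; linarith) (by push_cast; linarith))
    (hasCoord_Ici (l := 0) (q := 1) (by norm_num) (by push_cast; linarith))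
    [false, true, false, true, false, true, false, true, false, true] listTailE (by decide +kernel)
  have h2 : coefE0 k < 0 := by
    have h := mul_pos (mul_pos (mul_pos (mul_pos (mul_pos (show (0 : ℝ) < 2 * k - 1 by linarith)
      (show (0 : ℝ) < 5 * k - 1 by linarith))
      (show (0 : ℝ) < 3 * k - 2 by linarith))
      (show (0 : ℝ) < 3 - k by linarith))
      (show (0 : ℝ) < 2 * k - 3 by linarith))
      (show (0 : ℝ) < 5 * k - 4 by linarith)
    rw [coefE0]
    linear_combination h
  rw [polyE_eq_tail]
  nlinarith

theorem polyE_neg_near_three_half {k s : ℝ} (h0 : 176 / 100 ≤ k) (h1 : k < 178 / 100)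
    (hs : s ∈ Ico 0 2 ∪ Ici 10) : polyE k s < 0 := by
  rw [← evalLL_listE]
  rcases hs with hs | hs
  · exact evalLL_neg (hasCoord_Ico (l := 88) (h := 89) (q := 50) (by norm_num)
      (by push_cast; linarith) (by push_cast; linarith))
      (hasCoord_Ico (l := 0) (h := 2) (q := 1) (by norm_num)
      (by push_cast; linarith [hs.1]) (by push_cast; linarith [hs.2])) [] _ (by decide +kernel)
  · rw [mem_Ici] at hs
    exact evalLL_neg (hasCoord_Ico (l := 88) (h := 89) (q := 50) (by norm_num)
      (by push_cast; linarith) (by push_cast; linarith))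
      (hasCoord_Ici (l := 10) (q := 1) (by norm_num) (by push_cast; linarith)) [] _
      (by decide +kernel)

/-- Near `7 / 4`, the Wronskian factor keeps its sign as long as `q2` does. -/
theorem polyE_neg_propagate_three_half {W : Set ℝ} (hW : IsPreconnected W)
    (hW' : ∀ κ ∈ W, 176 / 100 ≤ κ ∧ κ < 178 / 100) (hq : ∀ κ ∈ W, q2 κ ≠ 0) {k₀ k : ℝ}
    (hk₀ : k₀ ∈ W) (hk : k ∈ W) (h : ∀ s > 0, polyE k₀ s < 0) {s : ℝ} (hs : 0 ≤ s) :
    polyE k s < 0 := by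
  have hn : ∀ κ ∈ W, ∀ s ∈ Ico (0 : ℝ) 2 ∪ Ici 10, polyE κ s < 0 := fun κ hκ s hs =>
    polyE_neg_near_three_half (hW' κ hκ).1 (hW' κ hκ).2 hs
  rcases lt_or_ge s 2 with h1 | h1
  · exact hn k hk s (Or.inl ⟨hs, h1⟩)
  rcases lt_or_ge 10 s with h2 | h2
  · exact hn k hk s (Or.inr h2.le)
  refine neg_of_no_double_zero continuous_uncurry_polyE hasDerivAt_polyE hW
    (show (1 : ℝ) ≤ 10 by norm_num) (fun κ hκ => hn κ hκ 1 (Or.inl ⟨by norm_num, by norm_num⟩))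
    (fun κ hκ => hn κ hκ 10 (Or.inr self_mem_Ici)) (fun κ hκ s _ h0 => ?_) hk₀
    (fun s hs => h s (by linarith [hs.1])) hk s ⟨by linarith, h2⟩
  have h1 := (hW' κ hκ).1
  have h2 := (hW' κ hκ).2
  exact polyE'_ne_zero (by linarith) (by linarith) (by linarith) (by linarith) (by linarith)
    (by linarith) (by linarith) (hq κ hκ) h0

theorem polyE_neg_of_lt_root_three_half {k₃ k s : ℝ} (hk₃ : IsTheRootIn q2 (3 / 2) 2 k₃)
    (h2 : k₃ < 178 / 100) (h0 : 3 / 2 < k) (h1 : k < k₃) (hs : 0 ≤ s) : polyE k s < 0 := by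
  rcases lt_or_ge k (1761 / 1000) with h3 | h3
  · exact polyE_neg_of_three_half h0 h3 hs
  refine polyE_neg_propagate_three_half (W := Ico (176 / 100) k₃) isPreconnected_Ico
    (fun κ hκ => ⟨hκ.1, hκ.2.trans h2⟩) (fun κ hκ hq => ?_) (k₀ := 176 / 100) (k := k)
    ⟨le_rfl, by linarith⟩ ⟨by linarith, h1⟩
    (fun s hs => polyE_neg_of_three_half (by norm_num) (by norm_num) hs.le) hs
  exact hκ.2.ne (hk₃.eq (by linarith [hκ.1]) (by linarith [hκ.2]) hq)

theorem polyE_at_pos_three_half {k : ℝ} (h0 : 1779 / 1000 ≤ k) (h1 : k < 3) :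
    0 < polyE k 3 := by
  have h := evalL_pos (x := k) (hasCoord_Ico (l := 1779) (h := 3000) (q := 1000) (by norm_num)
    (by push_cast; linarith) (by push_cast; linarith)) []
    ([624, -31968, 246064, -689136, 838128, -392576, -23664, 67536, -12960]) (by decide +kernel)
  simp only [evalL] at h
  push_cast at h
  simp only [polyE, coefE0, coefE1, coefE2, coefE3, coefE4]
  linear_combination h

/-- As above k₂: negativity just above k₃ would propagate to k = 1779/1000, against E > 0 at s = 3.
-/
theorem exists_polyE_root_of_gt_three_half {k₃ k : ℝ} (hk₃ : IsTheRootIn q2 (3 / 2) 2 k₃)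
    (h2 : 176 / 100 < k₃) (h0 : k₃ < k) (h1 : k < 3) :
    ∃ s > 0, polyE k s = 0 := by
  have hE0 : coefE0 k < 0 := by
    have h := mul_pos (mul_pos (mul_pos (mul_pos (mul_pos (show (0 : ℝ) < 2 * k - 1 by linarith)
      (show (0 : ℝ) < 5 * k - 1 by linarith))
      (show (0 : ℝ) < 3 * k - 2 by linarith))
      (show (0 : ℝ) < 3 - k by linarith))
      (show (0 : ℝ) < 2 * k - 3 by linarith))
      (show (0 : ℝ) < 5 * k - 4 by linarith)
    rw [coefE0]
    linear_combination h
  suffices h : ∃ s > 0, 0 ≤ polyE k s by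
    obtain ⟨s, hs, h⟩ := h
    rcases h.eq_or_lt with h | h
    · exact ⟨s, hs, h.symm⟩
    · exact exists_polyE_root_of_sign (ε := 1) (by linarith) hs (by linarith)
  rcases lt_or_ge k (1779 / 1000) with h3 | h3
  · by_contra! h
    have h4 := polyE_neg_propagate_three_half (W := Ioo k₃ (178 / 100)) isPreconnected_Ioo
      (fun κ hκ => ⟨by linarith [hκ.1], hκ.2⟩) (fun κ hκ hq => ?_) (k₀ := k)
      (k := 1779 / 1000) ⟨h0, by linarith⟩ ⟨by linarith, by norm_num⟩ h
      (s := 3) (by norm_num)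
    · exact lt_asymm h4 (polyE_at_pos_three_half (by norm_num) (by norm_num))
    · exact hκ.1.ne' (hk₃.eq (by linarith [hκ.1]) (by linarith [hκ.2]) hq)
  · exact ⟨3, by norm_num, (polyE_at_pos_three_half (by linarith) h1).le⟩

/-! #### Beyond the root of `q2` between `3` and `4` -/

theorem polyE_pos_of_three {k s : ℝ} (h0 : 315 / 100 < k) (h1 : k ≤ 5) (hs : s ∈ Ico 0 (1 / 5)) :
    0 < polyE k s := by
  rw [← evalLL_listE]
  exact evalLL_pos (hasCoord_Ioc (l := 63) (h := 100) (q := 20) (by norm_num)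
    (by push_cast; linarith) (by push_cast; linarith))
    (hasCoord_Ico (l := 0) (h := 1) (q := 5) (by norm_num)
      (by push_cast; linarith [hs.1]) (by push_cast; linarith [hs.2])) [false, true] _
    (by decide +kernel)

theorem polyE_at_pos_three {k : ℝ} (h0 : 31 / 10 < k) (h1 : k ≤ 32 / 10) :
    0 < polyE k (1 / 5) := by
  have h := evalL_pos (x := k) (hasCoord_Ioc (l := 31) (h := 32) (q := 10) (by norm_num)
    (by push_cast; linarith) (by push_cast; linarith)) []
    ([-3120, -289560, 1811628, -4063248, 4110408, -1851336, 330252, -48048, 13392]) (by decide +kernel)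
  simp only [evalL] at h
  push_cast at h
  simp only [polyE, coefE0, coefE1, coefE2, coefE3, coefE4]
  linear_combination h / 625

/-- Positivity is certified for k > 315/100 and transported down to k₅ by applying the propagation
to -E, with seed 316/100. -/
theorem polyE_pos_of_gt_root_three {k₅ k s : ℝ} (hk₅ : IsTheRootIn q2 3 4 k₅)
    (h2 : 31 / 10 < k₅) (h0 : k₅ < k) (h1 : k ≤ 5)
    (hs : s ∈ Ico 0 (1 / 5)) : 0 < polyE k s := by
  rcases lt_or_ge (315 / 100) k with h3 | h3
  · exact polyE_pos_of_three h3 h1 hs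
  have h4 : ∀ s ∈ Icc (0 : ℝ) (1 / 5), -polyE k s < 0 := by
    refine neg_of_no_double_zero (F := fun κ s => -polyE κ s) (F' := fun κ s => -polyE' κ s)
      (W := Ioc k₅ (32 / 10)) (k₀ := 316 / 100) continuous_uncurry_polyE.neg
      (fun κ s => (hasDerivAt_polyE κ s).neg) isPreconnected_Ioc (by norm_num) (fun k hκ => ?_)
      (fun κ hκ => neg_lt_zero.2 (polyE_at_pos_three (h2.trans hκ.1) hκ.2))
      (fun κ hκ s _ h0 => ?_) ⟨by linarith, by norm_num⟩ (fun s hs => ?_) ⟨h0, by linarith⟩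
    · have hk1 := hκ.1
      have hk2 := hκ.2
      have h5 : 0 < coefE0 k := by
        have h := mul_pos (mul_pos (mul_pos (mul_pos (mul_pos (show (0 : ℝ) < 2 * k - 1 by linarith)
          (show (0 : ℝ) < 5 * k - 1 by linarith))
          (show (0 : ℝ) < 3 * k - 2 by linarith))
          (show (0 : ℝ) < k - 3 by linarith))
          (show (0 : ℝ) < 2 * k - 3 by linarith))
          (show (0 : ℝ) < 5 * k - 4 by linarith)
        rw [coefE0]
        linear_combination h
      simpa [polyE] using h5
    · have h1 := hκ.1
      have h6 := hκ.2
      refine neg_ne_zero.2 (polyE'_ne_zero (by linarith) (by linarith) (by linarith) (by linarith)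
        (by linarith) (by linarith) (by linarith) (fun hq => ?_) (neg_eq_zero.1 h0))
      exact h1.ne' (hk₅.eq (by linarith) (by linarith) hq)
    · rw [neg_lt_zero]
      rcases hs.2.eq_or_lt with h5 | h5
      · rw [h5]
        exact polyE_at_pos_three (by norm_num) (by norm_num)
      · exact polyE_pos_of_three (by norm_num) (by norm_num) ⟨hs.1, h5⟩
  exact neg_lt_zero.1 (h4 s ⟨hs.1, hs.2.le⟩)

/-- This says that t⁻⁵ E(t²) decreases, which leaves at most one zero in this range although the
coefficients of E allow three. -/
theorem slope_neg_of_three {k s : ℝ} (h0 : 31 / 10 < k) (h1 : k ≤ 5) (hs : 19 / 100 ≤ s) :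
    2 * s * polyE' k s - 5 * polyE k s < 0 := by
  rw [← evalLL_slope_five]
  exact evalLL_neg (hasCoord_Ioc (l := 31) (h := 50) (q := 10) (by norm_num)
    (by push_cast; linarith) (by push_cast; linarith))
    (hasCoord_Ici (l := 19) (q := 100) (by norm_num) (by push_cast; linarith)) [] _
    (by decide +kernel)

/-! #### Below `1 / 5` -/

theorem polyE'_neg_of_lt_fifth {k s : ℝ} (h0 : 17 / 100 ≤ k) (h1 : k < 1 / 5)
    (hs : s ∈ Ico 0 (1 / 2)) : polyE' k s < 0 := by
  have h := evalLL_neg (x := k) (y := s) (hasCoord_Ico (l := 17) (h := 20) (q := 100) (by norm_num)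
    (by push_cast; linarith) (by push_cast; linarith))
    (hasCoord_Ico (l := 0) (h := 1) (q := 2) (by norm_num)
      (by push_cast; linarith [hs.1]) (by push_cast; linarith [hs.2])) []
    (slopeLL (-2) listTailE) (by decide +kernel)
  rw [evalLL_slope_tail] at h
  linarith

theorem polyE_neg_of_lt_fifth {k s : ℝ} (h0 : 17 / 100 ≤ k) (h1 : k < 1 / 5) (hs : 1 / 2 ≤ s) :
    polyE k s < 0 := by
  rw [← evalLL_listE]
  exact evalLL_neg (hasCoord_Ico (l := 17) (h := 20) (q := 100) (by norm_num)
    (by push_cast; linarith) (by push_cast; linarith))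
    (hasCoord_Ici (l := 1) (q := 2) (by norm_num) (by push_cast; linarith))
    [false, true, false, true] _ (by decide +kernel)

/-! ### The zero counts of the images, by range of the parameter -/

theorem coefQ0_eq (k : ℝ) : coefQ0 k = 3 * ((k - 3) * (2 * k - 3)) := by
  rw [coefQ0]
  ring

theorem coefQ1_eq (k : ℝ) : coefQ1 k = (1 - 2 * k) * (1 + k) ^ 2 := by
  rw [coefQ1]
  ring

theorem coefQ2_eq (k : ℝ) : coefQ2 k = 3 * (k * (4 * k - 3) * (2 * k - 1) * (3 * k - 1)) := by
  rw [coefQ2]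
  ring

/-- This is the origin of q₃: for k > 1/2 its positivity means that Q has no real root. -/
theorem disc_polyQ (k : ℝ) :
    coefQ1 k ^ 2 - 4 * coefQ0 k * coefQ2 k = -((2 * k - 1) * q3 k) := by
  rw [coefQ0, coefQ1, coefQ2, q3]
  ring

theorem polyQ_pos_of_q3 {k : ℝ} (hk : 1 / 2 < k) (h2 : 0 < coefQ2 k) (hq : 0 < q3 k) (s : ℝ) :
    0 < polyQ k s := by
  have h := disc_polyQ k
  have h1 : 0 < (2 * k - 1) * q3 k := mul_pos (by linarith) hq
  have : 0 < 4 * coefQ2 k * polyQ k s := by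
    rw [polyQ]
    nlinarith [sq_nonneg (2 * coefQ2 k * s + coefQ1 k)]
  exact pos_of_mul_pos_right this (by positivity)

theorem imageU_ne_of_pos {k : ℝ} (hQ : ∀ s > 0, 0 < polyQ k s) : ∀ t > 0, imageU k t ≠ 0 :=
  fun t ht => (hQ (t ^ 2) (by positivity)).ne'

theorem remainderNeZero_of_sign {k : ℝ} (hA : 0 < coefQ2 k * coefA k)
    (hB : 0 < coefQ2 k * coefB k) : RemainderNeZero k := fun s hs _ h => by
  have h1 : 0 < coefQ2 k * (coefA k + coefB k * s) := by nlinarith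
  simp [h] at h1

theorem imageZerosLE_one_of_neg {k : ℝ} (h : coefQ0 k * coefQ2 k < 0)
    (hA : 0 < coefQ2 k * coefA k) (hB : 0 < coefQ2 k * coefB k) (hE : ∀ s > 0, polyE k s < 0) :
    ImageZerosLE k 1 := by
  have h2 : coefQ2 k ≠ 0 := fun h2 => by simp [h2] at h
  obtain ⟨t₀, h0, -, -⟩ := exists_onlyZero h hA hB
  exact imageZerosLE_of_wronskE_neg (remainderNeZero_of_sign hA hB) h2
    (imageU_zerosLE_one h.le (Or.inr h2)) h0 fun t ht => hE _ (by positivity)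

/-- E is negative at the root of Q and, by `hf`, from there on. To the left Q is positive while A
and B are negative, so the splitting of V/U keeps that branch below π/2. -/
theorem imageZerosLE_two_of_falling {k : ℝ} (hA : coefA k < 0) (hB : coefB k < 0)
    (h0 : 0 < coefQ0 k) (h2 : coefQ2 k < 0) (hE : ZerosLE (wronskE k) (Ioi 0) 1)
    (hf : ∀ a > 0, ∀ b > a, polyE k a ≤ 0 → polyE k b < 0) : ImageZerosLE k 2 := by
  have h := mul_neg_of_pos_of_neg h0 h2
  have hA' := mul_pos_of_neg_of_neg h2 hA
  have hB' := mul_pos_of_neg_of_neg h2 hB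
  obtain ⟨t₀, hz, h3, h4⟩ := exists_onlyZero h hA' hB'
  refine imageZerosLE_of_left_lt (remainderNeZero_of_sign hA' hB') h2.ne
    (imageU_zerosLE_one h.le (Or.inr h2.ne)) hz hE (fun t ht => ?_) fun t ht => ?_
  · exact hf _ (pow_pos hz.pos 2) _ (pow_lt_pow_left₀ ht hz.pos.le two_ne_zero) h3.le
  · exact quotVU_lt_of_neg hA hB ht.1 (by nlinarith [h4 t ht])

theorem imageZerosLE_three_of_two {k : ℝ} (h : coefQ0 k * coefQ2 k < 0)
    (hA : 0 < coefQ2 k * coefA k) (hB : 0 < coefQ2 k * coefB k) (hE0 : coefE0 k < 0)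
    (hE4 : coefE4 k < 0) (hE : ZerosLE (wronskE k) (Ioi 0) 2) : ImageZerosLE k 3 := by
  have h2 : coefQ2 k ≠ 0 := fun h2 => by simp [h2] at h
  obtain ⟨t₀, h0, h3, -⟩ := exists_onlyZero h hA hB
  obtain ⟨M, hM, h4⟩ := polyE_pos_of_large (k := k) (ε := -1) (by linarith)
  refine imageZerosLE_three (M := max M 1) (remainderNeZero_of_sign hA hB) h2
    (imageU_zerosLE_one h.le (Or.inr h2)) h0 (by simpa [wronskE, polyE] using hE0) h3
    (fun t ht => ?_) hE
  have h5 : M ≤ t := (le_max_left _ _).trans ht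
  have h6 : 1 ≤ t := (le_max_right _ _).trans ht
  have := h4 (t ^ 2) (by nlinarith)
  rw [wronskE]
  linarith

theorem oneChange_of {k ε : ℝ} {m : ℕ} (hm : 0 < m) (h0 : ε * coefE0 k < 0)
    (hl : ∀ j < m, ε * coefE k j ≤ 0) (hr : ∀ j, m ≤ j → j < 5 → 0 ≤ ε * coefE k j) :
    OneChange k ε m := by
  refine ⟨hm, h0, hl, fun j hj => ?_⟩
  rcases lt_or_ge j 5 with h | h
  · exact hr j hj h
  · obtain ⟨i, rfl⟩ := Nat.exists_eq_add_of_le' h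
    simp [coefE]

theorem OneChange.falling {k : ℝ} {m : ℕ} (h : OneChange k (-1) m) :
    ∀ a > 0, ∀ b > a, polyE k a ≤ 0 → polyE k b < 0 := fun a ha b hb hE => by
  have := h.rising ha hb (by linarith)
  linarith

theorem hasDerivAt_wronskE (k t : ℝ) :
    HasDerivAt (wronskE k) (polyE' k (t ^ 2) * (2 * t)) t :=
  (hasDerivAt_polyE k (t ^ 2)).comp t (hasDerivAt_sq t)

/-- If an Euler operator does not vanish on the Wronskian factor, that has at most one zero. -/
theorem wronskE_zerosLE_of_slope {k p : ℝ} {I : Set ℝ} (hI : I.OrdConnected) (ho : IsOpen I)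
    (hpos : ∀ t ∈ I, 0 < t)
    (h : ∀ t ∈ I, 2 * t ^ 2 * polyE' k (t ^ 2) - p * polyE k (t ^ 2) ≠ 0) :
    ZerosLE (wronskE k) I 1 := by
  refine ZerosLE.of_eulerOp (a := 1) (b := -p) one_ne_zero hI hpos ho
    (fun t _ => analyticAt_wronskE k t) (ZerosLE.of_ne_zero fun t ht => ?_)
  rw [eulerOp_of_hasDerivAt _ _ (hasDerivAt_wronskE k t), wronskE]
  convert h t ht using 1
  ring

/-! #### Below `1 / 5` -/

theorem polyE_falling_of_lt_fifth {k : ℝ} (h0 : 17 / 100 ≤ k) (h1 : k < 1 / 5) :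
    ∀ a > 0, ∀ b > a, polyE k a ≤ 0 → polyE k b < 0 := by
  intro a ha b hab hE
  rcases le_or_gt (1 / 2) b with hb | hb
  · exact polyE_neg_of_lt_fifth h0 h1 hb
  have h := strictAntiOn_of_deriv_neg (convex_Icc a b) (continuous_polyE k).continuousOn
    fun s hs => by
      rw [interior_Icc] at hs
      rw [(hasDerivAt_polyE k s).deriv]
      exact polyE'_neg_of_lt_fifth h0 h1 ⟨(ha.trans hs.1).le, hs.2.trans hb⟩
  exact (h (left_mem_Icc.2 hab.le) (right_mem_Icc.2 hab.le) hab).trans_le hE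

theorem wronskE_zerosLE_of_lt_fifth {k : ℝ} (h0 : 17 / 100 ≤ k) (h1 : k < 1 / 5) :
    ZerosLE (wronskE k) (Ioi 0) 1 := by
  have hl : ZerosLE (wronskE k) (Ioo 0 (Real.sqrt (1 / 2))) 1 := by
    refine wronskE_zerosLE_of_slope (p := 0) ordConnected_Ioo isOpen_Ioo (fun t ht => ht.1)
      fun t ht => ?_
    have h2 := polyE'_neg_of_lt_fifth h0 h1 (s := t ^ 2)
      ⟨by positivity, (Real.lt_sqrt ht.1.le).1 ht.2⟩
    have h3 : 0 < t ^ 2 := pow_pos ht.1 2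
    nlinarith
  refine hl.union (n := 0) (J := Ici (Real.sqrt (1 / 2))) (ZerosLE.of_ne_zero fun t ht => ?_)
    fun t ht => ?_
  · exact (polyE_neg_of_lt_fifth h0 h1 (Real.sqrt_le_iff.1 ht).2).ne
  · rcases lt_or_ge t (Real.sqrt (1 / 2)) with h | h
    · exact Or.inl ⟨ht, h⟩
    · exact Or.inr h

theorem imageZerosLE_of_lt_fifth {k : ℝ} (h0 : 17 / 100 ≤ k) (h1 : k < 1 / 5) :
    ImageZerosLE k 2 := by
  have c0 : 0 < coefQ0 k := by
    have h := mul_pos (show (0 : ℝ) < 3 - k by linarith)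
      (show (0 : ℝ) < 3 - 2 * k by linarith)
    rw [coefQ0_eq]
    linear_combination 3 * h
  have c2 : coefQ2 k < 0 := by
    have h := mul_pos (mul_pos (mul_pos (show (0 : ℝ) < k by linarith)
      (show (0 : ℝ) < 3 - 4 * k by linarith))
      (show (0 : ℝ) < 1 - 2 * k by linarith))
      (show (0 : ℝ) < 1 - 3 * k by linarith)
    rw [coefQ2_eq]
    linear_combination 3 * h
  exact imageZerosLE_two_of_falling (coefA_neg (by linarith) (by linarith))
    (coefB_neg (by linarith) (by linarith)) c0 c2 (wronskE_zerosLE_of_lt_fifth h0 h1)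
    (polyE_falling_of_lt_fifth h0 h1)

theorem exists_polyE_root_of_lt_fifth {k : ℝ} (h0 : 17 / 100 ≤ k) (h1 : k < 1 / 5) :
    ∃ s > 0, polyE k s = 0 := by
  have e0 : 0 < coefE0 k := by
    have h := mul_pos (mul_pos (mul_pos (mul_pos (mul_pos (show (0 : ℝ) < 1 - 2 * k by linarith)
      (show (0 : ℝ) < 1 - 5 * k by linarith))
      (show (0 : ℝ) < 2 - 3 * k by linarith))
      (show (0 : ℝ) < 3 - k by linarith))
      (show (0 : ℝ) < 3 - 2 * k by linarith))
      (show (0 : ℝ) < 4 - 5 * k by linarith)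
    rw [coefE0]
    linear_combination h
  have e4 : coefE4 k < 0 := by
    have h := mul_pos (mul_pos (mul_pos (mul_pos (mul_pos (mul_pos (mul_pos
      (show (0 : ℝ) < k by linarith)
      (show (0 : ℝ) < 1 - 2 * k by linarith))
      (show (0 : ℝ) < 1 - 3 * k by linarith))
      (show (0 : ℝ) < 2 - k by linarith))
      (show (0 : ℝ) < 2 - k by linarith))
      (show (0 : ℝ) < 3 - 4 * k by linarith))
      (show (0 : ℝ) < 4 - 3 * k by linarith))
      (show (0 : ℝ) < 5 - k by linarith)
    rw [coefE4]
    linear_combination h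
  exact exists_polyE_root (ε := -1) (by linarith) (by linarith)

/-! #### From `1 / 5` to `1 / 3` -/

theorem imageZerosLE_of_lt_root_fifth {k₂ k : ℝ} (hk₂ : IsTheRootIn q2 (1 / 5) (1 / 3) k₂)
    (h2 : k₂ < 23 / 100) (h0 : 1 / 5 < k) (h1 : k < k₂) : ImageZerosLE k 1 := by
  have c0 : 0 < coefQ0 k := by
    have h := mul_pos (show (0 : ℝ) < 3 - k by linarith)
      (show (0 : ℝ) < 3 - 2 * k by linarith)
    rw [coefQ0_eq]
    linear_combination 3 * h
  have c2 : coefQ2 k < 0 := by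
    have h := mul_pos (mul_pos (mul_pos (show (0 : ℝ) < k by linarith)
      (show (0 : ℝ) < 3 - 4 * k by linarith))
      (show (0 : ℝ) < 1 - 2 * k by linarith))
      (show (0 : ℝ) < 1 - 3 * k by linarith)
    rw [coefQ2_eq]
    linear_combination 3 * h
  exact imageZerosLE_one_of_neg (mul_neg_of_pos_of_neg c0 c2)
    (mul_pos_of_neg_of_neg c2 (coefA_neg (by linarith) (by linarith)))
    (mul_pos_of_neg_of_neg c2 (coefB_neg (by linarith) (by linarith)))
    fun s hs => polyE_neg_of_lt_root_fifth hk₂ h2 h0 h1 hs.le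

theorem imageZerosLE_of_lt_third {k : ℝ} (h0 : 22 / 100 < k) (h1 : k < 1 / 3) :
    ImageZerosLE k 3 := by
  have c0 : 0 < coefQ0 k := by
    have h := mul_pos (show (0 : ℝ) < 3 - k by linarith)
      (show (0 : ℝ) < 3 - 2 * k by linarith)
    rw [coefQ0_eq]
    linear_combination 3 * h
  have c2 : coefQ2 k < 0 := by
    have h := mul_pos (mul_pos (mul_pos (show (0 : ℝ) < k by linarith)
      (show (0 : ℝ) < 3 - 4 * k by linarith))
      (show (0 : ℝ) < 1 - 2 * k by linarith))
      (show (0 : ℝ) < 1 - 3 * k by linarith)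
    rw [coefQ2_eq]
    linear_combination 3 * h
  have f1 : evalL k listF1 < 0 :=
    evalL_neg (hasCoord_Ico (l := 33) (h := 50) (q := 150) (by norm_num)
      (by push_cast; linarith) (by push_cast; linarith)) [] _
    (by decide +kernel)
  have f2 : evalL k listF2 < 0 :=
    evalL_neg (hasCoord_Ico (l := 33) (h := 50) (q := 150) (by norm_num)
      (by push_cast; linarith) (by push_cast; linarith)) [] _
    (by decide +kernel)
  have f3 : 0 < evalL k listF3 :=
    evalL_pos (hasCoord_Ico (l := 33) (h := 50) (q := 150) (by norm_num)
      (by push_cast; linarith) (by push_cast; linarith)) [] _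
    (by decide +kernel)
  have e0 : coefE0 k < 0 := by
    have h := mul_pos (mul_pos (mul_pos (mul_pos (mul_pos (show (0 : ℝ) < 1 - 2 * k by linarith)
      (show (0 : ℝ) < 5 * k - 1 by linarith))
      (show (0 : ℝ) < 2 - 3 * k by linarith))
      (show (0 : ℝ) < 3 - k by linarith))
      (show (0 : ℝ) < 3 - 2 * k by linarith))
      (show (0 : ℝ) < 4 - 5 * k by linarith)
    rw [coefE0]
    linear_combination h
  have e1 : coefE1 k < 0 := by
    have h := mul_pos (mul_pos (show (0 : ℝ) < 2 - 3 * k by linarith)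
      (show (0 : ℝ) < 4 - 5 * k by linarith))
      (neg_pos.2 f1)
    rw [coefE1_eq]
    linear_combination h
  have e2 : 0 < coefE2 k := by
    have h := mul_pos (show (0 : ℝ) < 4 - 3 * k by linarith)
      (neg_pos.2 f2)
    rw [coefE2_eq]
    linear_combination h
  have e3 : 0 < coefE3 k := by
    have h := mul_pos (mul_pos (show (0 : ℝ) < 1 - 2 * k by linarith)
      (show (0 : ℝ) < 4 - 3 * k by linarith))
      f3
    rw [coefE3_eq]
    linear_combination h
  have e4 : coefE4 k < 0 := by
    have h := mul_pos (mul_pos (mul_pos (mul_pos (mul_pos (mul_pos (mul_pos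
      (show (0 : ℝ) < k by linarith)
      (show (0 : ℝ) < 1 - 2 * k by linarith))
      (show (0 : ℝ) < 1 - 3 * k by linarith))
      (show (0 : ℝ) < 2 - k by linarith))
      (show (0 : ℝ) < 2 - k by linarith))
      (show (0 : ℝ) < 3 - 4 * k by linarith))
      (show (0 : ℝ) < 4 - 3 * k by linarith))
      (show (0 : ℝ) < 5 - k by linarith)
    rw [coefE4]
    linear_combination h
  refine imageZerosLE_three_of_two (mul_neg_of_pos_of_neg c0 c2)
    (mul_pos_of_neg_of_neg c2 (coefA_neg (by linarith) (by linarith)))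
    (mul_pos_of_neg_of_neg c2 (coefB_neg (by linarith) (by linarith))) e0 e4
    -- The coefficients of E have signs -, -, +, +, -; the changes lie between exponents 2 and 4 and
    -- between 6 and 8.
    (wronskE_zerosLE_coef (-1) [3, 7] ?_ ?_ ?_ ?_ ?_ ?_) <;> norm_num <;> linarith

/-! #### From `1 / 3` to `1 / 2` -/

theorem wronskE_zerosLE_of_lt_half {k : ℝ} (h0 : 1 / 3 < k) (h1 : k < 1 / 2) :
    ZerosLE (wronskE k) (Ioi 0) 1 := by
  have f2 : evalL k listF2 < 0 := evalL_neg (hasCoord_Ico (l := 2) (h := 3) (q := 6) (by norm_num)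
      (by push_cast; linarith) (by push_cast; linarith)) [] _
    (by decide +kernel)
  have f3 : 0 < evalL k listF3 := evalL_pos (hasCoord_Ico (l := 2) (h := 3) (q := 6) (by norm_num)
      (by push_cast; linarith) (by push_cast; linarith)) [] _
    (by decide +kernel)
  have e0 : coefE0 k < 0 := by
    have h := mul_pos (mul_pos (mul_pos (mul_pos (mul_pos (show (0 : ℝ) < 1 - 2 * k by linarith)
      (show (0 : ℝ) < 5 * k - 1 by linarith))
      (show (0 : ℝ) < 2 - 3 * k by linarith))
      (show (0 : ℝ) < 3 - k by linarith))
      (show (0 : ℝ) < 3 - 2 * k by linarith))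
      (show (0 : ℝ) < 4 - 5 * k by linarith)
    rw [coefE0]
    linear_combination h
  have e2 : 0 < coefE2 k := by
    have h := mul_pos (show (0 : ℝ) < 4 - 3 * k by linarith)
      (neg_pos.2 f2)
    rw [coefE2_eq]
    linear_combination h
  have e3 : 0 < coefE3 k := by
    have h := mul_pos (mul_pos (show (0 : ℝ) < 1 - 2 * k by linarith)
      (show (0 : ℝ) < 4 - 3 * k by linarith))
      f3
    rw [coefE3_eq]
    linear_combination h
  have e4 : 0 < coefE4 k := by
    have h := mul_pos (mul_pos (mul_pos (mul_pos (mul_pos (mul_pos (mul_pos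
      (show (0 : ℝ) < k by linarith)
      (show (0 : ℝ) < 1 - 2 * k by linarith))
      (show (0 : ℝ) < 3 * k - 1 by linarith))
      (show (0 : ℝ) < 2 - k by linarith))
      (show (0 : ℝ) < 2 - k by linarith))
      (show (0 : ℝ) < 3 - 4 * k by linarith))
      (show (0 : ℝ) < 4 - 3 * k by linarith))
      (show (0 : ℝ) < 5 - k by linarith)
    rw [coefE4]
    linear_combination h
  -- This coefficient may have either sign, but it only moves the place of the single sign change.
  rcases le_total 0 (coefE1 k) with e1 | e1
  · refine (oneChange_of (ε := 1) (m := 1) (by norm_num) (by linarith) (fun j hj => ?_)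
      fun j hj hj5 => ?_).zerosLE <;> interval_cases j <;> simp only [coefE] <;> linarith
  · refine (oneChange_of (ε := 1) (m := 2) (by norm_num) (by linarith) (fun j hj => ?_)
      fun j hj hj5 => ?_).zerosLE <;> interval_cases j <;> simp only [coefE] <;> linarith

theorem imageZerosLE_of_lt_half {k : ℝ} (h0 : 1 / 3 < k) (h1 : k < 1 / 2) :
    ImageZerosLE k 2 := by
  have c0 : 0 < coefQ0 k := by
    have h := mul_pos (show (0 : ℝ) < 3 - k by linarith)
      (show (0 : ℝ) < 3 - 2 * k by linarith)
    rw [coefQ0_eq]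
    linear_combination 3 * h
  have c2 : 0 < coefQ2 k := by
    have h := mul_pos (mul_pos (mul_pos (show (0 : ℝ) < k by linarith)
      (show (0 : ℝ) < 3 - 4 * k by linarith))
      (show (0 : ℝ) < 1 - 2 * k by linarith))
      (show (0 : ℝ) < 3 * k - 1 by linarith)
    rw [coefQ2_eq]
    linear_combination 3 * h
  have c1 : 0 < coefQ1 k := by
    rw [coefQ1_eq]
    have : 0 < 1 - 2 * k := by linarith
    positivity
  refine imageZerosLE_of_pos (imageU_ne_of_pos fun s hs => ?_) (wronskE_zerosLE_of_lt_half h0 h1)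
  rw [polyQ]
  positivity

theorem exists_polyE_root_of_lt_half {k : ℝ} (h0 : 1 / 3 < k) (h1 : k < 1 / 2) :
    ∃ s > 0, polyE k s = 0 := by
  have e0 : coefE0 k < 0 := by
    have h := mul_pos (mul_pos (mul_pos (mul_pos (mul_pos (show (0 : ℝ) < 1 - 2 * k by linarith)
      (show (0 : ℝ) < 5 * k - 1 by linarith))
      (show (0 : ℝ) < 2 - 3 * k by linarith))
      (show (0 : ℝ) < 3 - k by linarith))
      (show (0 : ℝ) < 3 - 2 * k by linarith))
      (show (0 : ℝ) < 4 - 5 * k by linarith)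
    rw [coefE0]
    linear_combination h
  have e4 : 0 < coefE4 k := by
    have h := mul_pos (mul_pos (mul_pos (mul_pos (mul_pos (mul_pos (mul_pos
      (show (0 : ℝ) < k by linarith)
      (show (0 : ℝ) < 1 - 2 * k by linarith))
      (show (0 : ℝ) < 3 * k - 1 by linarith))
      (show (0 : ℝ) < 2 - k by linarith))
      (show (0 : ℝ) < 2 - k by linarith))
      (show (0 : ℝ) < 3 - 4 * k by linarith))
      (show (0 : ℝ) < 4 - 3 * k by linarith))
      (show (0 : ℝ) < 5 - k by linarith)
    rw [coefE4]
    linear_combination h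
  exact exists_polyE_root (ε := 1) (by linarith) (by linarith)

/-! #### From `1 / 2` to `2 / 3` -/

theorem exists_oneChange_of_lt_two_thirds {k : ℝ} (h0 : 1 / 2 < k) (h1 : k < 2 / 3) :
    ∃ m, OneChange k (-1) m := by
  have f1 : 0 < evalL k listF1 := evalL_pos (hasCoord_Ico (l := 3) (h := 4) (q := 6) (by norm_num)
      (by push_cast; linarith) (by push_cast; linarith)) [] _
    (by decide +kernel)
  have f3 : 0 < evalL k listF3 := evalL_pos (hasCoord_Ico (l := 3) (h := 4) (q := 6) (by norm_num)
      (by push_cast; linarith) (by push_cast; linarith)) [] _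
    (by decide +kernel)
  have e0 : 0 < coefE0 k := by
    have h := mul_pos (mul_pos (mul_pos (mul_pos (mul_pos (show (0 : ℝ) < 2 * k - 1 by linarith)
      (show (0 : ℝ) < 5 * k - 1 by linarith))
      (show (0 : ℝ) < 2 - 3 * k by linarith))
      (show (0 : ℝ) < 3 - k by linarith))
      (show (0 : ℝ) < 3 - 2 * k by linarith))
      (show (0 : ℝ) < 4 - 5 * k by linarith)
    rw [coefE0]
    linear_combination h
  have e1 : 0 < coefE1 k := by
    have h := mul_pos (mul_pos (show (0 : ℝ) < 2 - 3 * k by linarith)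
      (show (0 : ℝ) < 4 - 5 * k by linarith))
      f1
    rw [coefE1_eq]
    linear_combination h
  have e3 : coefE3 k < 0 := by
    have h := mul_pos (mul_pos (show (0 : ℝ) < 2 * k - 1 by linarith)
      (show (0 : ℝ) < 4 - 3 * k by linarith))
      f3
    rw [coefE3_eq]
    linear_combination h
  have e4 : coefE4 k < 0 := by
    have h := mul_pos (mul_pos (mul_pos (mul_pos (mul_pos (mul_pos (mul_pos
      (show (0 : ℝ) < k by linarith)
      (show (0 : ℝ) < 2 * k - 1 by linarith))
      (show (0 : ℝ) < 3 * k - 1 by linarith))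
      (show (0 : ℝ) < 2 - k by linarith))
      (show (0 : ℝ) < 2 - k by linarith))
      (show (0 : ℝ) < 3 - 4 * k by linarith))
      (show (0 : ℝ) < 4 - 3 * k by linarith))
      (show (0 : ℝ) < 5 - k by linarith)
    rw [coefE4]
    linear_combination h
  rcases le_total 0 (coefE2 k) with e2 | e2
  · refine ⟨3, oneChange_of (by norm_num) (by linarith) (fun j hj => ?_) fun j hj hj5 => ?_⟩ <;>
      interval_cases j <;> simp only [coefE] <;> linarith
  · refine ⟨2, oneChange_of (by norm_num) (by linarith) (fun j hj => ?_) fun j hj hj5 => ?_⟩ <;>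
      interval_cases j <;> simp only [coefE] <;> linarith

theorem imageZerosLE_of_lt_two_thirds {k : ℝ} (h0 : 1 / 2 < k) (h1 : k < 2 / 3) :
    ImageZerosLE k 2 := by
  have c0 : 0 < coefQ0 k := by
    have h := mul_pos (show (0 : ℝ) < 3 - k by linarith)
      (show (0 : ℝ) < 3 - 2 * k by linarith)
    rw [coefQ0_eq]
    linear_combination 3 * h
  have c2 : coefQ2 k < 0 := by
    have h := mul_pos (mul_pos (mul_pos (show (0 : ℝ) < k by linarith)
      (show (0 : ℝ) < 3 - 4 * k by linarith))
      (show (0 : ℝ) < 2 * k - 1 by linarith))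
      (show (0 : ℝ) < 3 * k - 1 by linarith)
    rw [coefQ2_eq]
    linear_combination 3 * h
  obtain ⟨m, hm⟩ := exists_oneChange_of_lt_two_thirds h0 h1
  exact imageZerosLE_two_of_falling (coefA_neg (by linarith) (by linarith))
    (coefB_neg (by linarith) (by linarith)) c0 c2 hm.zerosLE hm.falling

theorem exists_polyE_root_of_lt_two_thirds {k : ℝ} (h0 : 1 / 2 < k) (h1 : k < 2 / 3) :
    ∃ s > 0, polyE k s = 0 := by
  have e0 : 0 < coefE0 k := by
    have h := mul_pos (mul_pos (mul_pos (mul_pos (mul_pos (show (0 : ℝ) < 2 * k - 1 by linarith)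
      (show (0 : ℝ) < 5 * k - 1 by linarith))
      (show (0 : ℝ) < 2 - 3 * k by linarith))
      (show (0 : ℝ) < 3 - k by linarith))
      (show (0 : ℝ) < 3 - 2 * k by linarith))
      (show (0 : ℝ) < 4 - 5 * k by linarith)
    rw [coefE0]
    linear_combination h
  have e4 : coefE4 k < 0 := by
    have h := mul_pos (mul_pos (mul_pos (mul_pos (mul_pos (mul_pos (mul_pos
      (show (0 : ℝ) < k by linarith)
      (show (0 : ℝ) < 2 * k - 1 by linarith))
      (show (0 : ℝ) < 3 * k - 1 by linarith))
      (show (0 : ℝ) < 2 - k by linarith))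
      (show (0 : ℝ) < 2 - k by linarith))
      (show (0 : ℝ) < 3 - 4 * k by linarith))
      (show (0 : ℝ) < 4 - 3 * k by linarith))
      (show (0 : ℝ) < 5 - k by linarith)
    rw [coefE4]
    linear_combination h
  exact exists_polyE_root (ε := -1) (by linarith) (by linarith)

/-! #### From `2 / 3` to `3 / 4` -/

theorem imageZerosLE_of_lt_three_quarters {k : ℝ} (h0 : 2 / 3 < k) (h1 : k < 3 / 4) :
    ImageZerosLE k 1 := by
  have c0 : 0 < coefQ0 k := by
    have h := mul_pos (show (0 : ℝ) < 3 - k by linarith)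
      (show (0 : ℝ) < 3 - 2 * k by linarith)
    rw [coefQ0_eq]
    linear_combination 3 * h
  have c2 : coefQ2 k < 0 := by
    have h := mul_pos (mul_pos (mul_pos (show (0 : ℝ) < k by linarith)
      (show (0 : ℝ) < 3 - 4 * k by linarith))
      (show (0 : ℝ) < 2 * k - 1 by linarith))
      (show (0 : ℝ) < 3 * k - 1 by linarith)
    rw [coefQ2_eq]
    linear_combination 3 * h
  have f1 : 0 < evalL k listF1 := evalL_pos (hasCoord_Ico (l := 8) (h := 9) (q := 12) (by norm_num)
      (by push_cast; linarith) (by push_cast; linarith)) [] _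
    (by decide +kernel)
  have f2 : 0 < evalL k listF2 := evalL_pos (hasCoord_Ico (l := 8) (h := 9) (q := 12) (by norm_num)
      (by push_cast; linarith) (by push_cast; linarith)) [] _
    (by decide +kernel)
  have f3 : 0 < evalL k listF3 := evalL_pos (hasCoord_Ico (l := 8) (h := 9) (q := 12) (by norm_num)
      (by push_cast; linarith) (by push_cast; linarith)) [] _
    (by decide +kernel)
  have e0 : coefE0 k < 0 := by
    have h := mul_pos (mul_pos (mul_pos (mul_pos (mul_pos (show (0 : ℝ) < 2 * k - 1 by linarith)
      (show (0 : ℝ) < 5 * k - 1 by linarith))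
      (show (0 : ℝ) < 3 * k - 2 by linarith))
      (show (0 : ℝ) < 3 - k by linarith))
      (show (0 : ℝ) < 3 - 2 * k by linarith))
      (show (0 : ℝ) < 4 - 5 * k by linarith)
    rw [coefE0]
    linear_combination h
  have e1 : coefE1 k < 0 := by
    have h := mul_pos (mul_pos (show (0 : ℝ) < 3 * k - 2 by linarith)
      (show (0 : ℝ) < 4 - 5 * k by linarith))
      f1
    rw [coefE1_eq]
    linear_combination h
  have e2 : coefE2 k < 0 := by
    have h := mul_pos (show (0 : ℝ) < 4 - 3 * k by linarith)
      f2
    rw [coefE2_eq]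
    linear_combination h
  have e3 : coefE3 k < 0 := by
    have h := mul_pos (mul_pos (show (0 : ℝ) < 2 * k - 1 by linarith)
      (show (0 : ℝ) < 4 - 3 * k by linarith))
      f3
    rw [coefE3_eq]
    linear_combination h
  have e4 : coefE4 k < 0 := by
    have h := mul_pos (mul_pos (mul_pos (mul_pos (mul_pos (mul_pos (mul_pos
      (show (0 : ℝ) < k by linarith)
      (show (0 : ℝ) < 2 * k - 1 by linarith))
      (show (0 : ℝ) < 3 * k - 1 by linarith))
      (show (0 : ℝ) < 2 - k by linarith))
      (show (0 : ℝ) < 2 - k by linarith))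
      (show (0 : ℝ) < 3 - 4 * k by linarith))
      (show (0 : ℝ) < 4 - 3 * k by linarith))
      (show (0 : ℝ) < 5 - k by linarith)
    rw [coefE4]
    linear_combination h
  refine imageZerosLE_one_of_neg (mul_neg_of_pos_of_neg c0 c2)
    (mul_pos_of_neg_of_neg c2 (coefA_neg (by linarith) (by linarith)))
    (mul_pos_of_neg_of_neg c2 (coefB_neg (by linarith) (by linarith))) fun s hs => ?_
  have := mul_neg_of_neg_of_pos e1 hs
  have := mul_neg_of_neg_of_pos e2 (pow_pos hs 2)
  have := mul_neg_of_neg_of_pos e3 (pow_pos hs 3)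
  have := mul_neg_of_neg_of_pos e4 (pow_pos hs 4)
  rw [polyE]
  linarith

/-! #### From `3 / 4` to `4 / 5` -/

theorem exists_oneChange_of_lt_four_fifths {k : ℝ} (h0 : 3 / 4 < k) (h1 : k < 4 / 5) :
    ∃ m, OneChange k 1 m := by
  have f1 : 0 < evalL k listF1 :=
    evalL_pos (hasCoord_Ico (l := 15) (h := 16) (q := 20) (by norm_num)
      (by push_cast; linarith) (by push_cast; linarith)) [] _
    (by decide +kernel)
  have e0 : coefE0 k < 0 := by
    have h := mul_pos (mul_pos (mul_pos (mul_pos (mul_pos (show (0 : ℝ) < 2 * k - 1 by linarith)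
      (show (0 : ℝ) < 5 * k - 1 by linarith))
      (show (0 : ℝ) < 3 * k - 2 by linarith))
      (show (0 : ℝ) < 3 - k by linarith))
      (show (0 : ℝ) < 3 - 2 * k by linarith))
      (show (0 : ℝ) < 4 - 5 * k by linarith)
    rw [coefE0]
    linear_combination h
  have e1 : coefE1 k < 0 := by
    have h := mul_pos (mul_pos (show (0 : ℝ) < 3 * k - 2 by linarith)
      (show (0 : ℝ) < 4 - 5 * k by linarith))
      f1
    rw [coefE1_eq]
    linear_combination h
  have e4 : 0 < coefE4 k := by
    have h := mul_pos (mul_pos (mul_pos (mul_pos (mul_pos (mul_pos (mul_pos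
      (show (0 : ℝ) < k by linarith)
      (show (0 : ℝ) < 2 * k - 1 by linarith))
      (show (0 : ℝ) < 3 * k - 1 by linarith))
      (show (0 : ℝ) < 2 - k by linarith))
      (show (0 : ℝ) < 2 - k by linarith))
      (show (0 : ℝ) < 4 * k - 3 by linarith))
      (show (0 : ℝ) < 4 - 3 * k by linarith))
      (show (0 : ℝ) < 5 - k by linarith)
    rw [coefE4]
    linear_combination h
  -- Below 795/1000 the quadratic coefficient is certified negative, above it the cubic one
  -- positive. Either way the remaining undetermined sign leaves a single change.
  rcases lt_or_ge k (795 / 1000) with h2 | h2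
  · have f2 : 0 < evalL k listF2 := evalL_pos (hasCoord_Ico (l := 750) (h := 795) (q := 1000)
      (by norm_num) (by push_cast; linarith) (by push_cast; linarith)) [] _ (by decide +kernel)
    have e2 : coefE2 k < 0 := by
      have h := mul_pos (show (0 : ℝ) < 4 - 3 * k by linarith)
        f2
      rw [coefE2_eq]
      linear_combination h
    rcases le_total 0 (coefE3 k) with e3 | e3
    · refine ⟨3, oneChange_of (by norm_num) (by linarith) (fun j hj => ?_) fun j hj hj5 => ?_⟩ <;>
        interval_cases j <;> simp only [coefE] <;> linarith
    · refine ⟨4, oneChange_of (by norm_num) (by linarith) (fun j hj => ?_) fun j hj hj5 => ?_⟩ <;>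
        interval_cases j <;> simp only [coefE] <;> linarith
  · have f3 : evalL k listF3 < 0 := evalL_neg (hasCoord_Ico (l := 795) (h := 800) (q := 1000)
      (by norm_num) (by push_cast; linarith) (by push_cast; linarith)) [] _ (by decide +kernel)
    have e3 : 0 < coefE3 k := by
      have h := mul_pos (mul_pos (show (0 : ℝ) < 2 * k - 1 by linarith)
        (show (0 : ℝ) < 4 - 3 * k by linarith))
        (neg_pos.2 f3)
      rw [coefE3_eq]
      linear_combination h
    rcases le_total 0 (coefE2 k) with e2 | e2
    · refine ⟨2, oneChange_of (by norm_num) (by linarith) (fun j hj => ?_) fun j hj hj5 => ?_⟩ <;>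
        interval_cases j <;> simp only [coefE] <;> linarith
    · refine ⟨3, oneChange_of (by norm_num) (by linarith) (fun j hj => ?_) fun j hj hj5 => ?_⟩ <;>
        interval_cases j <;> simp only [coefE] <;> linarith

/-- `primPhi` falls short of π/2 by at most (128/15)/t⁵. Where Q < 0 the rational term is positive
and exceeds this, because Q can be negative only for s > 9/2. -/
theorem lt_quotVU_of_polyQ_neg {k t : ℝ} (h0 : 3 / 4 < k) (h1 : k < 4 / 5) (ht : 0 < t)
    (hQ : polyQ k (t ^ 2) < 0) : Real.pi / 2 < quotVU k t := by
  have hA : coefA k < -40 := by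
    have h := evalL_neg (x := k) (hasCoord_Ico (l := 15) (h := 16) (q := 20)
      (by norm_num) (by push_cast; linarith) (by push_cast; linarith)) []
      [-65, 24, 180, -260, 120] (by decide +kernel)
    simp only [evalL] at h
    push_cast at h
    rw [coefA]
    linarith
  have hB := coefB_neg (k := k) (by linarith) h1.le
  have c2 : 0 < coefQ2 k := by
    have h := mul_pos (mul_pos (mul_pos (show (0 : ℝ) < k by linarith)
      (show (0 : ℝ) < 4 * k - 3 by linarith))
      (show (0 : ℝ) < 2 * k - 1 by linarith))
      (show (0 : ℝ) < 3 * k - 1 by linarith)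
    rw [coefQ2_eq]
    linear_combination 3 * h
  have c0 : 9 < coefQ0 k := by
    rw [coefQ0]
    nlinarith
  have c1 : -2 < coefQ1 k := by
    have h3 : k ^ 2 < (4 / 5) ^ 2 := pow_lt_pow_left₀ h1 (by linarith) two_ne_zero
    have h4 : k ^ 3 < (4 / 5) ^ 3 := pow_lt_pow_left₀ h1 (by linarith) three_ne_zero
    rw [coefQ1]
    linarith
  rw [quotVU_eq hQ.ne]
  refine lt_of_lt_of_le ?_ (add_le_add_left (le_primPhi ht) _)
  have ht2 : 0 < t ^ 2 := by positivity
  obtain ⟨s, hs⟩ : ∃ s, s = t ^ 2 := ⟨_, rfl⟩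
  rw [← hs] at hQ ht2 ⊢
  have hq : -polyQ k s < 2 * s := by
    rw [polyQ]
    nlinarith [mul_pos c2 (pow_pos ht2 2)]
  have hs2 : 9 / 2 < s := by
    rw [polyQ] at hQ
    nlinarith [mul_pos c2 (pow_pos ht2 2)]
  -- For s > 9/2 one has 1 + s < 11s/9, and (128/15)·2·(11/9)⁴ is just below the 40 obtained from
  -- `hA`.
  have h5 : (1 + s) ^ 4 ≤ (11 / 9 * s) ^ 4 := pow_le_pow_left₀ (by linarith) (by linarith) 4
  have h6 : 40 < -(coefA k + coefB k * s) := by nlinarith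
  have h7 : 128 / 15 * (-polyQ k s) * (1 + s) ^ 4 < s ^ 5 * -(coefA k + coefB k * s) := by
    have h8 : -polyQ k s * (1 + s) ^ 4 ≤ 2 * s * (11 / 9 * s) ^ 4 :=
      mul_le_mul hq.le h5 (by positivity) (by positivity)
    have h9 : 0 < s ^ 5 := by positivity
    nlinarith
  have h10 : 0 < -polyQ k s * (1 + s) ^ 4 := mul_pos (neg_pos.2 hQ) (by positivity)
  have h11 : 128 / 15 / t ^ 5 < t ^ 5 * (coefA k + coefB k * s) / (polyQ k s * (1 + s) ^ 4) := by
    rw [← neg_div_neg_eq (t ^ 5 * _), div_lt_div_iff₀ (by positivity) (by linarith)]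
    have h12 : t ^ 5 * t ^ 5 = s ^ 5 := by
      rw [hs]
      ring
    have h13 : -(t ^ 5 * (coefA k + coefB k * s)) * t ^ 5 =
        s ^ 5 * -(coefA k + coefB k * s) := by
      rw [← h12]
      ring
    rw [h13]
    linarith
  linarith

/-- When Q has roots a ≤ b, the formula for E at a root gives E ≤ 0 at a and E ≥ 0 at b. With a
single sign change, E is then negative before a and positive after b. -/
theorem imageZerosLE_of_lt_four_fifths {k : ℝ} (h0 : 3 / 4 < k) (h1 : k < 4 / 5) :
    ImageZerosLE k 2 := by
  have c0 : 0 < coefQ0 k := by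
    have h := mul_pos (show (0 : ℝ) < 3 - k by linarith)
      (show (0 : ℝ) < 3 - 2 * k by linarith)
    rw [coefQ0_eq]
    linear_combination 3 * h
  have c2 : 0 < coefQ2 k := by
    have h := mul_pos (mul_pos (mul_pos (show (0 : ℝ) < k by linarith)
      (show (0 : ℝ) < 4 * k - 3 by linarith))
      (show (0 : ℝ) < 2 * k - 1 by linarith))
      (show (0 : ℝ) < 3 * k - 1 by linarith)
    rw [coefQ2_eq]
    linear_combination 3 * h
  obtain ⟨m, hm⟩ := exists_oneChange_of_lt_four_fifths h0 h1
  rcases polyQ_pos_or_factor c0 c2 with hQ | ⟨a, ha, b, hab, hf⟩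
  · exact imageZerosLE_of_pos (imageU_ne_of_pos hQ) hm.zerosLE
  have hb := ha.trans_le hab
  have hA := coefA_neg (k := k) (by linarith) h1.le
  have hB := coefB_neg (k := k) (by linarith) h1.le
  have hsa := Real.sq_sqrt ha.le
  have hsb := Real.sq_sqrt hb.le
  have hEa : polyE k a ≤ 0 := by
    have h3 := polyE_at_root ha (k := k) (by simp [hf])
    rw [polyQ'_eq_of_factor hf] at h3
    have h4 : 0 < -(coefA k + coefB k * a) := by nlinarith
    have h5 : 0 ≤ coefQ2 k * (b - a) * (a * -(coefA k + coefB k * a)) * (1 + a) :=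
      mul_nonneg (mul_nonneg (mul_nonneg c2.le (by linarith)) (mul_pos ha h4).le) (by linarith)
    linarith
  have hEb : 0 ≤ polyE k b := by
    have h3 := polyE_at_root hb (k := k) (by simp [hf])
    rw [polyQ'_eq_of_factor hf] at h3
    have h4 : 0 < -(coefA k + coefB k * b) := by nlinarith
    have h5 : 0 ≤ coefQ2 k * (b - a) * (b * -(coefA k + coefB k * b)) * (1 + b) :=
      mul_nonneg (mul_nonneg (mul_nonneg c2.le (by linarith)) (mul_pos hb h4).le) (by linarith)
    linarith
  refine imageZerosLE_of_mid_gt (remainderNeZero_of_le (by linarith) h1.le) c2.ne'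
    (imageU_zerosLE_two c2.ne') (onlyTwoZeros_of_factor c2.ne' ha hab hf) hm.zerosLE
    (fun t ht => ?_) (fun t ht => ?_) fun t ht => ?_
  · have h3 := (Real.lt_sqrt ht.1.le).1 ht.2
    by_contra! h
    have := hm.rising (pow_pos ht.1 2) h3 (by simpa [wronskE] using h)
    linarith
  · have h3 := (Real.sqrt_lt' ((Real.sqrt_nonneg b).trans_lt ht)).1 ht
    simpa [wronskE] using hm.rising hb h3 (by simpa using hEb)
  · have ht0 := (Real.sqrt_nonneg a).trans_lt ht.1
    have h3 := (Real.sqrt_lt' ht0).1 ht.1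
    have h4 := (Real.lt_sqrt ht0.le).1 ht.2
    refine lt_quotVU_of_polyQ_neg h0 h1 ht0 ?_
    rw [hf]
    exact mul_neg_of_pos_of_neg (mul_pos c2 (by linarith)) (by linarith)

theorem exists_polyE_root_of_lt_four_fifths {k : ℝ} (h0 : 3 / 4 < k) (h1 : k < 4 / 5) :
    ∃ s > 0, polyE k s = 0 := by
  have e0 : coefE0 k < 0 := by
    have h := mul_pos (mul_pos (mul_pos (mul_pos (mul_pos (show (0 : ℝ) < 2 * k - 1 by linarith)
      (show (0 : ℝ) < 5 * k - 1 by linarith))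
      (show (0 : ℝ) < 3 * k - 2 by linarith))
      (show (0 : ℝ) < 3 - k by linarith))
      (show (0 : ℝ) < 3 - 2 * k by linarith))
      (show (0 : ℝ) < 4 - 5 * k by linarith)
    rw [coefE0]
    linear_combination h
  have e4 : 0 < coefE4 k := by
    have h := mul_pos (mul_pos (mul_pos (mul_pos (mul_pos (mul_pos (mul_pos
      (show (0 : ℝ) < k by linarith)
      (show (0 : ℝ) < 2 * k - 1 by linarith))
      (show (0 : ℝ) < 3 * k - 1 by linarith))
      (show (0 : ℝ) < 2 - k by linarith))
      (show (0 : ℝ) < 2 - k by linarith))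
      (show (0 : ℝ) < 4 * k - 3 by linarith))
      (show (0 : ℝ) < 4 - 3 * k by linarith))
      (show (0 : ℝ) < 5 - k by linarith)
    rw [coefE4]
    linear_combination h
  exact exists_polyE_root (ε := 1) (by linarith) (by linarith)

/-! #### From `4 / 5` to `4 / 3` -/

theorem imageZerosLE_of_le_four_thirds {k : ℝ} (h0 : 4 / 5 ≤ k) (h1 : k ≤ 4 / 3) :
    ImageZerosLE k 1 := by
  have hq : 0 < q3 k := by
    rw [q3_eq]
    exact evalL_pos (hasCoord_Ico (l := 8) (h := 14) (q := 10) (by norm_num)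
      (by push_cast; linarith) (by push_cast; linarith)) [] _ (by decide +kernel)
  have c2 : 0 < coefQ2 k := by
    have h := mul_pos (mul_pos (mul_pos (show (0 : ℝ) < k by linarith)
      (show (0 : ℝ) < 4 * k - 3 by linarith))
      (show (0 : ℝ) < 2 * k - 1 by linarith))
      (show (0 : ℝ) < 3 * k - 1 by linarith)
    rw [coefQ2_eq]
    linear_combination 3 * h
  have f1 : 0 < evalL k listF1 :=
    evalL_pos (hasCoord_Ico (l := 40) (h := 67) (q := 50) (by norm_num)
      (by push_cast; linarith) (by push_cast; linarith)) [] _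
    (by decide +kernel)
  have f2 : evalL k listF2 < 0 := evalL_neg (hasCoord_Ico (l := 8) (h := 15) (q := 10) (by norm_num)
      (by push_cast; linarith) (by push_cast; linarith)) [] _
    (by decide +kernel)
  have f3 : evalL k listF3 < 0 := evalL_neg (hasCoord_Ico (l := 8) (h := 15) (q := 10) (by norm_num)
      (by push_cast; linarith) (by push_cast; linarith)) [] _
    (by decide +kernel)
  have e0 : 0 ≤ coefE0 k := by
    have h := mul_nonneg (mul_nonneg (mul_nonneg (mul_nonneg (mul_nonneg
      (show (0 : ℝ) ≤ 2 * k - 1 by linarith)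
      (show (0 : ℝ) ≤ 5 * k - 1 by linarith))
      (show (0 : ℝ) ≤ 3 * k - 2 by linarith))
      (show (0 : ℝ) ≤ 3 - k by linarith))
      (show (0 : ℝ) ≤ 3 - 2 * k by linarith))
      (show (0 : ℝ) ≤ 5 * k - 4 by linarith)
    rw [coefE0]
    linear_combination h
  have e1 : 0 ≤ coefE1 k := by
    have h := mul_nonneg (mul_nonneg (show (0 : ℝ) ≤ 3 * k - 2 by linarith)
      (show (0 : ℝ) ≤ 5 * k - 4 by linarith))
      f1.le
    rw [coefE1_eq]
    linear_combination h
  have e2 : 0 ≤ coefE2 k := by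
    have h := mul_nonneg (show (0 : ℝ) ≤ 4 - 3 * k by linarith)
      (neg_nonneg.2 f2.le)
    rw [coefE2_eq]
    linear_combination h
  have e3 : 0 ≤ coefE3 k := by
    have h := mul_nonneg (mul_nonneg (show (0 : ℝ) ≤ 2 * k - 1 by linarith)
      (show (0 : ℝ) ≤ 4 - 3 * k by linarith))
      (neg_nonneg.2 f3.le)
    rw [coefE3_eq]
    linear_combination h
  have e4 : 0 ≤ coefE4 k := by
    have h := mul_nonneg (mul_nonneg (mul_nonneg (mul_nonneg (mul_nonneg (mul_nonneg (mul_nonneg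
      (show (0 : ℝ) ≤ k by linarith)
      (show (0 : ℝ) ≤ 2 * k - 1 by linarith))
      (show (0 : ℝ) ≤ 3 * k - 1 by linarith))
      (show (0 : ℝ) ≤ 2 - k by linarith))
      (show (0 : ℝ) ≤ 2 - k by linarith))
      (show (0 : ℝ) ≤ 4 * k - 3 by linarith))
      (show (0 : ℝ) ≤ 4 - 3 * k by linarith))
      (show (0 : ℝ) ≤ 5 - k by linarith)
    rw [coefE4]
    linear_combination h
  -- The constant coefficient vanishes at 4/5 and the leading one at 4/3, so strictness comes from
  -- one or the other.
  have he : 0 < coefE0 k ∨ 0 < coefE4 k := by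
    rcases h0.eq_or_lt with h | h
    · right
      rw [coefE4, ← h]
      norm_num
    · left
      have e0' : 0 < coefE0 k := by
        have h := mul_pos (mul_pos (mul_pos (mul_pos (mul_pos (show (0 : ℝ) < 2 * k - 1 by linarith)
          (show (0 : ℝ) < 5 * k - 1 by linarith))
          (show (0 : ℝ) < 3 * k - 2 by linarith))
          (show (0 : ℝ) < 3 - k by linarith))
          (show (0 : ℝ) < 3 - 2 * k by linarith))
          (show (0 : ℝ) < 5 * k - 4 by linarith)
        rw [coefE0]
        linear_combination h
      exact e0'
  have hE : ∀ s > 0, 0 < polyE k s := fun s hs => by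
    have h2 := mul_nonneg e1 hs.le
    have h3 := mul_nonneg e2 (pow_pos hs 2).le
    have h4 := mul_nonneg e3 (pow_pos hs 3).le
    rw [polyE]
    rcases he with h | h
    · have := mul_nonneg e4 (pow_pos hs 4).le
      linarith
    · have := mul_pos h (pow_pos hs 4)
      linarith
  exact imageZerosLE_of_pos (n := 0)
    (imageU_ne_of_pos fun s _ => polyQ_pos_of_q3 (by linarith) c2 hq s)
    (ZerosLE.of_ne_zero fun t ht => (hE _ (pow_pos ht 2)).ne')

/-! #### From `4 / 3` to `3 / 2` -/

theorem exists_oneChange_of_lt_three_half {k : ℝ} (h0 : 4 / 3 < k) (h1 : k < 3 / 2) :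
    ∃ m, OneChange k (-1) m := by
  have f2 : evalL k listF2 < 0 := evalL_neg (hasCoord_Ico (l := 8) (h := 9) (q := 6) (by norm_num)
      (by push_cast; linarith) (by push_cast; linarith)) [] _
    (by decide +kernel)
  have f3 : evalL k listF3 < 0 := evalL_neg (hasCoord_Ico (l := 8) (h := 9) (q := 6) (by norm_num)
      (by push_cast; linarith) (by push_cast; linarith)) [] _
    (by decide +kernel)
  have e0 : 0 < coefE0 k := by
    have h := mul_pos (mul_pos (mul_pos (mul_pos (mul_pos (show (0 : ℝ) < 2 * k - 1 by linarith)
      (show (0 : ℝ) < 5 * k - 1 by linarith))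
      (show (0 : ℝ) < 3 * k - 2 by linarith))
      (show (0 : ℝ) < 3 - k by linarith))
      (show (0 : ℝ) < 3 - 2 * k by linarith))
      (show (0 : ℝ) < 5 * k - 4 by linarith)
    rw [coefE0]
    linear_combination h
  have e2 : coefE2 k < 0 := by
    have h := mul_pos (show (0 : ℝ) < 3 * k - 4 by linarith)
      (neg_pos.2 f2)
    rw [coefE2_eq]
    linear_combination h
  have e3 : coefE3 k < 0 := by
    have h := mul_pos (mul_pos (show (0 : ℝ) < 2 * k - 1 by linarith)
      (show (0 : ℝ) < 3 * k - 4 by linarith))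
      (neg_pos.2 f3)
    rw [coefE3_eq]
    linear_combination h
  have e4 : coefE4 k < 0 := by
    have h := mul_pos (mul_pos (mul_pos (mul_pos (mul_pos (mul_pos (mul_pos
      (show (0 : ℝ) < k by linarith)
      (show (0 : ℝ) < 2 * k - 1 by linarith))
      (show (0 : ℝ) < 3 * k - 1 by linarith))
      (show (0 : ℝ) < 2 - k by linarith))
      (show (0 : ℝ) < 2 - k by linarith))
      (show (0 : ℝ) < 4 * k - 3 by linarith))
      (show (0 : ℝ) < 3 * k - 4 by linarith))
      (show (0 : ℝ) < 5 - k by linarith)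
    rw [coefE4]
    linear_combination h
  rcases le_total 0 (coefE1 k) with e1 | e1
  · refine ⟨2, oneChange_of (by norm_num) (by linarith) (fun j hj => ?_) fun j hj hj5 => ?_⟩ <;>
      interval_cases j <;> simp only [coefE] <;> linarith
  · refine ⟨1, oneChange_of (by norm_num) (by linarith) (fun j hj => ?_) fun j hj hj5 => ?_⟩ <;>
      interval_cases j <;> simp only [coefE] <;> linarith

/-- `primPhi` is at most (128/15) t⁵, and where Q < 0 the rational term is below -(128/15) t⁵.
Negativity of Q forces s < 1/5 and -Q < 5/2, and (128/15)(5/2)(6/5)⁴ is just below 45. -/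
theorem quotVU_neg_of_polyQ_neg {k t : ℝ} (h0 : 4 / 3 < k) (h1 : k < 3 / 2) (ht : 0 < t)
    (hQ : polyQ k (t ^ 2) < 0) : quotVU k t < 0 := by
  have hA : 45 < coefA k := by
    have h := evalL_pos (x := k) (hasCoord_Ico (l := 8) (h := 9) (q := 6)
      (by norm_num) (by push_cast; linarith) (by push_cast; linarith)) []
      [-97, 24, 180, -260, 120] (by decide +kernel)
    simp only [evalL] at h
    push_cast at h
    rw [coefA]
    linarith
  have h12 : 0 < 5 * coefQ1 k + coefQ2 k := by
    have h := evalL_pos (x := k) (hasCoord_Ico (l := 8) (h := 9) (q := 6)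
      (by norm_num) (by push_cast; linarith) (by push_cast; linarith)) []
      [5, -9, 42, -124, 72] (by decide +kernel)
    simp only [evalL] at h
    push_cast at h
    rw [coefQ1, coefQ2]
    linarith
  have hB := coefB_pos h0 (by linarith)
  have c0 : 0 < coefQ0 k := by
    have h := mul_pos (show (0 : ℝ) < 3 - k by linarith)
      (show (0 : ℝ) < 3 - 2 * k by linarith)
    rw [coefQ0_eq]
    linear_combination 3 * h
  have c2 : 0 < coefQ2 k := by
    have h := mul_pos (mul_pos (mul_pos (show (0 : ℝ) < k by linarith)
      (show (0 : ℝ) < 4 * k - 3 by linarith))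
      (show (0 : ℝ) < 2 * k - 1 by linarith))
      (show (0 : ℝ) < 3 * k - 1 by linarith)
    rw [coefQ2_eq]
    linear_combination 3 * h
  have c1 : -25 / 2 < coefQ1 k := by
    have h3 : k ^ 2 < (3 / 2) ^ 2 := pow_lt_pow_left₀ h1 (by linarith) two_ne_zero
    have h4 : k ^ 3 < (3 / 2) ^ 3 := pow_lt_pow_left₀ h1 (by linarith) three_ne_zero
    rw [coefQ1]
    linarith
  rw [quotVU_eq hQ.ne]
  refine lt_of_le_of_lt (add_le_add_left (primPhi_le ht.le) _) ?_
  have ht2 : 0 < t ^ 2 := by positivity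
  obtain ⟨s, hs⟩ : ∃ s, s = t ^ 2 := ⟨_, rfl⟩
  rw [← hs] at hQ ht2 ⊢
  have hs2 : s < 1 / 5 := by
    by_contra! h
    have h3 : 0 < s * (coefQ1 k + coefQ2 k * s) := mul_pos ht2 (by nlinarith)
    rw [polyQ] at hQ
    linarith
  have hq : -polyQ k s < 5 / 2 := by
    rw [polyQ]
    nlinarith [mul_pos c2 (pow_pos ht2 2)]
  have h5 : (1 + s) ^ 4 ≤ (6 / 5) ^ 4 := pow_le_pow_left₀ (by linarith) (by linarith) 4
  have h6 : 45 < coefA k + coefB k * s := by nlinarith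
  have h8 : -polyQ k s * (1 + s) ^ 4 ≤ 5 / 2 * (6 / 5) ^ 4 :=
    mul_le_mul hq.le h5 (by positivity) (by positivity)
  have h10 : 0 < -polyQ k s * (1 + s) ^ 4 := mul_pos (neg_pos.2 hQ) (by positivity)
  have h11 : (coefA k + coefB k * s) / (polyQ k s * (1 + s) ^ 4) < -(128 / 15) := by
    rw [← neg_lt_neg_iff, neg_neg, ← div_neg, lt_div_iff₀ (by linarith)]
    linarith
  rw [mul_div_assoc]
  nlinarith [pow_pos ht 5]

theorem imageZerosLE_of_lt_three_half {k : ℝ} (h0 : 4 / 3 < k) (h1 : k < 3 / 2) :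
    ImageZerosLE k 2 := by
  have c0 : 0 < coefQ0 k := by
    have h := mul_pos (show (0 : ℝ) < 3 - k by linarith)
      (show (0 : ℝ) < 3 - 2 * k by linarith)
    rw [coefQ0_eq]
    linear_combination 3 * h
  have c2 : 0 < coefQ2 k := by
    have h := mul_pos (mul_pos (mul_pos (show (0 : ℝ) < k by linarith)
      (show (0 : ℝ) < 4 * k - 3 by linarith))
      (show (0 : ℝ) < 2 * k - 1 by linarith))
      (show (0 : ℝ) < 3 * k - 1 by linarith)
    rw [coefQ2_eq]
    linear_combination 3 * h
  obtain ⟨m, hm⟩ := exists_oneChange_of_lt_three_half h0 h1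
  rcases polyQ_pos_or_factor c0 c2 with hQ | ⟨a, ha, b, hab, hf⟩
  · exact imageZerosLE_of_pos (imageU_ne_of_pos hQ) hm.zerosLE
  have hb := ha.trans_le hab
  have hA := coefA_pos h0 (by linarith)
  have hB := coefB_pos h0 (by linarith)
  have hEa : 0 ≤ polyE k a := by
    have h3 := polyE_at_root ha (k := k) (by simp [hf])
    rw [polyQ'_eq_of_factor hf] at h3
    have h5 : 0 ≤ coefQ2 k * (b - a) * (a * (coefA k + coefB k * a)) * (1 + a) :=
      mul_nonneg (mul_nonneg (mul_nonneg c2.le (by linarith)) (by positivity)) (by linarith)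
    linarith
  have hEb : polyE k b ≤ 0 := by
    have h3 := polyE_at_root hb (k := k) (by simp [hf])
    rw [polyQ'_eq_of_factor hf] at h3
    have h5 : 0 ≤ coefQ2 k * (b - a) * (b * (coefA k + coefB k * b)) * (1 + b) :=
      mul_nonneg (mul_nonneg (mul_nonneg c2.le (by linarith)) (by positivity)) (by linarith)
    linarith
  refine imageZerosLE_of_mid_neg (remainderNeZero_of_gt h0 (by linarith)) c2.ne'
    (imageU_zerosLE_two c2.ne') (onlyTwoZeros_of_factor c2.ne' ha hab hf) hm.zerosLE
    (fun t ht => ?_) (fun t ht => ?_) fun t ht => ?_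
  · have h3 := (Real.lt_sqrt ht.1.le).1 ht.2
    by_contra! h
    have := hm.falling _ (pow_pos ht.1 2) _ h3 (by simpa [wronskE] using h)
    linarith
  · have h3 := (Real.sqrt_lt' ((Real.sqrt_nonneg b).trans_lt ht)).1 ht
    simpa [wronskE] using hm.falling _ hb _ h3 hEb
  · have ht0 := (Real.sqrt_nonneg a).trans_lt ht.1
    have h3 := (Real.sqrt_lt' ht0).1 ht.1
    have h4 := (Real.lt_sqrt ht0.le).1 ht.2
    refine quotVU_neg_of_polyQ_neg h0 h1 ht0 ?_
    rw [hf]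
    exact mul_neg_of_pos_of_neg (mul_pos c2 (by linarith)) (by linarith)

theorem exists_polyE_root_of_lt_three_half {k : ℝ} (h0 : 4 / 3 < k) (h1 : k < 3 / 2) :
    ∃ s > 0, polyE k s = 0 := by
  have e0 : 0 < coefE0 k := by
    have h := mul_pos (mul_pos (mul_pos (mul_pos (mul_pos (show (0 : ℝ) < 2 * k - 1 by linarith)
      (show (0 : ℝ) < 5 * k - 1 by linarith))
      (show (0 : ℝ) < 3 * k - 2 by linarith))
      (show (0 : ℝ) < 3 - k by linarith))
      (show (0 : ℝ) < 3 - 2 * k by linarith))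
      (show (0 : ℝ) < 5 * k - 4 by linarith)
    rw [coefE0]
    linear_combination h
  have e4 : coefE4 k < 0 := by
    have h := mul_pos (mul_pos (mul_pos (mul_pos (mul_pos (mul_pos (mul_pos
      (show (0 : ℝ) < k by linarith)
      (show (0 : ℝ) < 2 * k - 1 by linarith))
      (show (0 : ℝ) < 3 * k - 1 by linarith))
      (show (0 : ℝ) < 2 - k by linarith))
      (show (0 : ℝ) < 2 - k by linarith))
      (show (0 : ℝ) < 4 * k - 3 by linarith))
      (show (0 : ℝ) < 3 * k - 4 by linarith))
      (show (0 : ℝ) < 5 - k by linarith)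
    rw [coefE4]
    linear_combination h
  exact exists_polyE_root (ε := -1) (by linarith) (by linarith)

/-! #### From `3 / 2` to `3` -/

theorem imageZerosLE_of_lt_root_three_half {k₃ k : ℝ} (hk₃ : IsTheRootIn q2 (3 / 2) 2 k₃)
    (h2 : k₃ < 178 / 100) (h0 : 3 / 2 < k) (h1 : k < k₃) : ImageZerosLE k 1 := by
  have c0 : coefQ0 k < 0 := by
    have h := mul_pos (show (0 : ℝ) < 3 - k by linarith)
      (show (0 : ℝ) < 2 * k - 3 by linarith)
    rw [coefQ0_eq]
    linear_combination 3 * h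
  have c2 : 0 < coefQ2 k := by
    have h := mul_pos (mul_pos (mul_pos (show (0 : ℝ) < k by linarith)
      (show (0 : ℝ) < 4 * k - 3 by linarith))
      (show (0 : ℝ) < 2 * k - 1 by linarith))
      (show (0 : ℝ) < 3 * k - 1 by linarith)
    rw [coefQ2_eq]
    linear_combination 3 * h
  exact imageZerosLE_one_of_neg (mul_neg_of_neg_of_pos c0 c2)
    (mul_pos c2 (coefA_pos (by linarith) (by linarith)))
    (mul_pos c2 (coefB_pos (by linarith) (by linarith)))
    fun s hs => polyE_neg_of_lt_root_three_half hk₃ h2 h0 h1 hs.le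

theorem imageZerosLE_of_lt_three {k : ℝ} (h0 : 176 / 100 < k) (h1 : k < 3) (h2 : k ≠ 2) :
    ImageZerosLE k 3 := by
  have c0 : coefQ0 k < 0 := by
    have h := mul_pos (show (0 : ℝ) < 3 - k by linarith)
      (show (0 : ℝ) < 2 * k - 3 by linarith)
    rw [coefQ0_eq]
    linear_combination 3 * h
  have c2 : 0 < coefQ2 k := by
    have h := mul_pos (mul_pos (mul_pos (show (0 : ℝ) < k by linarith)
      (show (0 : ℝ) < 4 * k - 3 by linarith))
      (show (0 : ℝ) < 2 * k - 1 by linarith))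
      (show (0 : ℝ) < 3 * k - 1 by linarith)
    rw [coefQ2_eq]
    linear_combination 3 * h
  have f1 : evalL k listF1 < 0 :=
    evalL_neg (hasCoord_Ico (l := 44) (h := 75) (q := 25) (by norm_num)
      (by push_cast; linarith) (by push_cast; linarith)) [] _
    (by decide +kernel)
  have f2 : 0 < evalL k listF2 :=
    evalL_pos (hasCoord_Ico (l := 44) (h := 75) (q := 25) (by norm_num)
      (by push_cast; linarith) (by push_cast; linarith)) [] _
    (by decide +kernel)
  have e0 : coefE0 k < 0 := by
    have h := mul_pos (mul_pos (mul_pos (mul_pos (mul_pos (show (0 : ℝ) < 2 * k - 1 by linarith)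
      (show (0 : ℝ) < 5 * k - 1 by linarith))
      (show (0 : ℝ) < 3 * k - 2 by linarith))
      (show (0 : ℝ) < 3 - k by linarith))
      (show (0 : ℝ) < 2 * k - 3 by linarith))
      (show (0 : ℝ) < 5 * k - 4 by linarith)
    rw [coefE0]
    linear_combination h
  have e1 : coefE1 k < 0 := by
    have h := mul_pos (mul_pos (show (0 : ℝ) < 3 * k - 2 by linarith)
      (show (0 : ℝ) < 5 * k - 4 by linarith))
      (neg_pos.2 f1)
    rw [coefE1_eq]
    linear_combination h
  have e2 : 0 < coefE2 k := by
    have h := mul_pos (show (0 : ℝ) < 3 * k - 4 by linarith)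
      f2
    rw [coefE2_eq]
    linear_combination h
  have e4 : coefE4 k < 0 := by
    have h3 : 0 < (k - 2) ^ 2 := by
      have := sub_ne_zero.2 h2
      positivity
    have h4 : 0 < k * (2 * k - 1) * (3 * k - 1) * (k - 2) ^ 2 * (4 * k - 3) * (3 * k - 4)
        * (5 - k) := by
      have h5 : 0 < 2 * k - 1 := by linarith
      have h6 : 0 < 3 * k - 1 := by linarith
      have h7 : 0 < 4 * k - 3 := by linarith
      have h8 : 0 < 3 * k - 4 := by linarith
      have h9 : 0 < 5 - k := by linarith
      have h10 : 0 < k := by linarith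
      positivity
    rw [coefE4]
    linarith
  refine imageZerosLE_three_of_two (mul_neg_of_neg_of_pos c0 c2)
    (mul_pos c2 (coefA_pos (by linarith) (by linarith)))
    (mul_pos c2 (coefB_pos (by linarith) (by linarith))) e0 e4 ?_
  -- The signs are -, -, +, ?, -, with two changes for either value of the undetermined one.
  rcases le_total 0 (coefE3 k) with e3 | e3
  · refine wronskE_zerosLE_coef (-1) [3, 7] ?_ ?_ ?_ ?_ ?_ ?_ <;> norm_num <;> linarith
  · refine wronskE_zerosLE_coef (-1) [3, 5] ?_ ?_ ?_ ?_ ?_ ?_ <;> norm_num <;> linarith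

/-! #### From `3` to `5` -/

theorem wronskE_zerosLE_of_gt_three {k : ℝ} (h0 : 3 < k) (h1 : k ≤ 5) :
    ZerosLE (wronskE k) (Ioi 0) 3 := by
  have f1 : evalL k listF1 < 0 := evalL_neg (hasCoord_Ioc (l := 3) (h := 5) (q := 1) (by norm_num)
      (by push_cast; linarith) (by push_cast; linarith)) [] _
    (by decide +kernel)
  have f2 : 0 < evalL k listF2 := evalL_pos (hasCoord_Ioc (l := 3) (h := 5) (q := 1) (by norm_num)
      (by push_cast; linarith) (by push_cast; linarith)) [] _
    (by decide +kernel)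
  have f3 : evalL k listF3 < 0 := evalL_neg (hasCoord_Ioc (l := 3) (h := 5) (q := 1) (by norm_num)
      (by push_cast; linarith) (by push_cast; linarith)) [] _
    (by decide +kernel)
  have e0 : 0 < coefE0 k := by
    have h := mul_pos (mul_pos (mul_pos (mul_pos (mul_pos (show (0 : ℝ) < 2 * k - 1 by linarith)
      (show (0 : ℝ) < 5 * k - 1 by linarith))
      (show (0 : ℝ) < 3 * k - 2 by linarith))
      (show (0 : ℝ) < k - 3 by linarith))
      (show (0 : ℝ) < 2 * k - 3 by linarith))
      (show (0 : ℝ) < 5 * k - 4 by linarith)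
    rw [coefE0]
    linear_combination h
  have e1 : coefE1 k < 0 := by
    have h := mul_pos (mul_pos (show (0 : ℝ) < 3 * k - 2 by linarith)
      (show (0 : ℝ) < 5 * k - 4 by linarith))
      (neg_pos.2 f1)
    rw [coefE1_eq]
    linear_combination h
  have e2 : 0 < coefE2 k := by
    have h := mul_pos (show (0 : ℝ) < 3 * k - 4 by linarith)
      f2
    rw [coefE2_eq]
    linear_combination h
  have e3 : coefE3 k < 0 := by
    have h := mul_pos (mul_pos (show (0 : ℝ) < 2 * k - 1 by linarith)
      (show (0 : ℝ) < 3 * k - 4 by linarith))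
      (neg_pos.2 f3)
    rw [coefE3_eq]
    linear_combination h
  have e4 : coefE4 k ≤ 0 := by
    have h := mul_nonneg (mul_nonneg (mul_nonneg (mul_nonneg (mul_nonneg (mul_nonneg (mul_nonneg
      (show (0 : ℝ) ≤ k by linarith)
      (show (0 : ℝ) ≤ 2 * k - 1 by linarith))
      (show (0 : ℝ) ≤ 3 * k - 1 by linarith))
      (show (0 : ℝ) ≤ k - 2 by linarith))
      (show (0 : ℝ) ≤ k - 2 by linarith))
      (show (0 : ℝ) ≤ 4 * k - 3 by linarith))
      (show (0 : ℝ) ≤ 3 * k - 4 by linarith))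
      (show (0 : ℝ) ≤ 5 - k by linarith)
    rw [coefE4]
    linear_combination h
  refine wronskE_zerosLE_coef (-1) [1, 3, 5] ?_ ?_ ?_ ?_ ?_ ?_ <;> norm_num <;> linarith

theorem coefQ2_pos_of_gt_three {k : ℝ} (h0 : 3 < k) : 0 < coefQ2 k := by
  have c2 : 0 < coefQ2 k := by
    have h := mul_pos (mul_pos (mul_pos (show (0 : ℝ) < k by linarith)
      (show (0 : ℝ) < 4 * k - 3 by linarith))
      (show (0 : ℝ) < 2 * k - 1 by linarith))
      (show (0 : ℝ) < 3 * k - 1 by linarith)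
    rw [coefQ2_eq]
    linear_combination 3 * h
  exact c2

theorem imageZerosLE_of_gt_three {k : ℝ} (h0 : 3 < k) (h1 : k ≤ 5) : ImageZerosLE k 6 := by
  exact imageZerosLE_of_le_two (remainderNeZero_of_gt (by linarith) h1)
    (imageU_zerosLE_two (coefQ2_pos_of_gt_three h0).ne') (wronskE_zerosLE_of_gt_three h0 h1)

theorem q3_pos_of_gt {k : ℝ} (h0 : 31 / 10 < k) (h1 : k ≤ 5) : 0 < q3 k := by
  rw [q3_eq]
  exact evalL_pos (hasCoord_Ioc (l := 31) (h := 50) (q := 10) (by norm_num)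
      (by push_cast; linarith) (by push_cast; linarith)) [] _ (by decide +kernel)

theorem q3_pos_of_gt_root {k₄ k : ℝ} (hk₄ : IsTheRootIn q3 3 4 k₄) (h3 : 3 < k₄) (h0 : k₄ < k)
    (h1 : k ≤ 5) : 0 < q3 k := by
  rcases lt_or_ge (31 / 10) k with h | h
  · exact q3_pos_of_gt h h1
  by_contra! hq
  obtain ⟨x, hx, hx0⟩ := intermediate_value_Icc (show k ≤ 35 / 10 by linarith)
    (((continuous_evalL listq3).congr fun x => (q3_eq x).symm).continuousOn)
    (show (0 : ℝ) ∈ Icc (q3 k) (q3 (35 / 10)) from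
      ⟨hq, (q3_pos_of_gt (by norm_num) (by norm_num)).le⟩)
  linarith [hk₄.eq (by linarith [hx.1]) (by linarith [hx.2]) hx0, hx.1]

theorem imageZerosLE_of_gt_root_q3 {k₄ k : ℝ} (hk₄ : IsTheRootIn q3 3 4 k₄) (h3 : 3 < k₄)
    (h0 : k₄ < k) (h1 : k ≤ 5) : ImageZerosLE k 4 := by
  have hk : 3 < k := by linarith
  exact imageZerosLE_of_pos (imageU_ne_of_pos fun s _ => polyQ_pos_of_q3 (by linarith)
    (coefQ2_pos_of_gt_three hk) (q3_pos_of_gt_root hk₄ h3 h0 h1) s)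
    (wronskE_zerosLE_of_gt_three hk h1)

theorem imageZerosLE_of_gt_root_three {k₅ k : ℝ} (hk₅ : IsTheRootIn q2 3 4 k₅)
    (h2 : 31 / 10 < k₅) (h0 : k₅ < k) (h1 : k ≤ 5) : ImageZerosLE k 2 := by
  -- 0.44² = 0.1936 lies between 19/100, where the slope estimate starts, and 1/5, up to which E is
  -- positive.
  have hl : ZerosLE (wronskE k) (Ioi (44 / 100)) 1 :=
    wronskE_zerosLE_of_slope (p := 5) ordConnected_Ioi isOpen_Ioi
      (fun t ht => lt_trans (by norm_num) ht) fun t ht =>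
      (slope_neg_of_three (by linarith) h1 (by nlinarith [mem_Ioi.1 ht])).ne
  refine imageZerosLE_of_pos (imageU_ne_of_pos fun s _ => polyQ_pos_of_q3 (by linarith)
    (coefQ2_pos_of_gt_three (by linarith)) (q3_pos_of_gt (by linarith) h1) s)
    (hl.union (n := 0) (J := Ioc 0 (44 / 100)) (ZerosLE.of_ne_zero fun t ht => ?_) fun t ht => ?_)
  · exact (polyE_pos_of_gt_root_three hk₅ h2 h0 h1
      ⟨by positivity, by nlinarith [ht.1, ht.2]⟩).ne'
  · rcases lt_or_ge (44 / 100) t with h | h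
    · exact Or.inl h
    · exact Or.inr ⟨ht, h⟩

theorem exists_polyE_root_of_gt_three {k : ℝ} (h0 : 3 < k) (h1 : k ≤ 5) :
    ∃ s > 0, polyE k s = 0 := by
  have e0 : 0 < coefE0 k := by
    have h := mul_pos (mul_pos (mul_pos (mul_pos (mul_pos (show (0 : ℝ) < 2 * k - 1 by linarith)
      (show (0 : ℝ) < 5 * k - 1 by linarith))
      (show (0 : ℝ) < 3 * k - 2 by linarith))
      (show (0 : ℝ) < k - 3 by linarith))
      (show (0 : ℝ) < 2 * k - 3 by linarith))
      (show (0 : ℝ) < 5 * k - 4 by linarith)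
    rw [coefE0]
    linear_combination h
  -- At k = 5 the leading coefficient of E vanishes, so a value at s = 10 replaces the sign at
  -- infinity.
  rcases h1.eq_or_lt with rfl | h1
  · refine exists_polyE_root_of_sign (ε := -1) (s := 10) (by linarith) (by norm_num) ?_
    norm_num [polyE, coefE0, coefE1, coefE2, coefE3, coefE4]
  have e4 : coefE4 k < 0 := by
    have h := mul_pos (mul_pos (mul_pos (mul_pos (mul_pos (mul_pos (mul_pos
      (show (0 : ℝ) < k by linarith)
      (show (0 : ℝ) < 2 * k - 1 by linarith))
      (show (0 : ℝ) < 3 * k - 1 by linarith))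
      (show (0 : ℝ) < k - 2 by linarith))
      (show (0 : ℝ) < k - 2 by linarith))
      (show (0 : ℝ) < 4 * k - 3 by linarith))
      (show (0 : ℝ) < 3 * k - 4 by linarith))
      (show (0 : ℝ) < 5 - k by linarith)
    rw [coefE4]
    linear_combination h
  exact exists_polyE_root (ε := -1) (by linarith) (by linarith)

/-! #### All parameters -/

theorem imageZerosLE_of_mul_nonpos {k : ℝ} (hR : RemainderNeZero k)
    (h : coefQ0 k * coefQ2 k ≤ 0) (hne : coefQ0 k ≠ 0 ∨ coefQ2 k ≠ 0)
    (hE : ∃ j < 5, coefE k j ≠ 0) : ImageZerosLE k 6 :=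
  imageZerosLE_of_le_one hR (imageU_zerosLE_one h hne) (wronskE_zerosLE_four hE)

theorem ImageZerosLE.mono {k : ℝ} {m n : ℕ} (h : ImageZerosLE k m) (hmn : m ≤ n) :
    ImageZerosLE k n := fun α β hαβ => (h α β hαβ).mono_nat hmn

/-- On this range the constant coefficient can vanish only at 1/5, 1/2 and 3, where the linear one
does not. -/
theorem exists_coefE_ne_zero {k : ℝ} (h0 : 0 < k) (h1 : k ≤ 3 / 4 ∨ 3 / 2 < k) (h2 : k ≤ 3)
    (h3 : k ≠ 2 / 3) : ∃ j < 5, coefE k j ≠ 0 := by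
  by_cases hE : coefE0 k = 0
  · refine ⟨1, by norm_num, ?_⟩
    have h4 : 3 * k - 2 ≠ 0 := fun h => h3 (by linarith)
    have h5 : k = 1 / 2 ∨ k = 1 / 5 ∨ k = 3 := by
      have h6 : 2 * k - 3 ≠ 0 := by
        intro h
        rcases h1 with h1 | h1 <;> linarith
      have h7 : 5 * k - 4 ≠ 0 := by
        intro h
        rcases h1 with h1 | h1 <;> linarith
      rw [coefE0] at hE
      simp only [mul_eq_zero, h4, h6, h7, or_false] at hE
      rcases hE with (h | h) | h
      · left; linarith
      · right; left; linarith
      · right; right; linarith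
    rcases h5 with rfl | rfl | rfl <;> norm_num [coefE, coefE1]
  · exact ⟨0, by norm_num, hE⟩

/-- The general bound 11 is 5 + 6. For k > 3, three zeros of E and two of Q give 3 + 3. Where the
outer coefficients of Q have product ≤ 0, four zeros of E and one of Q give 4 + 2. The other ranges
have sharper bounds. -/
theorem imageZerosLE_six {k : ℝ} (h0 : 0 < k) (h5 : k ≤ 5) (h1 : k ≠ 2 / 3) (h2 : k ≠ 3 / 2) :
    ImageZerosLE k 6 := by
  rcases lt_or_ge 3 k with h3 | h3
  · exact imageZerosLE_of_gt_three h3 h5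
  rcases lt_or_ge (3 / 2) k with h4 | h4
  · refine imageZerosLE_of_mul_nonpos (remainderNeZero_of_gt (by linarith) h5) ?_ (Or.inr ?_)
      (exists_coefE_ne_zero h0 (Or.inr h4) h3 h1)
    · have g0 : coefQ0 k ≤ 0 := by
        rw [coefQ0_eq]
        nlinarith
      have c2 : 0 < coefQ2 k := by
        have h := mul_pos (mul_pos (mul_pos (show (0 : ℝ) < k by linarith)
          (show (0 : ℝ) < 4 * k - 3 by linarith))
          (show (0 : ℝ) < 2 * k - 1 by linarith))
          (show (0 : ℝ) < 3 * k - 1 by linarith)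
        rw [coefQ2_eq]
        linear_combination 3 * h
      exact mul_nonpos_of_nonpos_of_nonneg g0 c2.le
    · have g0 : coefQ2 k ≠ 0 := by
        have c2 : 0 < coefQ2 k := by
          have h := mul_pos (mul_pos (mul_pos (show (0 : ℝ) < k by linarith)
            (show (0 : ℝ) < 4 * k - 3 by linarith))
            (show (0 : ℝ) < 2 * k - 1 by linarith))
            (show (0 : ℝ) < 3 * k - 1 by linarith)
          rw [coefQ2_eq]
          linear_combination 3 * h
        exact c2.ne'
      exact g0
  have h4' := h4.lt_of_ne h2
  rcases lt_or_ge (4 / 3) k with h6 | h6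
  · exact (imageZerosLE_of_lt_three_half h6 h4').mono (by norm_num)
  rcases le_or_gt (4 / 5) k with h7 | h7
  · exact (imageZerosLE_of_le_four_thirds h7 h6).mono (by norm_num)
  rcases lt_or_ge (3 / 4) k with h8 | h8
  · exact (imageZerosLE_of_lt_four_fifths h8 h7).mono (by norm_num)
  have hmid : (k < 1 / 2 ∧ 1 / 3 < k) ∨ k ≤ 1 / 3 ∨ 1 / 2 ≤ k := by
    rcases lt_or_ge k (1 / 2) with h | h
    · rcases lt_or_ge (1 / 3) k with h' | h'
      · exact Or.inl ⟨h, h'⟩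
      · exact Or.inr (Or.inl h')
    · exact Or.inr (Or.inr h)
  rcases hmid with ⟨h9, h10⟩ | hmid
  · exact (imageZerosLE_of_lt_half h10 h9).mono (by norm_num)
  have c0 : 0 < coefQ0 k := by
    have h := mul_pos (show (0 : ℝ) < 3 - k by linarith)
      (show (0 : ℝ) < 3 - 2 * k by linarith)
    rw [coefQ0_eq]
    linear_combination 3 * h
  have c2 : coefQ2 k ≤ 0 := by
    have h11 : 0 ≤ (2 * k - 1) * (3 * k - 1) := by
      rcases hmid with h | h <;> nlinarith
    have h12 := mul_nonneg (mul_nonneg h0.le (show 0 ≤ 3 - 4 * k by linarith)) h11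
    rw [coefQ2_eq]
    linarith
  exact imageZerosLE_of_mul_nonpos (remainderNeZero_of_le h0 h7.le)
    (mul_nonpos_of_nonneg_of_nonpos c0.le c2) (Or.inl c0.ne')
    (exists_coefE_ne_zero h0 (Or.inl h8) h3 h1)

theorem maxPosZeros_eq_six {k : ℝ} (h0 : 0 < k) (h1 : k ≠ 1) (h2 : k ≠ 2) (h3 : k ≠ 2 / 3)
    (h : ImageZerosLE k 1) : maxPosZeros (G9 k) = 6 :=
  le_antisymm (maxPosZeros_le h0 h1 h2 h3 h) (six_le_maxPosZeros h0 h1 h2 h3 h)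

theorem maxPosZeros_eq_seven {k : ℝ} (h0 : 0 < k) (h1 : k ≠ 1) (h2 : k ≠ 2) (h3 : k ≠ 2 / 3)
    (h : ImageZerosLE k 2) (hE : ∃ s > 0, polyE k s = 0) : maxPosZeros (G9 k) = 7 :=
  le_antisymm (maxPosZeros_le h0 h1 h2 h3 h) (seven_le_maxPosZeros h0 h1 h2 h3 h hE)

end ChebyshevFamily

/-! ### Assembly of the parameter ranges -/

theorem proposition8 :
    ∃ k₀ k₁ k₂ k₃ k₄ k₅ : ℝ,
      IsTheRootIn q2 0 (1 / 5) k₀ ∧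
      (IsTheRootIn q1 0 (1 / 5) k₁ ∧ Irrational k₁) ∧
      (IsTheRootIn q2 (1 / 5) (1 / 3) k₂ ∧ Irrational k₂) ∧
      (IsTheRootIn q2 (3 / 2) 2 k₃ ∧ Irrational k₃) ∧
      (IsTheRootIn q3 3 4 k₄ ∧ Irrational k₄) ∧
      (IsTheRootIn q2 3 4 k₅ ∧ Irrational k₅) ∧
      (∀ k ∈ Set.Ioc (0 : ℝ) 5 \ {k₀, k₁, k₂, k₃, k₄, k₅, 2, 1, 3 / 2, 2 / 3},
        6 ≤ maxPosZeros (G9 k) ∧ maxPosZeros (G9 k) ≤ 11) ∧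
      (∀ k ∈ Set.Ioo (1 / 5) k₂ ∪ Set.Ioo (2 / 3) (3 / 4) ∪ Set.Ico (4 / 5) 1 ∪
          Set.Ioc 1 (4 / 3) ∪ Set.Ioo (3 / 2) k₃,
        maxPosZeros (G9 k) = 6) ∧
      (∀ k ∈ Set.Ioo k₁ (1 / 5) ∪ Set.Ioo (1 / 3) (1 / 2) ∪ Set.Ioo (1 / 2) (2 / 3) ∪
          Set.Ioo (3 / 4) (4 / 5) ∪ Set.Ioo (4 / 3) (3 / 2) ∪ Set.Ioc k₅ 5,
        maxPosZeros (G9 k) = 7) ∧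
      (∀ k ∈ Set.Ioo k₂ (1 / 3) ∪ Set.Ioo k₃ 2 ∪ Set.Ioo 2 3,
        7 ≤ maxPosZeros (G9 k) ∧ maxPosZeros (G9 k) ≤ 8) ∧
      (∀ k ∈ Set.Ioo k₄ k₅,
        7 ≤ maxPosZeros (G9 k) ∧ maxPosZeros (G9 k) ≤ 9) := by
  obtain ⟨k₀, -, hk₀⟩ := exists_root_q2_zero
  obtain ⟨k₁, ⟨b₁, b₁'⟩, hk₁⟩ := exists_root_q1
  obtain ⟨k₂, ⟨b₂, b₂'⟩, hk₂⟩ := exists_root_q2_fifth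
  obtain ⟨k₃, ⟨b₃, b₃'⟩, hk₃⟩ := exists_root_q2_three_half
  obtain ⟨k₄, ⟨b₄, b₄'⟩, hk₄⟩ := exists_root_q3
  obtain ⟨k₅, ⟨b₅, b₅'⟩, hk₅⟩ := exists_root_q2_three
  refine ⟨k₀, k₁, k₂, k₃, k₄, k₅, hk₀, ⟨hk₁, irrational_of_q1 hk₁.root⟩,
    ⟨hk₂, irrational_of_q2 hk₂.root⟩, ⟨hk₃, irrational_of_q2 hk₃.root⟩,
    ⟨hk₄, irrational_of_q3 hk₄.root⟩, ⟨hk₅, irrational_of_q2 hk₅.root⟩, ?_, ?_, ?_, ?_, ?_⟩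
  · rintro k ⟨⟨h0, h5⟩, hk⟩
    simp only [Set.mem_insert_iff, Set.mem_singleton_iff, not_or] at hk
    obtain ⟨-, -, -, -, -, -, h2, h1, h32, h23⟩ := hk
    have h := imageZerosLE_six h0 h5 h23 h32
    exact ⟨six_le_maxPosZeros h0 h1 h2 h23 h, maxPosZeros_le h0 h1 h2 h23 h⟩
  · rintro k ((((⟨h, h'⟩ | ⟨h, h'⟩) | ⟨h, h'⟩) | ⟨h, h'⟩) | ⟨h, h'⟩)
    · exact maxPosZeros_eq_six (by linarith) (by linarith) (by linarith) (by linarith)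
        (imageZerosLE_of_lt_root_fifth hk₂ (by linarith) h h')
    · exact maxPosZeros_eq_six (by linarith) (by linarith) (by linarith) h.ne'
        (imageZerosLE_of_lt_three_quarters h h')
    · exact maxPosZeros_eq_six (by linarith) h'.ne (by linarith) (by linarith)
        (imageZerosLE_of_le_four_thirds h (by linarith))
    · exact maxPosZeros_eq_six (by linarith) h.ne' (by linarith) (by linarith)
        (imageZerosLE_of_le_four_thirds (by linarith) h')
    · exact maxPosZeros_eq_six (by linarith) (by linarith) (by linarith) (by linarith)
        (imageZerosLE_of_lt_root_three_half hk₃ (by linarith) h h')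
  · rintro k (((((⟨h, h'⟩ | ⟨h, h'⟩) | ⟨h, h'⟩) | ⟨h, h'⟩) | ⟨h, h'⟩) | ⟨h, h'⟩)
    · exact maxPosZeros_eq_seven (by linarith) (by linarith) (by linarith) (by linarith)
        (imageZerosLE_of_lt_fifth (by linarith) h')
        (exists_polyE_root_of_lt_fifth (by linarith) h')
    · exact maxPosZeros_eq_seven (by linarith) (by linarith) (by linarith) (by linarith)
        (imageZerosLE_of_lt_half h h') (exists_polyE_root_of_lt_half h h')
    · exact maxPosZeros_eq_seven (by linarith) (by linarith) (by linarith) h'.ne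
        (imageZerosLE_of_lt_two_thirds h h') (exists_polyE_root_of_lt_two_thirds h h')
    · exact maxPosZeros_eq_seven (by linarith) (by linarith) (by linarith) (by linarith)
        (imageZerosLE_of_lt_four_fifths h h') (exists_polyE_root_of_lt_four_fifths h h')
    · exact maxPosZeros_eq_seven (by linarith) (by linarith) (by linarith) (by linarith)
        (imageZerosLE_of_lt_three_half h h') (exists_polyE_root_of_lt_three_half h h')
    · exact maxPosZeros_eq_seven (by linarith) (by linarith) (by linarith) (by linarith)
        (imageZerosLE_of_gt_root_three hk₅ (by linarith) h h')
        (exists_polyE_root_of_gt_three (by linarith) h')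
  · have key : ∀ k, 0 < k → k ≠ 1 → k ≠ 2 → k ≠ 2 / 3 → ImageZerosLE k 3 →
        (∃ s > 0, polyE k s = 0) → 7 ≤ maxPosZeros (G9 k) ∧ maxPosZeros (G9 k) ≤ 8 :=
      fun k h0 h1 h2 h3 h hE =>
        ⟨seven_le_maxPosZeros h0 h1 h2 h3 h hE, maxPosZeros_le h0 h1 h2 h3 h⟩
    rintro k ((⟨h, h'⟩ | ⟨h, h'⟩) | ⟨h, h'⟩)
    · exact key k (by linarith) (by linarith) (by linarith) (by linarith)
        (imageZerosLE_of_lt_third (by linarith) h')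
        (exists_polyE_root_of_gt_fifth hk₂ (by linarith) h h')
    · exact key k (by linarith) (by linarith) h'.ne (by linarith)
        (imageZerosLE_of_lt_three (by linarith) (by linarith) h'.ne)
        (exists_polyE_root_of_gt_three_half hk₃ (by linarith) h (by linarith))
    · exact key k (by linarith) (by linarith) h.ne' (by linarith)
        (imageZerosLE_of_lt_three (by linarith) h' h.ne')
        (exists_polyE_root_of_gt_three_half hk₃ (by linarith) (by linarith) h')
  · rintro k ⟨h, h'⟩
    have hE := exists_polyE_root_of_gt_three (k := k) (by linarith) (by linarith)
    have hI := imageZerosLE_of_gt_root_q3 hk₄ (by linarith) h (by linarith)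
    exact ⟨seven_le_maxPosZeros (by linarith) (by linarith) (by linarith) (by linarith) hI hE,
      maxPosZeros_le (by linarith) (by linarith) (by linarith) (by linarith) hI⟩
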